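/- Let $S$ be a compact connected oriented surface with non-empty boundary and $\chi(S)=-s<0$, and let $T$ be an ideal triangulation of $S$ (a maximal family of $3s$ pairwise disjoint simple arcs between boundary points, realised by orthogeodesics for each hyperbolic structure with geodesic boundary) such that the $2s$ complementary right-angled hexagons split into two classes $H_1,\dots,H_s$ and $H^c_1,\dots,H^c_s$, no two hexagons of the same class being adjacent. Let $\mathbb G$ be the trivalent graph dual to $T$. The coordinates of $m\in\mathcal T(S)$ are the lengths $(b_1,\dots,b_{3s})$ of the boundary segments contained in $H_1,\dots,H_s$. Let $\mathcal C$ be the set of all $(b_1,\dots,b_{3s})\in\mathbb R^{3s}$ such that the triple $(b_i,b_j,b_k)$ belonging to each hexagon $H_n$ satisfies the strict triangle inequalities (so all $b_i>0$), and let $\mathcal C_1=\{b\in\mathcal C:\sum_i b_i=1\}$. A metric on $\mathbb G$ is a positive length $l(e)$ for each edge $e$; its entropy is $h(l)=\lim_{R\to\infty}\frac1R\log\#\{\text{oriented closed geodesics of }l\text{-length}<R\}$, and $\mathcal M_1(\mathbb G)$ is the set of metrics with $h(l)=1$. For $b\in\mathcal C$, a ray of $b$ is a family $(m_\lambda)_{\lambda>0}$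 in $\mathcal T(S)$ such that $m_\lambda$ has coordinates $\lambda b$. Given factors $s_\lambda>0$, we say that $s_\lambda m_\lambda$ (the surface with its distance multiplied by $s_\lambda$) degenerates to $(\mathbb G,l)$ as $\lambda\to\infty$ if it converges to the metric graph in the marked Gromov--Hausdorff sense: for every $\varepsilon>0$ and all large $\lambda$ there is a map from the surface to $\mathbb G$ which changes distances by less than $\varepsilon$, has $\varepsilon$-dense image, sends each arc of $T$ to the midpoint of the dual edge, and sends each hexagon into the union of the three half-edges at the dual vertex. A metric $l$ is a projective limit of $(m_\lambda)$ if $s_\lambda m_\lambda$ degenerates to $(\mathbb G,l)$ for some factors $s_\lambda>0$. Theorem. (1) For every $b\in\mathcal C$ there is a ray of $b$ in $\mathcal T(S)$. (2) For every $b\in\mathcal C_1$ there is exactly one metric $l$ on $\mathbb G$ such that, for each ray $(m_\lambda)$ of $b$, the rescaled surfaces $\lambda^{-1}m_\lambda$ degenerate to $(\mathbb G,l)$. (3) For every $b\in\mathcal C_1$ there is exactly one $l\in\mathcal M_1(\mathbb G)$ which is a projective limit of each ray of $b$. (4) For every $l\in\mathcal M_1(\mathbb G)$ there is exactly one $b\in\mathcal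 C_1$ such that $l$ is a projective limit of each ray of $b$. Thus the projective limits of the rays in $\mathcal C$ are exactly the points of $\mathcal M_1(\mathbb G)$, and different points of $\mathcal C_1$ have different projective limits. -/

import Mathlib

open Filter Topology
open scoped UpperHalfPlane

noncomputable section

/-! ### Half-planes and right-angled hexagons in the hyperbolic plane `ℍ` -/

/-- A closed half-plane of the hyperbolic plane bounded by a complete geodesic: the set where
`p |z|² + 2 q Re z + r ≥ 0`, normalised by `q² - p r = 1`. -/
structure HalfPlane where
  p : ℝ
  q : ℝ
  r : ℝ
  norm_eq : q ^ 2 - p * r = 1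

namespace HalfPlane

/-- The hyperbolic sine of the signed distance of `z` to the bounding geodesic
(positive inside the half-plane). -/
def val (u : HalfPlane) (z : ℍ) : ℝ :=
  (u.p * (z.re ^ 2 + z.im ^ 2) + 2 * u.q * z.re + u.r) / (2 * z.im)

/-- The closed half-plane as a set of points. -/
def carrier (u : HalfPlane) : Set ℍ := {z | 0 ≤ u.val z}

/-- The Lorentzian product of the unit normals. It vanishes iff the bounding geodesics are
perpendicular. It is `< -1` iff the bounding geodesics are disjoint, at positive distance `d`, and
the intersection of the two half-planes is the strip between them; it is then `- cosh d`. -/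
def inner (u v : HalfPlane) : ℝ := u.q * v.q - (u.p * v.r + u.r * v.p) / 2

end HalfPlane

/-- A compact right-angled hexagon in the hyperbolic plane, with its six sides cyclically named
`b₀, a₂, b₁, a₀, b₂, a₁` (so `aᵢ` is opposite to `bᵢ`, and lies between `bᵢ₊₁` and `bᵢ₊₂`). Each
side is given by the half-plane that it bounds and that contains the hexagon. Adjacent sides are
perpendicular, non-adjacent sides lie on disjoint geodesics. The point `corner i j`, for `i ≠ j`, is
the common vertex of the sides `bᵢ` and `aⱼ` (`corner i i` is not used). -/
structure RightAngledHexagon where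
  bSide : Fin 3 → HalfPlane
  aSide : Fin 3 → HalfPlane
  adjacent : ∀ i j, i ≠ j → (bSide i).inner (aSide j) = 0
  opposite : ∀ i, (bSide i).inner (aSide i) < -1
  bSides : ∀ i j, i ≠ j → (bSide i).inner (bSide j) < -1
  aSides : ∀ i j, i ≠ j → (aSide i).inner (aSide j) < -1
  corner : Fin 3 → Fin 3 → ℍ
  corner_mem : ∀ i j, i ≠ j → (bSide i).val (corner i j) = 0 ∧ (aSide j).val (corner i j) = 0

namespace RightAngledHexagon

/-- The closed hexagon. -/
def region (P : RightAngledHexagon) : Set ℍ :=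
  {z | ∀ i, z ∈ (P.bSide i).carrier ∧ z ∈ (P.aSide i).carrier}

/-- The side `aⱼ`. -/
def arc (P : RightAngledHexagon) (j : Fin 3) : Set ℍ := {z ∈ P.region | (P.aSide j).val z = 0}

/-- The length of the side `bᵢ`. -/
def bLength (P : RightAngledHexagon) (i : Fin 3) : ℝ :=
  dist (P.corner i (i + 1)) (P.corner i (i + 2))

/-- The length of the side `aⱼ`. -/
def aLength (P : RightAngledHexagon) (j : Fin 3) : ℝ :=
  dist (P.corner (j + 1) j) (P.corner (j + 2) j)

end RightAngledHexagon

/-! ### Hyperbolic surfaces with geodesic boundary -/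

/-- A compact connected hyperbolic surface with (possibly empty) geodesic boundary, given by its
Riemannian distance: a compact connected length space in which every point has a ball isometric to
a ball of a closed half-plane of `ℍ` (centred at an interior or at a boundary point of it). -/
structure IsHyperbolicSurface (X : Type) [MetricSpace X] : Prop where
  compact : CompactSpace X
  connected : ConnectedSpace X
  length_metric : ∀ x y : X, ∀ ε > 0, ∃ γ : Path x y,
    eVariationOn γ Set.univ ≤ ENNReal.ofReal (dist x y + ε)
  local_model : ∀ x : X, ∃ r > 0, ∃ (u : HalfPlane) (φ : X → ℍ),
    (∀ y ∈ Metric.ball x r, ∀ z ∈ Metric.ball x r, dist (φ y) (φ z) = dist y z) ∧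
      φ '' Metric.ball x r = Metric.ball (φ x) r ∩ u.carrier

/-! ### Trivalent bipartite fat graphs -/

/-- A connected trivalent fat graph whose vertices are split into two classes `W` and `B`, each edge
joining the two classes. Equivalently, an ideal triangulation `T` of an oriented bordered surface
with complementary hexagons `H n` (`n : W`) and `Hᶜ m` (`m : B`) such that no two hexagons of the
same class are adjacent. The edges at a vertex, i.e. the arcs of `T` on the boundary of a hexagon,
are numbered by `Fin 3` in their cyclic order. The edges (arcs) are thus the pairs `(n, i)`, and
`glue (n, i) = (m, j)` says that the `i`-th arc of `H n` is the `j`-th arc of `Hᶜ m`. -/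
structure FatGraph where
  W : Type
  B : Type
  [fintypeW : Fintype W]
  [fintypeB : Fintype B]
  glue : W × Fin 3 ≃ B × Fin 3
  connected : (SimpleGraph.fromRel (fun x y : W ⊕ B =>
    ∃ e : W × Fin 3, x = Sum.inl e.1 ∧ y = Sum.inr (glue e).1)).Connected

attribute [instance] FatGraph.fintypeW FatGraph.fintypeB

namespace FatGraph

variable (G : FatGraph)

/-- The edges of the graph, dual to the arcs of the ideal triangulation. -/
abbrev Edge : Type := G.W × Fin 3

/-- The vertices of the graph, dual to the hexagons. -/
abbrev Vertex : Type := G.W ⊕ G.B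

/-! ### Teichmüller space and orthogeodesic coordinates -/

/-- A point of the Teichmüller space of the oriented bordered surface `S` of the fat graph: a
hyperbolic surface with geodesic boundary marked by `S`, where the marking carries the arcs of the
ideal triangulation `T` to orthogeodesics, which cut the surface into right-angled hexagons. The
marking is recorded by the labels of the hexagons and of their sides: the hexagon `hex v` is mapped
locally isometrically onto the part of the surface labelled by the vertex `v`, and two hexagons meet
exactly along the arcs that are glued by the fat graph. The sides `bᵢ` lie on the boundary of the
surface and the sides `aᵢ` are the arcs of `T`; the gluing reverses the direction of the
arcs, for the boundary orientations of the two hexagons. -/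
structure Teich where
  Carrier : Type
  [metric : MetricSpace Carrier]
  hyperbolic : IsHyperbolicSurface Carrier
  hex : G.Vertex → RightAngledHexagon
  tile : G.Vertex → ℍ → Carrier
  tile_isometry : ∀ v, ∀ x ∈ (hex v).region, ∃ r > 0,
    ∀ y ∈ (hex v).region ∩ Metric.ball x r, ∀ z ∈ (hex v).region ∩ Metric.ball x r,
      dist (tile v y) (tile v z) = dist y z
  cover : ∀ x : Carrier, ∃ v, ∃ z ∈ (hex v).region, tile v z = x
  arc_length : ∀ e : G.Edge,
    (hex (Sum.inl e.1)).aLength e.2 = (hex (Sum.inr (G.glue e).1)).aLength (G.glue e).2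
  tile_white : ∀ n n', ∀ z ∈ (hex (Sum.inl n)).region, ∀ z' ∈ (hex (Sum.inl n')).region,
    tile (Sum.inl n) z = tile (Sum.inl n') z' ↔ n = n' ∧ z = z'
  tile_black : ∀ m m', ∀ z ∈ (hex (Sum.inr m)).region, ∀ z' ∈ (hex (Sum.inr m')).region,
    tile (Sum.inr m) z = tile (Sum.inr m') z' ↔ m = m' ∧ z = z'
  tile_glue : ∀ n m, ∀ z ∈ (hex (Sum.inl n)).region, ∀ z' ∈ (hex (Sum.inr m)).region,
    tile (Sum.inl n) z = tile (Sum.inr m) z' ↔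
      ∃ i j, G.glue (n, i) = (m, j) ∧ z ∈ (hex (Sum.inl n)).arc i ∧
        z' ∈ (hex (Sum.inr m)).arc j ∧
        dist z ((hex (Sum.inl n)).corner (i + 1) i) = dist z' ((hex (Sum.inr m)).corner (j + 2) j)

attribute [instance] Teich.metric

variable {G}

/-- The orthogeodesic coordinates `(b₁, …, b₃ₛ)`: the lengths of the boundary segments contained in
the hexagons `H n`. The coordinate `(n, i)` belongs to the side opposite to the arc `(n, i)`. -/
def Teich.coord (m : G.Teich) : G.W × Fin 3 → ℝ := fun k => (m.hex (Sum.inl k.1)).bLength k.2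

variable (G)

/-- The open cone of coordinates such that the triple of each hexagon `H n` satisfies the strict
triangle inequalities. -/
def cone : Set (G.W × Fin 3 → ℝ) := {b | ∀ n i, b (n, i) < b (n, i + 1) + b (n, i + 2)}

/-- The points of the cone whose coordinates have sum `1`. -/
def unitCone : Set (G.W × Fin 3 → ℝ) := {b ∈ G.cone | ∑ k, b k = 1}

variable {G}

/-- `m` is the ray `m λ = (λ b₁, …, λ b₃ₛ)`, `λ > 0`, in Teichmüller space. -/
def IsRay (b : G.W × Fin 3 → ℝ) (m : ℝ → G.Teich) : Prop := ∀ t > 0, (m t).coord = t • b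

/-! ### Metric graphs -/

variable (G)

/-- Metrics on the graph: positive edge lengths. -/
def metrics : Set (G.Edge → ℝ) := {l | ∀ e, 0 < l e}

/-- Points of the geometric realisation of the graph: `(e, t)` is the point of the edge `e` which
divides it in the ratio `t : 1 - t`, from its end in `W` to its end in `B`. (The end points of
edges with a common end are different here, but they have distance `0` below.) -/
abbrev Point : Type := G.Edge × Set.Icc (0 : ℝ) 1

variable {G}

/-- `PathOfLength l x y r`: the points `x` and `y` of the graph are joined by a path which is
composed of finitely many segments of edges and has `l`-length `r`. -/
inductive PathOfLength (l : G.Edge → ℝ) (x : G.Point) : G.Point → ℝ → Prop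
  | refl : PathOfLength l x x 0
  | segment (e : G.Edge) (t t' : Set.Icc (0 : ℝ) 1) (r : ℝ) :
      PathOfLength l x (e, t) r → PathOfLength l x (e, t') (r + l e * |(t : ℝ) - t'|)
  | white (e e' : G.Edge) (r : ℝ) : e.1 = e'.1 →
      PathOfLength l x (e, 0) r → PathOfLength l x (e', 0) r
  | black (e e' : G.Edge) (r : ℝ) : (G.glue e).1 = (G.glue e').1 →
      PathOfLength l x (e, 1) r → PathOfLength l x (e', 1) r

/-- The path metric of the metric graph. -/
def graphDist (l : G.Edge → ℝ) (x y : G.Point) : ℝ := sInf {r | PathOfLength l x y r}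

variable (G)

/-- Oriented edges; `true` stands for the direction from `W` to `B`. -/
abbrev OrientedEdge : Type := G.Edge × Bool

variable {G}

/-- The initial vertex of an oriented edge. -/
def tail (o : G.OrientedEdge) : G.Vertex :=
  if o.2 then Sum.inl o.1.1 else Sum.inr (G.glue o.1).1

/-- The opposite oriented edge. -/
def reverse (o : G.OrientedEdge) : G.OrientedEdge := (o.1, !o.2)

/-- The final vertex of an oriented edge. -/
def head (o : G.OrientedEdge) : G.Vertex := tail (reverse o)

/-- Oriented geodesics: bi-infinite edge paths without backtracking. -/
def IsGeodesic (γ : ℤ → G.OrientedEdge) : Prop :=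
  ∀ k, tail (γ (k + 1)) = head (γ k) ∧ γ (k + 1) ≠ reverse (γ k)

/-- The shift on bi-infinite sequences. -/
def shift (γ : ℤ → G.OrientedEdge) : ℤ → G.OrientedEdge := fun k => γ (k + 1)

/-- The oriented closed geodesics of `l`-length less than `T`: the shift orbits of the periodic
oriented geodesics, the length being the sum of the edge lengths over the least period. -/
def closedGeodesics (l : G.Edge → ℝ) (T : ℝ) : Set (Set (ℤ → G.OrientedEdge)) :=
  {O | ∃ γ : ℤ → G.OrientedEdge, IsGeodesic γ ∧ 0 < Function.minimalPeriod shift γ ∧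
    O = Set.range (fun (k : ℤ) (j : ℤ) => γ (j + k)) ∧
    ∑ i ∈ Finset.range (Function.minimalPeriod shift γ), l (γ (i : ℤ)).1 < T}

/-- The topological entropy of the metric `l` is `h`. -/
def HasEntropy (l : G.Edge → ℝ) (h : ℝ) : Prop :=
  Tendsto (fun T : ℝ => Real.log ((closedGeodesics l T).ncard : ℝ) / T) atTop (𝓝 h)

variable (G)

/-- The moduli space `M₁(G)` of metrics of topological entropy `1`. -/
def moduliOne : Set (G.Edge → ℝ) := {l ∈ G.metrics | HasEntropy l 1}

variable {G}

/-! ### Degeneration of hyperbolic surfaces to metric graphs -/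

/-- The map `f` is a marked Gromov–Hausdorff `ε`-approximation from the surface `m`, with its
distance multiplied by `s`, to the graph with the metric `l`: it distorts distances by less than
`ε`, its image is `ε`-dense, it sends each arc of the ideal triangulation to the midpoint of the dual
edge, and each hexagon to the union of the half-edges at the dual vertex. -/
structure IsMarkedApprox (m : G.Teich) (s : ℝ) (l : G.Edge → ℝ) (ε : ℝ)
    (f : m.Carrier → G.Point) : Prop where
  distortion : ∀ x y, |s * dist x y - graphDist l (f x) (f y)| < ε
  dense : ∀ p, ∃ x, graphDist l p (f x) < ε
  arc : ∀ e : G.Edge, ∀ z ∈ (m.hex (Sum.inl e.1)).arc e.2,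
    (f (m.tile (Sum.inl e.1) z)).1 = e ∧ ((f (m.tile (Sum.inl e.1) z)).2 : ℝ) = 1 / 2
  white : ∀ n, ∀ z ∈ (m.hex (Sum.inl n)).region,
    (f (m.tile (Sum.inl n) z)).1.1 = n ∧ ((f (m.tile (Sum.inl n) z)).2 : ℝ) ≤ 1 / 2
  black : ∀ n, ∀ z ∈ (m.hex (Sum.inr n)).region,
    (G.glue (f (m.tile (Sum.inr n) z)).1).1 = n ∧ 1 / 2 ≤ ((f (m.tile (Sum.inr n) z)).2 : ℝ)

/-- The surfaces `m t`, with their distances multiplied by `s t`, converge to the graph with the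
metric `l`, in the marked Gromov–Hausdorff sense, as `t → ∞`. -/
def DegeneratesTo (m : ℝ → G.Teich) (s : ℝ → ℝ) (l : G.Edge → ℝ) : Prop :=
  ∀ ε > 0, ∀ᶠ t in atTop, ∃ f, IsMarkedApprox (m t) (s t) l ε f

/-- The metric `l` is a projective limit of the surfaces `m t` as `t → ∞`: a limit after
multiplication of the distances by suitable positive factors. -/
def IsProjectiveLimit (m : ℝ → G.Teich) (l : G.Edge → ℝ) : Prop :=
  ∃ s : ℝ → ℝ, (∀ t > 0, 0 < s t) ∧ DegeneratesTo m s l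

end FatGraph

end

open Filter Topology
open scoped UpperHalfPlane

noncomputable section


/-! Half-planes are unit spacelike vectors of Minkowski space and points of the hyperbolic plane are
timelike ones. A right-angled hexagon becomes a triple of vectors with a given Gram matrix together
with its normalised dual basis, and the basic distance inequalities come from the sign of a Gram
determinant (`gram_nonpos`).

Rays exist because the lengths of three alternating sides of a hexagon can be prescribed
(`exists_of_bLength`). The white hexagons are built from the coordinates; this determines the
lengths of the arcs, and the black hexagons are built from those. The hexagons are glued through a
pseudometric given by chains of segments. Around each point two adjacent hexagons develop
isometrically into the plane (`EdgeChart.dist_eq`), so the quotient is a hyperbolic surface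
(`isHyperbolicSurface`, `exists_teich`).

For the limit, put `l i = b (i+1) + b (i+2) - b i` in each white hexagon; positivity of `l` is
exactly the strict triangle inequality. With `Λ = t l / 2` the sides have lengths `t b i = Λ (i+1) +
Λ (i+2)`, so up to bounded additive errors the hexagon is a tripod with legs `Λ i`, and the law of
cosines makes `cosh (a i) - 1` comparable to `exp (-2 Λ i)`. The adjacent black hexagons have the
same arc lengths, which force them to be tripods with the same legs (`isLong_of_bLength`,
`isLong_of_aLength`). Two legs meet at each arc, so the dual edge has length `2 Λ = t l`, and the
bounded errors disappear after division by `t`. In `exists_markedApprox`, upper bounds on distances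
come from chaining along edges (`dist_le_graphDist`), lower bounds from a projection to the graph
that is nearly 1-Lipschitz (`graphDist_le_dist`).

For uniqueness, the marking sends arcs to midpoints of edges, so two limits have proportional
distances between midpoints. At a white vertex these distances are `(l i + l j) / 2`, and they
determine `l` (`DegeneratesTo.eq_smul`). Moreover `b ↦ l` is linear, injective, and maps the cone
onto all metrics. Thus directions in the cone correspond to metrics up to scale. The entropy exists,
is positive and is homogeneous of degree `-1` (`exists_entropy`, `HasEntropy.smul`), so each class
contains exactly one metric of entropy 1, just as each direction contains exactly one point of
coordinate sum 1. -/

/-! ### The Minkowski model -/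

/-- Three-dimensional Minkowski space, in coordinates adapted to `HalfPlane`. -/
abbrev Mink : Type := ℝ × ℝ × ℝ

lemma abs_eq_abs_of_cosh_eq {a b : ℝ} (h : Real.cosh a = Real.cosh b) : |a| = |b| :=
  le_antisymm (Real.cosh_le_cosh.1 h.le) (Real.cosh_le_cosh.1 h.ge)

/-- The Lorentzian product. -/
def mink (x y : Mink) : ℝ := x.2.1 * y.2.1 - (x.1 * y.2.2 + x.2.2 * y.1) / 2

lemma mink_comm (x y : Mink) : mink x y = mink y x := by unfold mink; ring
@[simp] lemma mink_add_left (x y z : Mink) : mink (x + y) z = mink x z + mink y z := by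
  simp only [mink, Prod.fst_add, Prod.snd_add]; ring
@[simp] lemma mink_add_right (x y z : Mink) : mink x (y + z) = mink x y + mink x z := by
  simp only [mink, Prod.fst_add, Prod.snd_add]; ring
@[simp] lemma mink_sub_left (x y z : Mink) : mink (x - y) z = mink x z - mink y z := by
  simp only [mink, Prod.fst_sub, Prod.snd_sub]; ring
@[simp] lemma mink_sub_right (x y z : Mink) : mink x (y - z) = mink x y - mink x z := by
  simp only [mink, Prod.fst_sub, Prod.snd_sub]; ring
@[simp] lemma mink_smul_left (a : ℝ) (x z : Mink) : mink (a • x) z = a * mink x z := by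
  simp only [mink, Prod.smul_fst, Prod.smul_snd, smul_eq_mul]; ring
@[simp] lemma mink_smul_right (a : ℝ) (x z : Mink) : mink x (a • z) = a * mink x z := by
  simp only [mink, Prod.smul_fst, Prod.smul_snd, smul_eq_mul]; ring
@[simp] lemma mink_neg_left (x z : Mink) : mink (-x) z = -mink x z := by
  simp only [mink, Prod.fst_neg, Prod.snd_neg]; ring
@[simp] lemma mink_neg_right (x z : Mink) : mink x (-z) = -mink x z := by
  simp only [mink, Prod.fst_neg, Prod.snd_neg]; ring

/-- The Gram determinant of three vectors. -/
def gram (x y z : Mink) : ℝ :=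
  mink x x * (mink y y * mink z z - mink y z ^ 2)
    - mink x y * (mink x y * mink z z - mink y z * mink x z)
    + mink x z * (mink x y * mink y z - mink y y * mink x z)

/-- The determinant of three vectors. -/
def mdet (x y z : Mink) : ℝ :=
  x.1 * (y.2.1 * z.2.2 - y.2.2 * z.2.1) - x.2.1 * (y.1 * z.2.2 - y.2.2 * z.1)
    + x.2.2 * (y.1 * z.2.1 - y.2.1 * z.1)

/-- The matrix of the form in these coordinates has determinant `-1/4`, which reflects the signature
`(2,1)`. -/
lemma gram_eq (x y z : Mink) : gram x y z = -(mdet x y z) ^ 2 / 4 := by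
  unfold gram mdet mink; ring

lemma gram_nonpos (x y z : Mink) : gram x y z ≤ 0 := by
  rw [gram_eq]; nlinarith [sq_nonneg (mdet x y z)]

/-- A nonzero Gram determinant makes the three vectors a basis, and the form is nondegenerate. The
coefficients in the proof are those of Cramer's rule. Expansions in adapted bases are proved by this
criterion. -/
lemma Mink.ext_of_mink {x y z : Mink} (h : gram x y z ≠ 0) {u v : Mink}
    (hx : mink x u = mink x v) (hy : mink y u = mink y v) (hz : mink z u = mink z v) : u = v := by
  have hd : mdet x y z ≠ 0 := by
    intro h0; apply h; rw [gram_eq, h0]; simp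
  obtain ⟨x1, x2, x3⟩ := x
  obtain ⟨y1, y2, y3⟩ := y
  obtain ⟨z1, z2, z3⟩ := z
  obtain ⟨u1, u2, u3⟩ := u
  obtain ⟨v1, v2, v3⟩ := v
  simp only [mink, mdet] at *
  have e1 : u1 = v1 := by
    apply mul_left_cancel₀ hd
    linear_combination (-2) * (x1 * y2 - x2 * y1) * hz + (2) * (x1 * z2 - x2 * z1) * hy
      - 2 * (y1 * z2 - y2 * z1) * hx
  have e2 : u2 = v2 := by
    apply mul_left_cancel₀ hd
    linear_combination (- (x1 * y3 - x3 * y1)) * hz + (x1 * z3 - x3 * z1) * hy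
      - (y1 * z3 - y3 * z1) * hx
  have e3 : u3 = v3 := by
    apply mul_left_cancel₀ hd
    linear_combination (-2) * (x2 * y3 - x3 * y2) * hz + (2) * (x2 * z3 - x3 * z2) * hy
      - 2 * (y2 * z3 - y3 * z2) * hx
  rw [e1, e2, e3]

/-- The cross product. -/
lemma exists_cross (x y : Mink) :
    ∃ n : Mink, mink n x = 0 ∧ mink n y = 0 ∧
      mink n n = mink x y ^ 2 - mink x x * mink y y := by
  obtain ⟨x1, x2, x3⟩ := x
  obtain ⟨y1, y2, y3⟩ := y
  refine ⟨((x1 * y2 - x2 * y1), (x1 * y3 - x3 * y1) / 2, (x2 * y3 - x3 * y2)), ?_, ?_, ?_⟩ <;>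
  · simp only [mink]; ring

/-- The normal vector of a half-plane. -/
def HalfPlane.normal (u : HalfPlane) : Mink := (u.p, u.q, u.r)

/-- The point of the hyperboloid which corresponds to a point of `ℍ`. -/
def pointVec (z : ℍ) : Mink := (-1 / z.im, z.re / z.im, -(z.re ^ 2 + z.im ^ 2) / z.im)

lemma HalfPlane.inner_eq (u v : HalfPlane) : u.inner v = mink u.normal v.normal := rfl

lemma HalfPlane.inner_comm (u v : HalfPlane) : u.inner v = v.inner u := by
  rw [HalfPlane.inner_eq, mink_comm]; rfl

@[simp] lemma HalfPlane.normal_self (u : HalfPlane) : mink u.normal u.normal = 1 := by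
  have := u.norm_eq
  simp only [mink, HalfPlane.normal]; linarith

lemma HalfPlane.val_eq (u : HalfPlane) (z : ℍ) : u.val z = mink u.normal (pointVec z) := by
  have := z.im_pos.ne'
  simp only [mink, HalfPlane.normal, HalfPlane.val, pointVec]
  field_simp; ring

lemma exists_halfPlane {x : Mink} (h : mink x x = 1) : ∃ u : HalfPlane, u.normal = x :=
  ⟨⟨x.1, x.2.1, x.2.2, by simp only [mink] at h; linarith⟩, rfl⟩

lemma mink_point (z w : ℍ) : mink (pointVec z) (pointVec w) = -Real.cosh (dist z w) := by
  have h1 := z.im_pos.ne'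
  have h2 := w.im_pos.ne'
  rw [UpperHalfPlane.cosh_dist']
  simp only [mink, pointVec]
  field_simp; ring

@[simp] lemma mink_point_self (z : ℍ) : mink (pointVec z) (pointVec z) = -1 := by
  rw [mink_point]; simp

lemma pointVec_injective : Function.Injective pointVec := by
  intro z w h
  have : Real.cosh (dist z w) = 1 := by
    have := mink_point z w
    rw [h, mink_point_self] at this; linarith
  have h0 : dist z w = 0 := by
    by_contra h0
    have := Real.one_lt_cosh.2 h0
    linarith
  exact dist_eq_zero.1 h0

lemma exists_point_of_neg {x : Mink} (h : mink x x = -1) (h1 : x.1 < 0) :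
    ∃ z : ℍ, pointVec z = x := by
  obtain ⟨p, q, r⟩ := x
  simp only [mink] at h h1
  have hy : 0 < -1 / p := div_pos_of_neg_of_neg (by norm_num) h1
  refine ⟨UpperHalfPlane.mk ⟨-q / p, -1 / p⟩ hy, ?_⟩
  have hp := h1.ne
  have h2 : r * p = q ^ 2 + 1 := by linarith
  have e1 : (UpperHalfPlane.mk ⟨-q / p, -1 / p⟩ hy).re = -q / p := rfl
  have e2 : (UpperHalfPlane.mk ⟨-q / p, -1 / p⟩ hy).im = -1 / p := rfl
  simp only [pointVec, e1, e2, Prod.mk.injEq]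
  refine ⟨by field_simp, by field_simp, ?_⟩
  field_simp; linarith

/-- The hyperboloid has two sheets; `pointVec` parametrises the one with negative first coordinate.
-/
lemma exists_point_or {x : Mink} (h : mink x x = -1) :
    ∃ z : ℍ, pointVec z = x ∨ pointVec z = -x := by
  rcases lt_trichotomy x.1 0 with h1 | h1 | h1
  · obtain ⟨z, hz⟩ := exists_point_of_neg h h1
    exact ⟨z, Or.inl hz⟩
  · exfalso
    simp only [mink, h1] at h
    nlinarith [sq_nonneg x.2.1]
  · obtain ⟨z, hz⟩ := exists_point_of_neg (x := -x) (by simpa using h) (by simpa using h1)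
    exact ⟨z, Or.inr hz⟩

/-- A timelike vector has products of constant sign with the points of the hyperboloid. -/
lemma timelike_sign {n : Mink} (h : mink n n < 0) (z : ℍ) : 0 < n.1 * mink n (pointVec z) := by
  obtain ⟨p, q, r⟩ := n
  have h1 := z.im_pos
  simp only [mink, pointVec] at *
  -- Completing the square leaves two squares plus `p r - q²`, which is positive for a timelike
  -- vector.
  have : p * (q * (z.re / z.im) - (p * (-(z.re ^ 2 + z.im ^ 2) / z.im) + r * (-1 / z.im)) / 2)
      = ((p * z.re + q) ^ 2 + (p * r - q ^ 2) + (p * z.im) ^ 2) / (2 * z.im) := by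
    field_simp; ring
  rw [this]
  apply div_pos _ (by positivity)
  nlinarith [sq_nonneg (p * z.re + q), sq_nonneg (p * z.im)]

lemma timelike_mul_pos {n : Mink} (h : mink n n < 0) (z w : ℍ) :
    0 < mink n (pointVec z) * mink n (pointVec w) := by
  have h1 := timelike_sign h z
  have h2 := timelike_sign h w
  by_contra h3
  have h4 := mul_pos h1 h2
  nlinarith [sq_nonneg n.1]

lemma continuous_pointVec : Continuous pointVec := by
  have h1 : Continuous fun z : ℍ => z.im := UpperHalfPlane.continuous_im
  have h2 : Continuous fun z : ℍ => z.re := UpperHalfPlane.continuous_re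
  unfold pointVec
  refine Continuous.prodMk ?_ (Continuous.prodMk ?_ ?_)
  · exact continuous_const.div h1 (fun z => z.im_pos.ne')
  · exact h2.div h1 (fun z => z.im_pos.ne')
  · exact (((h2.pow 2).add (h1.pow 2)).neg).div h1 (fun z => z.im_pos.ne')

lemma HalfPlane.continuous_val (u : HalfPlane) : Continuous u.val := by
  have h := continuous_pointVec
  have : u.val = fun z => mink u.normal (pointVec z) := funext u.val_eq
  rw [this]
  have h1 := continuous_fst.comp h
  have h2 := (continuous_fst.comp continuous_snd).comp h
  have h3 := (continuous_snd.comp continuous_snd).comp h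
  exact (continuous_const.mul h2).sub
    (((continuous_const.mul h3).add (continuous_const.mul h1)).div_const 2)

/-- The signed distance to the bounding geodesic is `1`-Lipschitz. -/
lemma HalfPlane.arsinh_val_sub_le (u : HalfPlane) (z w : ℍ) :
    |Real.arsinh (u.val z) - Real.arsinh (u.val w)| ≤ dist z w := by
  set a := Real.arsinh (u.val z) with ha
  set b := Real.arsinh (u.val w) with hb
  have hza : mink u.normal (pointVec z) = Real.sinh a := by
    rw [← HalfPlane.val_eq, ha, Real.sinh_arsinh]
  have hwb : mink u.normal (pointVec w) = Real.sinh b := by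
    rw [← HalfPlane.val_eq, hb, Real.sinh_arsinh]
  have hg := gram_nonpos u.normal (pointVec z) (pointVec w)
  simp only [gram, HalfPlane.normal_self, mink_point_self, hza, hwb, mink_point] at hg
  have hca := Real.cosh_sq a
  have hcb := Real.cosh_sq b
  have h1 := Real.cosh_pos a
  have h2 := Real.cosh_pos b
  have hC := Real.one_le_cosh (dist z w)
  set C := Real.cosh (dist z w)
  -- This is the Gram inequality for the normal and the two points.
  have key : (Real.cosh a * Real.cosh b) ^ 2 ≤ (C + Real.sinh a * Real.sinh b) ^ 2 := by
    rw [mul_pow, hca, hcb]; nlinarith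
  have key2 : Real.cosh (a - b) ≤ C := by
    rw [Real.cosh_sub]
    rcases le_total 0 (C + Real.sinh a * Real.sinh b) with h | h
    · have := abs_le_of_sq_le_sq key h
      linarith [le_abs_self (Real.cosh a * Real.cosh b)]
    -- The negative root is impossible: it would give `cosh (a + b) ≤ -C`.
    · have h3 : Real.cosh a * Real.cosh b ≤ -(C + Real.sinh a * Real.sinh b) := by
        apply le_of_sq_le_sq _ (by linarith)
        rw [neg_sq]; exact key
      have h4 : 1 ≤ Real.cosh (a + b) := Real.one_le_cosh _
      rw [Real.cosh_add] at h4
      linarith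
  have := Real.cosh_le_cosh.1 key2
  rwa [abs_of_nonneg (dist_nonneg : 0 ≤ dist z w)] at this

/-- The sum of the distances to two geodesics at distance `d` is at least `d`. -/
lemma HalfPlane.le_arsinh_add {u v : HalfPlane} {d : ℝ} (hd : 0 ≤ d)
    (h : u.inner v = -Real.cosh d) {z : ℍ} (hu : 0 ≤ u.val z) (hv : 0 ≤ v.val z) :
    d ≤ Real.arsinh (u.val z) + Real.arsinh (v.val z) := by
  set a := Real.arsinh (u.val z) with ha
  set b := Real.arsinh (v.val z) with hb
  have hza : mink u.normal (pointVec z) = Real.sinh a := by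
    rw [← HalfPlane.val_eq, ha, Real.sinh_arsinh]
  have hwb : mink v.normal (pointVec z) = Real.sinh b := by
    rw [← HalfPlane.val_eq, hb, Real.sinh_arsinh]
  have hg := gram_nonpos u.normal v.normal (pointVec z)
  rw [HalfPlane.inner_eq] at h
  simp only [gram, HalfPlane.normal_self, mink_point_self, hza, hwb, h] at hg
  have hca := Real.cosh_sq a
  have hcb := Real.cosh_sq b
  have h1 := Real.cosh_pos a
  have h2 := Real.cosh_pos b
  have ha0 : 0 ≤ a := Real.arsinh_nonneg_iff.2 hu
  have hb0 : 0 ≤ b := Real.arsinh_nonneg_iff.2 hv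
  set C := Real.cosh d
  have key : (C - Real.sinh a * Real.sinh b) ^ 2 ≤ (Real.cosh a * Real.cosh b) ^ 2 := by
    rw [mul_pow, hca, hcb]; nlinarith
  have h3 := (le_abs_self _).trans (abs_le_of_sq_le_sq key (by positivity))
  have key2 : C ≤ Real.cosh (a + b) := by rw [Real.cosh_add]; linarith
  have := Real.cosh_le_cosh.1 key2
  rwa [abs_of_nonneg hd, abs_of_nonneg (by positivity)] at this

/-- The geodesic segment between two points of `ℍ`. -/
lemma exists_geodesic (z w : ℍ) : ∃ γ : ℝ → ℍ, γ 0 = z ∧ γ 1 = w ∧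
    (∀ s ∈ Set.Icc (0 : ℝ) 1, ∀ t ∈ Set.Icc (0 : ℝ) 1, dist (γ s) (γ t) = |s - t| * dist z w) ∧
    ∀ t ∈ Set.Icc (0 : ℝ) 1, ∃ a b : ℝ, 0 ≤ a ∧ 0 ≤ b ∧
      pointVec (γ t) = a • pointVec z + b • pointVec w := by
  rcases eq_or_ne z w with rfl | hne
  · refine ⟨fun _ => z, rfl, rfl, by simp, fun t _ => ⟨1, 0, by norm_num, le_rfl, by simp⟩⟩
  set d := dist z w with hd
  have hd0 : 0 < d := dist_pos.2 hne
  have hs0 : 0 < Real.sinh d := Real.sinh_pos_iff.2 hd0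
  -- Hyperbolic interpolation at constant speed. The weights are nonnegative on the unit interval,
  -- which is what makes half-planes convex.
  let a : ℝ → ℝ := fun t => Real.sinh (d * (1 - t)) / Real.sinh d
  let b : ℝ → ℝ := fun t => Real.sinh (d * t) / Real.sinh d
  let X : ℝ → Mink := fun t => a t • pointVec z + b t • pointVec w
  have hzw : mink (pointVec z) (pointVec w) = -Real.cosh d := mink_point z w
  have hwz : mink (pointVec w) (pointVec z) = -Real.cosh d := by rw [mink_comm, hzw]
  have hX : ∀ s t, mink (X s) (X t) = -Real.cosh (d * (s - t)) := by
    intro s t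
    simp only [X, mink_add_left, mink_add_right, mink_smul_left, mink_smul_right, mink_point_self,
      hzw, hwz, a, b]
    have e1 : d * (1 - s) = d - d * s := by ring
    have e2 : d * (1 - t) = d - d * t := by ring
    have e3 : d * (s - t) = d * s - d * t := by ring
    rw [e1, e2, e3, Real.sinh_sub, Real.sinh_sub, Real.cosh_sub]
    have h1 := Real.cosh_sq d
    have h2 := Real.cosh_sq (d * s)
    have h3 := Real.cosh_sq (d * t)
    field_simp
    linear_combination (Real.sinh (d * s) * Real.sinh (d * t)) * h1
  have ha : ∀ t ∈ Set.Icc (0 : ℝ) 1, 0 ≤ a t := fun t ht =>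
    div_nonneg (Real.sinh_nonneg_iff.2 (mul_nonneg hd0.le (by linarith [ht.2]))) hs0.le
  have hb : ∀ t ∈ Set.Icc (0 : ℝ) 1, 0 ≤ b t := fun t ht =>
    div_nonneg (Real.sinh_nonneg_iff.2 (mul_nonneg hd0.le ht.1)) hs0.le
  have hex : ∀ t ∈ Set.Icc (0 : ℝ) 1, ∃ y : ℍ, pointVec y = X t := by
    intro t ht
    apply exists_point_of_neg
    · rw [hX]; simp
    · have hz1 : (pointVec z).1 < 0 := div_neg_of_neg_of_pos (by norm_num) z.im_pos
      have hw1 : (pointVec w).1 < 0 := div_neg_of_neg_of_pos (by norm_num) w.im_pos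
      have e : (X t).1 = a t * (pointVec z).1 + b t * (pointVec w).1 := rfl
      have hab : 0 < a t ∨ 0 < b t := by
        rcases lt_or_ge 0 t with h | h
        · exact Or.inr (div_pos (Real.sinh_pos_iff.2 (by positivity)) hs0)
        · exact Or.inl (div_pos (Real.sinh_pos_iff.2 (mul_pos hd0 (by linarith))) hs0)
      rw [e]
      rcases hab with h | h
      · nlinarith [ha t ht, hb t ht]
      · nlinarith [ha t ht, hb t ht]
  choose! γ hγ using hex
  refine ⟨γ, ?_, ?_, ?_, ?_⟩
  · apply pointVec_injective
    rw [hγ 0 (by simp)]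
    simp [X, a, b, hs0.ne']
  · apply pointVec_injective
    rw [hγ 1 (by simp)]
    simp [X, a, b, hs0.ne']
  · intro s hs t ht
    have h1 := mink_point (γ s) (γ t)
    rw [hγ s hs, hγ t ht, hX] at h1
    have h2 : Real.cosh (dist (γ s) (γ t)) = Real.cosh (d * (s - t)) := by linarith
    have h3 := abs_eq_abs_of_cosh_eq h2
    rwa [abs_of_nonneg dist_nonneg, abs_mul, abs_of_pos hd0, mul_comm] at h3
  · intro t ht
    exact ⟨a t, b t, ha t ht, hb t ht, hγ t ht⟩


/-! ### Trirectangular configurations and Fermi coordinates -/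

/-- In the basis `B, U, z` the vectors `U'` and `z'` have no component along `B`: they lie in the
Lorentzian plane of the geodesic `B`. There `U' = αU - βz` and `z' = γU + κz` with `α² - β² = 1`,
`κ² - γ² = 1` and `αγ + βκ = 0`, so `α² = κ²`; the sign of `α` is given by `hlt`. -/
lemma foot_dist {B U U' : HalfPlane} {z z' : ℍ} (h1 : B.inner U = 0) (h2 : B.inner U' = 0)
    (hz : B.val z = 0) (hz' : B.val z' = 0) (hu : U.val z = 0) (hu' : U'.val z' = 0)
    (hlt : U.inner U' < -1) : U.inner U' = -Real.cosh (dist z z') := by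
  rw [HalfPlane.inner_eq] at *
  rw [HalfPlane.val_eq] at *
  set α := mink U.normal U'.normal with hα
  set β := mink U'.normal (pointVec z) with hβ
  set γ := mink U.normal (pointVec z') with hγ
  have hκ := mink_point z z'
  set κ := Real.cosh (dist z z') with hκd
  have hκ1 : 1 ≤ κ := Real.one_le_cosh _
  have hg : gram B.normal U.normal (pointVec z) ≠ 0 := by
    simp [gram, h1, hz, hu]
  have e1 : U'.normal = α • U.normal - β • pointVec z := by
    apply Mink.ext_of_mink hg
    · simp [h1, h2, hz]
    · simp [hu, hα]
    · simp only [mink_sub_right, mink_smul_right, mink_point_self]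
      rw [mink_comm _ U.normal, hu, mink_comm, ← hβ]; ring
  have e2 : pointVec z' = γ • U.normal + κ • pointVec z := by
    apply Mink.ext_of_mink hg
    · simp [h1, hz, hz']
    · simp [hu, hγ]
    · simp only [mink_add_right, mink_smul_right, mink_point_self]
      rw [mink_comm _ U.normal, hu, hκ]; ring
  have f1 : 1 = α ^ 2 - β ^ 2 := by
    have := U'.normal_self
    rw [e1] at this
    simp only [mink_sub_right, mink_sub_left, mink_smul_right, mink_smul_left, mink_point_self, hu,
      mink_comm (pointVec z) U.normal, HalfPlane.normal_self] at this
    linarith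
  have f2 : -1 = γ ^ 2 - κ ^ 2 := by
    have := mink_point_self z'
    rw [e2] at this
    simp only [mink_add_right, mink_add_left, mink_smul_right, mink_smul_left, mink_point_self, hu,
      mink_comm (pointVec z) U.normal, HalfPlane.normal_self] at this
    linarith
  have f3 : 0 = α * γ + β * κ := by
    have h := hu'
    rw [e2, mink_add_right, mink_smul_right, mink_smul_right, mink_comm, ← hα, ← hβ] at h
    linarith
  have f4 : α ^ 2 = κ ^ 2 := by
    have : α ^ 2 * γ ^ 2 = β ^ 2 * κ ^ 2 := by
      linear_combination (α * γ - β * κ) * (-f3)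
    nlinarith
  nlinarith [sq_eq_sq_iff_abs_eq_abs α κ]

section Fermi

variable {A B B' : HalfPlane} {C : ℝ}

lemma fermi_expand (hC : 1 < C) (h1 : A.inner B = 0) (h2 : A.inner B' = 0)
    (h3 : B.inner B' = -C) (x : Mink) :
    x = mink A.normal x • A.normal
      - ((mink B.normal x + C * mink B'.normal x) / (C ^ 2 - 1)) • B.normal
      - ((mink B'.normal x + C * mink B.normal x) / (C ^ 2 - 1)) • B'.normal := by
  rw [HalfPlane.inner_eq] at h1 h2 h3
  have hC2 : C ^ 2 - 1 ≠ 0 := by nlinarith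
  have hg : gram A.normal B.normal B'.normal ≠ 0 := by
    simp only [gram, HalfPlane.normal_self, h1, h2, h3]
    intro h; apply hC2; linarith
  apply Mink.ext_of_mink hg
  · simp [h1, h2]
  · simp only [mink_sub_right, mink_smul_right, HalfPlane.normal_self, h3, mink_comm B.normal A.normal, h1]
    field_simp; ring
  · simp only [mink_sub_right, mink_smul_right, HalfPlane.normal_self, mink_comm B'.normal A.normal,
      mink_comm B'.normal B.normal, h3, h2]
    field_simp; ring

lemma fermi_mink (hC : 1 < C) (h1 : A.inner B = 0) (h2 : A.inner B' = 0)
    (h3 : B.inner B' = -C) (x y : Mink) :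
    mink x y = mink A.normal x * mink A.normal y
      - (mink B.normal x * mink B.normal y + mink B'.normal x * mink B'.normal y
        + C * (mink B.normal x * mink B'.normal y + mink B'.normal x * mink B.normal y))
          / (C ^ 2 - 1) := by
  have hC2 : C ^ 2 - 1 ≠ 0 := by nlinarith
  conv_lhs => rw [fermi_expand hC h1 h2 h3 x]
  simp only [mink_sub_left, mink_smul_left]
  field_simp; ring

lemma fermi_cosh_dist (hC : 1 < C) (h1 : A.inner B = 0) (h2 : A.inner B' = 0)
    (h3 : B.inner B' = -C) (z w : ℍ) :
    Real.cosh (dist z w) = (B.val z * B.val w + B'.val z * B'.val w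
        + C * (B.val z * B'.val w + B'.val z * B.val w)) / (C ^ 2 - 1) - A.val z * A.val w := by
  have := fermi_mink hC h1 h2 h3 (pointVec z) (pointVec w)
  rw [mink_point] at this
  simp only [HalfPlane.val_eq]
  linarith

lemma fermi_norm (hC : 1 < C) (h1 : A.inner B = 0) (h2 : A.inner B' = 0)
    (h3 : B.inner B' = -C) (z : ℍ) :
    B.val z ^ 2 + B'.val z ^ 2 + 2 * C * (B.val z * B'.val z) = (C ^ 2 - 1) * (1 + A.val z ^ 2) := by
  have hC2 : C ^ 2 - 1 ≠ 0 := by nlinarith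
  have := fermi_cosh_dist hC h1 h2 h3 z z
  rw [dist_self, Real.cosh_zero] at this
  field_simp at this
  linarith

/-- The relation `fermi_norm` is the only constraint on the three values: it says that the vector
with these products has square `-1`. The sign of `p + q` selects the right sheet of the hyperboloid.
-/
lemma fermi_exists (hC : 1 < C) (h1 : A.inner B = 0) (h2 : A.inner B' = 0)
    (h3 : B.inner B' = -C) (hgen : ∀ z, 0 < B.val z + B'.val z) {v p q : ℝ} (hpq : 0 < p + q)
    (h : p ^ 2 + q ^ 2 + 2 * C * (p * q) = (C ^ 2 - 1) * (1 + v ^ 2)) :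
    ∃ z, A.val z = v ∧ B.val z = p ∧ B'.val z = q := by
  have hC2 : C ^ 2 - 1 ≠ 0 := by nlinarith
  set x : Mink := v • A.normal - ((p + C * q) / (C ^ 2 - 1)) • B.normal
    - ((q + C * p) / (C ^ 2 - 1)) • B'.normal with hx
  have h1' : mink A.normal B.normal = 0 := h1
  have h2' : mink A.normal B'.normal = 0 := h2
  have h3' : mink B.normal B'.normal = -C := h3
  have ea : mink A.normal x = v := by simp [hx, h1', h2']
  have eb : mink B.normal x = p := by
    simp only [hx, mink_sub_right, mink_smul_right, HalfPlane.normal_self, h3',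
      mink_comm B.normal A.normal, h1']
    field_simp; ring
  have ec : mink B'.normal x = q := by
    simp only [hx, mink_sub_right, mink_smul_right, HalfPlane.normal_self,
      mink_comm B'.normal A.normal, mink_comm B'.normal B.normal, h3', h2']
    field_simp; ring
  have hn : mink x x = -1 := by
    rw [fermi_mink hC h1 h2 h3, ea, eb, ec]
    field_simp; linarith
  obtain ⟨z, hz | hz⟩ := exists_point_or hn
  · exact ⟨z, by rw [HalfPlane.val_eq, hz, ea], by rw [HalfPlane.val_eq, hz, eb],
      by rw [HalfPlane.val_eq, hz, ec]⟩
  · exfalso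
    have := hgen z
    rw [HalfPlane.val_eq, HalfPlane.val_eq, hz, mink_neg_right, mink_neg_right, eb, ec] at this
    linarith

/-- Two points between two geodesics perpendicular to a third one. -/
lemma fermi_cosh_dist_le (hC : 1 < C) (h1 : A.inner B = 0) (h2 : A.inner B' = 0)
    (h3 : B.inner B' = -C) {z w : ℍ} (hz : 0 ≤ B.val z) (hz' : 0 ≤ B'.val z) (hw : 0 ≤ B.val w)
    (hw' : 0 ≤ B'.val w) :
    Real.cosh (dist z w) ≤ Real.cosh (Real.arsinh (A.val z) - Real.arsinh (A.val w))
      + (C - 1) * (Real.cosh (Real.arsinh (A.val z)) * Real.cosh (Real.arsinh (A.val w))) := by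
  have hC2 : 0 < C ^ 2 - 1 := by nlinarith
  rw [fermi_cosh_dist hC h1 h2 h3, Real.cosh_sub, Real.sinh_arsinh, Real.sinh_arsinh]
  have n1 := fermi_norm hC h1 h2 h3 z
  have n2 := fermi_norm hC h1 h2 h3 w
  have k1 := Real.cosh_sq (Real.arsinh (A.val z))
  have k2 := Real.cosh_sq (Real.arsinh (A.val w))
  rw [Real.sinh_arsinh] at k1 k2
  have k3 := Real.cosh_pos (Real.arsinh (A.val z))
  have k4 := Real.cosh_pos (Real.arsinh (A.val w))
  set a := Real.cosh (Real.arsinh (A.val z))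
  set b := Real.cosh (Real.arsinh (A.val w))
  set p := B.val z
  set q := B'.val z
  set p' := B.val w
  set q' := B'.val w
  have m1 : (p + q) ^ 2 ≤ (C ^ 2 - 1) * a ^ 2 := by nlinarith [mul_nonneg hz hz']
  have m2 : (p' + q') ^ 2 ≤ (C ^ 2 - 1) * b ^ 2 := by nlinarith [mul_nonneg hw hw']
  have m3 : ((p + q) * (p' + q')) ^ 2 ≤ ((C ^ 2 - 1) * (a * b)) ^ 2 := by
    calc ((p + q) * (p' + q')) ^ 2 = (p + q) ^ 2 * (p' + q') ^ 2 := by ring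
      _ ≤ ((C ^ 2 - 1) * a ^ 2) * ((C ^ 2 - 1) * b ^ 2) := by gcongr
      _ = _ := by ring
  have m4 : (p + q) * (p' + q') ≤ (C ^ 2 - 1) * (a * b) :=
    (le_abs_self _).trans (abs_le_of_sq_le_sq m3 (by positivity))
  -- As `C > 1`, the numerator is at most `C (p + q) (p' + q')`.
  have m5 : (p * p' + q * q' + C * (p * q' + q * p')) / (C ^ 2 - 1) ≤ C * (a * b) := by
    rw [div_le_iff₀ hC2]
    nlinarith [mul_nonneg hz hw, mul_nonneg hz' hw']
  linarith

end Fermi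

/-! ### Right-angled hexagons -/

lemma Fin3.add (i : Fin 3) : i + 1 + 1 = i + 2 ∧ i + 1 + 2 = i ∧ i + 2 + 1 = i ∧
    i + 2 + 2 = i + 1 := by decide +revert

lemma Fin3.ne (i : Fin 3) : i ≠ i + 1 ∧ i ≠ i + 2 ∧ i + 1 ≠ i ∧ i + 2 ≠ i ∧ i + 1 ≠ i + 2 ∧
    i + 2 ≠ i + 1 := by decide +revert

lemma Fin3.cases (i j : Fin 3) : j = i ∨ j = i + 1 ∨ j = i + 2 := by decide +revert

namespace RightAngledHexagon

/-- The hexagon with the roles of the two triples of sides exchanged. -/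
def swap (P : RightAngledHexagon) : RightAngledHexagon where
  bSide := P.aSide
  aSide := P.bSide
  adjacent i j h := by rw [HalfPlane.inner_comm]; exact P.adjacent j i h.symm
  opposite i := by rw [HalfPlane.inner_comm]; exact P.opposite i
  bSides := P.aSides
  aSides := P.bSides
  corner i j := P.corner j i
  corner_mem i j h := (P.corner_mem j i h.symm).symm

variable (P : RightAngledHexagon)

lemma mem_region {z : ℍ} :
    z ∈ P.region ↔ ∀ i, 0 ≤ (P.bSide i).val z ∧ 0 ≤ (P.aSide i).val z := Iff.rfl

lemma swap_region : P.swap.region = P.region := by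
  ext z; simp only [mem_region, swap, and_comm]

lemma inner_aSide (i : Fin 3) :
    (P.aSide (i + 1)).inner (P.aSide (i + 2)) = -Real.cosh (P.bLength i) :=
  have h := Fin3.ne i
  foot_dist (P.adjacent i (i + 1) h.1) (P.adjacent i (i + 2) h.2.1)
    (P.corner_mem i (i + 1) h.1).1 (P.corner_mem i (i + 2) h.2.1).1
    (P.corner_mem i (i + 1) h.1).2 (P.corner_mem i (i + 2) h.2.1).2 (P.aSides _ _ h.2.2.2.2.1)

lemma inner_bSide (i : Fin 3) :
    (P.bSide (i + 1)).inner (P.bSide (i + 2)) = -Real.cosh (P.aLength i) :=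
  P.swap.inner_aSide i

lemma one_lt_cosh_bLength (i : Fin 3) : 1 < Real.cosh (P.bLength i) := by
  have h1 := P.inner_aSide i
  have h2 := P.aSides _ _ (Fin3.ne i).2.2.2.2.1
  linarith

lemma one_lt_cosh_aLength (i : Fin 3) : 1 < Real.cosh (P.aLength i) := P.swap.one_lt_cosh_bLength i

lemma bLength_pos (i : Fin 3) : 0 < P.bLength i :=
  lt_of_le_of_ne dist_nonneg fun h => by
    have := P.one_lt_cosh_bLength i; rw [← h] at this; simp at this

lemma aLength_pos (i : Fin 3) : 0 < P.aLength i := P.swap.bLength_pos i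

/-- The off-diagonal cofactors of the Gram matrix of the normals of the sides `aᵢ`. -/
def cof (i : Fin 3) : ℝ := Real.cosh (P.bLength i) +
  Real.cosh (P.bLength (i + 1)) * Real.cosh (P.bLength (i + 2))

/-- The absolute value of the Gram determinant of the normals of the sides `aᵢ`. -/
def disc : ℝ := Real.cosh (P.bLength 0) ^ 2 + Real.cosh (P.bLength 1) ^ 2
  + Real.cosh (P.bLength 2) ^ 2
  + 2 * Real.cosh (P.bLength 0) * Real.cosh (P.bLength 1) * Real.cosh (P.bLength 2) - 1

lemma disc_eq (i : Fin 3) : P.disc = Real.cosh (P.bLength i) ^ 2 +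
    Real.cosh (P.bLength (i + 1)) ^ 2 + Real.cosh (P.bLength (i + 2)) ^ 2
    + 2 * Real.cosh (P.bLength i) * Real.cosh (P.bLength (i + 1)) * Real.cosh (P.bLength (i + 2))
    - 1 := by
  unfold disc
  fin_cases i <;> simp <;> ring

lemma cof_pos (i : Fin 3) : 0 < P.cof i := by unfold cof; positivity

lemma disc_pos : 0 < P.disc := by
  have h0 := P.one_lt_cosh_bLength 0
  have h1 := P.one_lt_cosh_bLength 1
  have h2 := P.one_lt_cosh_bLength 2
  unfold disc
  have : 0 < 2 * Real.cosh (P.bLength 0) * Real.cosh (P.bLength 1) * Real.cosh (P.bLength 2) := by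
    positivity
  nlinarith

/-- The coordinate of a point with respect to the dual basis of the normals of the sides `aᵢ`,
a positive multiple of the value of the side `bᵢ`. -/
def dualVal (i : Fin 3) (z : ℍ) : ℝ :=
  P.cof (i + 2) * (P.aSide (i + 1)).val z + P.cof (i + 1) * (P.aSide (i + 2)).val z
    - Real.sinh (P.bLength i) ^ 2 * (P.aSide i).val z

lemma gram_aSide (i : Fin 3) :
    gram (P.aSide i).normal (P.aSide (i + 1)).normal (P.aSide (i + 2)).normal = -P.disc := by
  have h0 := P.inner_aSide i
  have h1 := P.inner_aSide (i + 1)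
  have h2 := P.inner_aSide (i + 2)
  obtain ⟨e1, e2, e3, e4⟩ := Fin3.add i
  rw [e1, e2, HalfPlane.inner_comm] at h1
  rw [e3, e4] at h2
  rw [HalfPlane.inner_eq] at h0 h1 h2
  rw [P.disc_eq i]
  simp only [gram, HalfPlane.normal_self, h0, h1, h2]
  ring

/-- The side `bᵢ` is perpendicular to `aᵢ₊₁` and `aᵢ₊₂`, so its normal is proportional to a vector
of the dual basis of the normals of the `aⱼ`. The coefficients are the cofactors of their Gram
matrix. -/
lemma smul_bSide (i : Fin 3) :
    P.disc • (P.bSide i).normal = (-(P.bSide i).inner (P.aSide i)) •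
      (P.cof (i + 2) • (P.aSide (i + 1)).normal + P.cof (i + 1) • (P.aSide (i + 2)).normal
        - Real.sinh (P.bLength i) ^ 2 • (P.aSide i).normal) := by
  have h0 := P.inner_aSide i
  have h1 := P.inner_aSide (i + 1)
  have h2 := P.inner_aSide (i + 2)
  obtain ⟨e1, e2, e3, e4⟩ := Fin3.add i
  obtain ⟨n1, n2, -⟩ := Fin3.ne i
  rw [e1, e2, HalfPlane.inner_comm] at h1
  rw [e3, e4] at h2
  have a1 := P.adjacent i (i + 1) n1
  have a2 := P.adjacent i (i + 2) n2
  rw [HalfPlane.inner_eq] at *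
  rw [mink_comm] at a1 a2
  apply Mink.ext_of_mink (x := (P.aSide i).normal) (y := (P.aSide (i + 1)).normal)
    (z := (P.aSide (i + 2)).normal)
  · rw [gram_aSide]; exact neg_ne_zero.2 P.disc_pos.ne'
  · simp only [mink_smul_right, mink_add_right, mink_sub_right, HalfPlane.normal_self, h1, h2]
    rw [P.disc_eq i, cof, cof, e1, e2, e3, e4, mink_comm, Real.sinh_sq]
    ring
  · simp only [mink_smul_right, mink_add_right, mink_sub_right, HalfPlane.normal_self, h0,
      mink_comm (P.aSide (i + 1)).normal (P.aSide i).normal, h2, a1]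
    rw [cof, cof, e1, e2, e3, e4, Real.sinh_sq]
    ring
  · simp only [mink_smul_right, mink_add_right, mink_sub_right, HalfPlane.normal_self,
      mink_comm (P.aSide (i + 2)).normal (P.aSide i).normal,
      mink_comm (P.aSide (i + 2)).normal (P.aSide (i + 1)).normal, h0, h1, a2]
    rw [cof, cof, e1, e2, e3, e4, Real.sinh_sq]
    ring

lemma disc_mul_val (i : Fin 3) (z : ℍ) :
    P.disc * (P.bSide i).val z = -(P.bSide i).inner (P.aSide i) * P.dualVal i z := by
  have h := congrArg (fun x => mink x (pointVec z)) (P.smul_bSide i)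
  simpa only [mink_smul_left, mink_add_left, mink_sub_left, dualVal, ← HalfPlane.val_eq] using h

lemma dualVal_nonneg_iff (i : Fin 3) (z : ℍ) : 0 ≤ P.dualVal i z ↔ 0 ≤ (P.bSide i).val z := by
  have h1 := P.disc_mul_val i z
  have h2 := P.opposite i
  have h3 := P.disc_pos
  rw [← mul_nonneg_iff_of_pos_left (b := (P.bSide i).val z) h3, h1, mul_nonneg_iff_of_pos_left (by linarith)]

lemma dualVal_eq_zero_iff (i : Fin 3) (z : ℍ) : P.dualVal i z = 0 ↔ (P.bSide i).val z = 0 := by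
  have h1 := P.disc_mul_val i z
  have h2 := P.opposite i
  have h3 := P.disc_pos
  constructor
  · intro h; rw [h, mul_zero] at h1
    exact (mul_eq_zero.1 h1).resolve_left h3.ne'
  · intro h; rw [h, mul_zero] at h1
    exact (mul_eq_zero.1 h1.symm).resolve_left (by linarith)

lemma opposite_sq (i : Fin 3) :
    ((P.bSide i).inner (P.aSide i)) ^ 2 * Real.sinh (P.bLength i) ^ 2 = P.disc := by
  have h := congrArg (fun x => mink x (P.bSide i).normal) (P.smul_bSide i)
  obtain ⟨n1, n2, -⟩ := Fin3.ne i
  have a1 := P.adjacent i (i + 1) n1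
  have a2 := P.adjacent i (i + 2) n2
  rw [HalfPlane.inner_eq, mink_comm] at a1 a2 ⊢
  simp only [mink_smul_left, mink_add_left, mink_sub_left, HalfPlane.normal_self, a1, a2] at h
  rw [HalfPlane.inner_eq, mink_comm] at h
  linarith

lemma opposite_mul_sinh (i : Fin 3) :
    -(P.bSide i).inner (P.aSide i) * Real.sinh (P.bLength i) = √P.disc := by
  rw [← P.opposite_sq i, ← mul_pow, ← neg_sq, ← neg_mul, Real.sqrt_sq]
  have := P.opposite i
  exact mul_nonneg (by linarith) (Real.sinh_pos_iff.2 (P.bLength_pos i)).le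

/-- The hyperbolic law of cosines for right-angled hexagons. -/
lemma cosh_aLength (i : Fin 3) : Real.cosh (P.aLength i) =
    P.cof i / (Real.sinh (P.bLength (i + 1)) * Real.sinh (P.bLength (i + 2))) := by
  -- Only the term of `aᵢ₊₂` survives, since `bᵢ₊₂` is perpendicular to the other two sides.
  have h := congrArg (fun x => mink x (P.bSide (i + 2)).normal) (P.smul_bSide (i + 1))
  have h0 := P.inner_bSide i
  obtain ⟨e1, e2, e3, e4⟩ := Fin3.add i
  obtain ⟨-, n2, n3, n4, n5, n6⟩ := Fin3.ne i
  have a1 := P.adjacent (i + 2) i n4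
  have a2 := P.adjacent (i + 2) (i + 1) n6
  rw [HalfPlane.inner_eq] at h0
  rw [HalfPlane.inner_eq, mink_comm] at a1 a2
  simp only [mink_smul_left, mink_add_left, mink_sub_left, e1, e2, h0, a1, a2] at h
  have h1 := P.opposite_mul_sinh (i + 1)
  have h2 := P.opposite_mul_sinh (i + 2)
  have s1 := Real.sinh_pos_iff.2 (P.bLength_pos (i + 1))
  have s2 := Real.sinh_pos_iff.2 (P.bLength_pos (i + 2))
  have hd := P.disc_pos
  have hs := Real.mul_self_sqrt hd.le
  have h3 : mink (P.aSide (i + 2)).normal (P.bSide (i + 2)).normal =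
    (P.bSide (i + 2)).inner (P.aSide (i + 2)) := by rw [mink_comm]; rfl
  rw [h3] at h
  rw [eq_div_iff (by positivity)]
  apply mul_left_cancel₀ hd.ne'
  set x := (P.bSide (i + 1)).inner (P.aSide (i + 1))
  set x' := (P.bSide (i + 2)).inner (P.aSide (i + 2))
  have h4 : P.disc = (-x * Real.sinh (P.bLength (i + 1))) * (-x' * Real.sinh (P.bLength (i + 2))) := by
    rw [h1, h2, hs]
  linear_combination (-Real.sinh (P.bLength (i + 1)) * Real.sinh (P.bLength (i + 2))) * h
    - P.cof i * h4

lemma cosh_bLength (i : Fin 3) : Real.cosh (P.bLength i) =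
    (Real.cosh (P.aLength i) + Real.cosh (P.aLength (i + 1)) * Real.cosh (P.aLength (i + 2))) /
      (Real.sinh (P.aLength (i + 1)) * Real.sinh (P.aLength (i + 2))) :=
  P.swap.cosh_aLength i

lemma smul_point (i : Fin 3) (z : ℍ) :
    P.disc • pointVec z = -(P.dualVal i z • (P.aSide i).normal
      + P.dualVal (i + 1) z • (P.aSide (i + 1)).normal
      + P.dualVal (i + 2) z • (P.aSide (i + 2)).normal) := by
  have h0 := P.inner_aSide i
  have h1 := P.inner_aSide (i + 1)
  have h2 := P.inner_aSide (i + 2)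
  obtain ⟨e1, e2, e3, e4⟩ := Fin3.add i
  rw [e1, e2, HalfPlane.inner_comm] at h1
  rw [e3, e4] at h2
  rw [HalfPlane.inner_eq] at h0 h1 h2
  apply Mink.ext_of_mink (x := (P.aSide i).normal) (y := (P.aSide (i + 1)).normal)
    (z := (P.aSide (i + 2)).normal)
  · rw [gram_aSide]; exact neg_ne_zero.2 P.disc_pos.ne'
  · simp only [mink_smul_right, mink_add_right, mink_neg_right, HalfPlane.normal_self, h1, h2]
    rw [P.disc_eq i]
    simp only [dualVal, cof, e1, e2, e3, e4, Real.sinh_sq, ← HalfPlane.val_eq]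
    ring
  · simp only [mink_smul_right, mink_add_right, mink_neg_right, HalfPlane.normal_self, h0,
      mink_comm (P.aSide (i + 1)).normal (P.aSide i).normal, h2]
    rw [P.disc_eq i]
    simp only [dualVal, cof, e1, e2, e3, e4, Real.sinh_sq, ← HalfPlane.val_eq]
    ring
  · simp only [mink_smul_right, mink_add_right, mink_neg_right, HalfPlane.normal_self,
      mink_comm (P.aSide (i + 2)).normal (P.aSide i).normal,
      mink_comm (P.aSide (i + 2)).normal (P.aSide (i + 1)).normal, h0, h1]
    rw [P.disc_eq i]
    simp only [dualVal, cof, e1, e2, e3, e4, Real.sinh_sq, ← HalfPlane.val_eq]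
    ring

/-- Pairing the expansion of a point in the basis of the `aⱼ` with the point itself. On the hexagon
all three summands are nonnegative, so each of them is at most `disc`. -/
lemma disc_eq_sum (i : Fin 3) (z : ℍ) : P.disc = (P.aSide i).val z * P.dualVal i z
    + (P.aSide (i + 1)).val z * P.dualVal (i + 1) z
    + (P.aSide (i + 2)).val z * P.dualVal (i + 2) z := by
  have h := congrArg (fun x => mink x (pointVec z)) (P.smul_point i z)
  simp only [mink_smul_left, mink_add_left, mink_neg_left, ← HalfPlane.val_eq, mink_point_self] at h
  linarith

/-- The combination on the left is chosen to eliminate `dualVal (i + 2)`; the remaining coefficients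
are positive. -/
lemma disc_mul_add (i : Fin 3) (z : ℍ) :
    P.disc * ((P.aSide i).val z + Real.cosh (P.bLength (i + 1)) * (P.aSide (i + 2)).val z) =
      Real.sinh (P.bLength (i + 1)) ^ 2 * P.dualVal i z + P.cof (i + 2) * P.dualVal (i + 1) z := by
  obtain ⟨e1, e2, e3, e4⟩ := Fin3.add i
  rw [P.disc_eq i]
  simp only [dualVal, cof, e1, e2, e3, e4, Real.sinh_sq]
  ring

lemma disc_mul_add' (i : Fin 3) (z : ℍ) :
    P.disc * ((P.aSide i).val z + Real.cosh (P.bLength (i + 2)) * (P.aSide (i + 1)).val z) =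
      Real.sinh (P.bLength (i + 2)) ^ 2 * P.dualVal i z + P.cof (i + 1) * P.dualVal (i + 2) z := by
  obtain ⟨e1, e2, e3, e4⟩ := Fin3.add i
  rw [P.disc_eq i]
  simp only [dualVal, cof, e1, e2, e3, e4, Real.sinh_sq]
  ring

end RightAngledHexagon


/-! ### The closed hexagon: arcs, corners, compactness and existence -/

namespace RightAngledHexagon

variable (P : RightAngledHexagon)

/-- On the line of `aᵢ` the values of the other two arcs are positive combinations of two
nonnegative dual values. These do not both vanish, because `disc_eq_sum` is positive. So on an arc
the remaining conditions of the hexagon hold automatically and strictly. -/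
lemma aSide_of_val_eq_zero {i : Fin 3} {z : ℍ} (h : (P.aSide i).val z = 0)
    (h1 : 0 ≤ (P.bSide (i + 1)).val z) (h2 : 0 ≤ (P.bSide (i + 2)).val z) :
    0 < (P.aSide (i + 1)).val z ∧ 0 < (P.aSide (i + 2)).val z ∧ 0 < (P.bSide i).val z := by
  have hD := P.disc_pos
  have y1 := (P.dualVal_nonneg_iff (i + 1) z).2 h1
  have y2 := (P.dualVal_nonneg_iff (i + 2) z).2 h2
  have e := P.disc_eq_sum i z
  have g1 := P.disc_mul_add (i + 1) z
  have g2 := P.disc_mul_add' (i + 2) z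
  obtain ⟨e1, e2, e3, e4⟩ := Fin3.add i
  rw [e1, e2] at g1
  rw [e3, e4] at g2
  have s1 := Real.sinh_pos_iff.2 (P.bLength_pos (i + 2))
  have s2 := Real.sinh_pos_iff.2 (P.bLength_pos (i + 1))
  have m := P.cof_pos i
  rw [h] at e g1 g2
  simp only [mul_zero, add_zero, zero_mul, zero_add] at e g1 g2
  have v1 : 0 ≤ (P.aSide (i + 1)).val z := by
    rw [← mul_nonneg_iff_of_pos_left (b := (P.aSide (i + 1)).val z) hD, g1]; positivity
  have v2 : 0 ≤ (P.aSide (i + 2)).val z := by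
    rw [← mul_nonneg_iff_of_pos_left (b := (P.aSide (i + 2)).val z) hD, g2]; positivity
  have w1 : 0 < (P.aSide (i + 1)).val z := by
    refine lt_of_le_of_ne v1 fun h0 => ?_
    rw [← h0, mul_zero] at g1
    have hy1 : P.dualVal (i + 1) z = 0 := by
      have := mul_nonneg (sq_nonneg (Real.sinh (P.bLength (i + 2)))) y1
      have h3 : Real.sinh (P.bLength (i + 2)) ^ 2 * P.dualVal (i + 1) z = 0 := by
        have := mul_nonneg m.le y2
        linarith
      exact (mul_eq_zero.1 h3).resolve_left (by positivity)
    have hy2 : P.dualVal (i + 2) z = 0 := by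
      rw [hy1, mul_zero, zero_add] at g1
      exact (mul_eq_zero.1 g1.symm).resolve_left m.ne'
    rw [hy1, hy2] at e
    linarith
  have w2 : 0 < (P.aSide (i + 2)).val z := by
    refine lt_of_le_of_ne v2 fun h0 => ?_
    rw [← h0, mul_zero] at g2
    have hy1 : P.dualVal (i + 2) z = 0 := by
      have := mul_nonneg (sq_nonneg (Real.sinh (P.bLength (i + 1)))) y2
      have h3 : Real.sinh (P.bLength (i + 1)) ^ 2 * P.dualVal (i + 2) z = 0 := by
        have := mul_nonneg m.le y1
        linarith
      exact (mul_eq_zero.1 h3).resolve_left (by positivity)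
    have hy2 : P.dualVal (i + 1) z = 0 := by
      rw [hy1, mul_zero, zero_add] at g2
      exact (mul_eq_zero.1 g2.symm).resolve_left m.ne'
    rw [hy1, hy2] at e
    linarith
  refine ⟨w1, w2, lt_of_le_of_ne ?_ ?_⟩
  · rw [← dualVal_nonneg_iff, dualVal, h]
    have := P.cof_pos (i + 1)
    have := P.cof_pos (i + 2)
    nlinarith [mul_pos (P.cof_pos (i + 2)) w1, mul_pos (P.cof_pos (i + 1)) w2]
  · intro h0
    have := (P.dualVal_eq_zero_iff i z).2 h0.symm
    rw [dualVal, h] at this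
    nlinarith [mul_pos (P.cof_pos (i + 2)) w1, mul_pos (P.cof_pos (i + 1)) w2]

lemma mem_arc_iff {i : Fin 3} {z : ℍ} : z ∈ P.arc i ↔
    (P.aSide i).val z = 0 ∧ 0 ≤ (P.bSide (i + 1)).val z ∧ 0 ≤ (P.bSide (i + 2)).val z := by
  constructor
  · rintro ⟨h, h0⟩
    exact ⟨h0, (h _).1, (h _).1⟩
  · rintro ⟨h, h1, h2⟩
    obtain ⟨a1, a2, b0⟩ := P.aSide_of_val_eq_zero h h1 h2
    refine ⟨fun j => ?_, h⟩
    rcases Fin3.cases i j with rfl | rfl | rfl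
    · exact ⟨b0.le, h.ge⟩
    · exact ⟨h1, a1.le⟩
    · exact ⟨h2, a2.le⟩

lemma arc_subset (i : Fin 3) : P.arc i ⊆ P.region := fun _ h => h.1

lemma aSide_pos {z : ℍ} (hz : z ∈ P.region) {i j : Fin 3} (hij : j ≠ i)
    (h : (P.aSide i).val z = 0) : 0 < (P.aSide j).val z := by
  obtain ⟨a1, a2, -⟩ := P.aSide_of_val_eq_zero h (hz _).1 (hz _).1
  rcases Fin3.cases i j with rfl | rfl | rfl
  · exact absurd rfl hij
  · exact a1
  · exact a2

lemma bSide_pos {z : ℍ} (hz : z ∈ P.region) {i j : Fin 3} (hij : j ≠ i)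
    (h : (P.bSide i).val z = 0) : 0 < (P.bSide j).val z :=
  P.swap.aSide_pos (by rwa [swap_region]) hij h

lemma bSide_pos_of_aSide {z : ℍ} (hz : z ∈ P.region) {i : Fin 3}
    (h : (P.aSide i).val z = 0) : 0 < (P.bSide i).val z :=
  (P.aSide_of_val_eq_zero h (hz _).1 (hz _).1).2.2

lemma arc_disjoint {z : ℍ} {i j : Fin 3} (h : z ∈ P.arc i) (h' : z ∈ P.arc j) : i = j := by
  by_contra hij
  exact (P.aSide_pos h.1 hij h'.2).ne' h.2

/-- As the product of the normals is `< -1`, their sum is timelike, hence of constant sign on `ℍ`. A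
point of the region fixes the sign; this excludes the configuration of the complementary
half-planes. -/
lemma aSide_add_pos (hP : P.region.Nonempty) {i j : Fin 3} (hij : i ≠ j) (z : ℍ) :
    0 < (P.aSide i).val z + (P.aSide j).val z := by
  obtain ⟨z0, hz0⟩ := hP
  have h := P.aSides i j hij
  rw [HalfPlane.inner_eq] at h
  have hn : mink ((P.aSide i).normal + (P.aSide j).normal)
      ((P.aSide i).normal + (P.aSide j).normal) < 0 := by
    simp only [mink_add_left, mink_add_right, HalfPlane.normal_self,
      mink_comm (P.aSide j).normal (P.aSide i).normal]
    linarith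
  have h1 := timelike_mul_pos hn z0 z
  simp only [mink_add_left, ← HalfPlane.val_eq] at h1
  exact pos_of_mul_pos_right h1 (add_nonneg (hz0 i).2 (hz0 j).2)

lemma bSide_add_pos (hP : P.region.Nonempty) {i j : Fin 3} (hij : i ≠ j) (z : ℍ) :
    0 < (P.bSide i).val z + (P.bSide j).val z :=
  P.swap.aSide_add_pos (by rwa [swap_region]) hij z

section FermiCoordinates

variable (i : Fin 3)

lemma arc_norm (z : ℍ) : (P.bSide (i + 1)).val z ^ 2 + (P.bSide (i + 2)).val z ^ 2
    + 2 * Real.cosh (P.aLength i) * ((P.bSide (i + 1)).val z * (P.bSide (i + 2)).val z)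
    = (Real.cosh (P.aLength i) ^ 2 - 1) * (1 + (P.aSide i).val z ^ 2) := by
  refine fermi_norm (P.one_lt_cosh_aLength i) ?_ ?_ (P.inner_bSide i) z
  · rw [HalfPlane.inner_comm]; exact P.adjacent _ _ (Fin3.ne i).2.2.1
  · rw [HalfPlane.inner_comm]; exact P.adjacent _ _ (Fin3.ne i).2.2.2.1

lemma arc_cosh_dist (z w : ℍ) : Real.cosh (dist z w) =
    ((P.bSide (i + 1)).val z * (P.bSide (i + 1)).val w
      + (P.bSide (i + 2)).val z * (P.bSide (i + 2)).val w
      + Real.cosh (P.aLength i) * ((P.bSide (i + 1)).val z * (P.bSide (i + 2)).val w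
        + (P.bSide (i + 2)).val z * (P.bSide (i + 1)).val w)) / (Real.cosh (P.aLength i) ^ 2 - 1)
      - (P.aSide i).val z * (P.aSide i).val w := by
  refine fermi_cosh_dist (P.one_lt_cosh_aLength i) ?_ ?_ (P.inner_bSide i) z w
  · rw [HalfPlane.inner_comm]; exact P.adjacent _ _ (Fin3.ne i).2.2.1
  · rw [HalfPlane.inner_comm]; exact P.adjacent _ _ (Fin3.ne i).2.2.2.1

lemma exists_arc_coord (hP : P.region.Nonempty) {v p q : ℝ} (hpq : 0 < p + q)
    (h : p ^ 2 + q ^ 2 + 2 * Real.cosh (P.aLength i) * (p * q)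
      = (Real.cosh (P.aLength i) ^ 2 - 1) * (1 + v ^ 2)) :
    ∃ z, (P.aSide i).val z = v ∧ (P.bSide (i + 1)).val z = p ∧ (P.bSide (i + 2)).val z = q := by
  refine fermi_exists (P.one_lt_cosh_aLength i) ?_ ?_ (P.inner_bSide i)
    (P.bSide_add_pos hP (Fin3.ne i).2.2.2.2.1) hpq h
  · rw [HalfPlane.inner_comm]; exact P.adjacent _ _ (Fin3.ne i).2.2.1
  · rw [HalfPlane.inner_comm]; exact P.adjacent _ _ (Fin3.ne i).2.2.2.1

lemma cosh_dist_le {z w : ℍ} (hz : z ∈ P.region) (hw : w ∈ P.region) :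
    Real.cosh (dist z w) ≤
      Real.cosh (Real.arsinh ((P.aSide i).val z) - Real.arsinh ((P.aSide i).val w))
      + (Real.cosh (P.aLength i) - 1) * (Real.cosh (Real.arsinh ((P.aSide i).val z))
        * Real.cosh (Real.arsinh ((P.aSide i).val w))) := by
  refine fermi_cosh_dist_le (P.one_lt_cosh_aLength i) ?_ ?_ (P.inner_bSide i)
    (hz _).1 (hz _).1 (hw _).1 (hw _).1
  · rw [HalfPlane.inner_comm]; exact P.adjacent _ _ (Fin3.ne i).2.2.1
  · rw [HalfPlane.inner_comm]; exact P.adjacent _ _ (Fin3.ne i).2.2.2.1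

end FermiCoordinates

lemma arc_corner (i : Fin 3) :
    ((P.bSide (i + 2)).val (P.corner (i + 1) i)) ^ 2 = Real.sinh (P.aLength i) ^ 2 := by
  have h := P.corner_mem (i + 1) i (Fin3.ne i).2.2.1
  have := P.arc_norm i (P.corner (i + 1) i)
  rw [h.1, h.2] at this
  rw [Real.sinh_sq]
  linarith

lemma arc_corner' (i : Fin 3) :
    ((P.bSide (i + 1)).val (P.corner (i + 2) i)) ^ 2 = Real.sinh (P.aLength i) ^ 2 := by
  have h := P.corner_mem (i + 2) i (Fin3.ne i).2.2.2.1
  have := P.arc_norm i (P.corner (i + 2) i)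
  rw [h.1, h.2] at this
  rw [Real.sinh_sq]
  linarith

lemma corner_mem_arc (hP : P.region.Nonempty) {i j : Fin 3} (hij : j ≠ i) :
    P.corner j i ∈ P.arc i := by
  have h := P.corner_mem j i hij
  rw [mem_arc_iff]
  have hs := P.bSide_add_pos hP (Fin3.ne i).2.2.2.2.1 (P.corner j i)
  rcases Fin3.cases i j with rfl | rfl | rfl
  · exact absurd rfl hij
  · rw [h.1] at *
    exact ⟨h.2, le_rfl, by linarith⟩
  · rw [h.1] at *
    exact ⟨h.2, by linarith, le_rfl⟩

/-- The arc meets `bᵢ₊₁` perpendicularly at the corner, so distance along the arc is distance to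
that side. This translates the gluing condition on distances to corners into one on side values. -/
lemma sinh_dist_corner (hP : P.region.Nonempty) {i : Fin 3} {z : ℍ} (hz : z ∈ P.arc i) :
    Real.sinh (dist z (P.corner (i + 1) i)) = (P.bSide (i + 1)).val z := by
  have hc := P.corner_mem_arc hP (i := i) (Fin3.ne i).2.2.1
  have h := P.corner_mem (i + 1) i (Fin3.ne i).2.2.1
  have h1 := P.arc_cosh_dist i z (P.corner (i + 1) i)
  have h2 := P.arc_corner i
  have h3 := P.arc_norm i z
  rw [mem_arc_iff] at hz hc
  rw [h.1, h.2, hz.1] at h1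
  rw [hz.1] at h3
  have hC : 0 < Real.cosh (P.aLength i) ^ 2 - 1 := by nlinarith [P.one_lt_cosh_aLength i]
  rw [Real.sinh_sq] at h2
  have h4 : Real.sinh (dist z (P.corner (i + 1) i)) ^ 2 = (P.bSide (i + 1)).val z ^ 2 := by
    rw [Real.sinh_sq, h1]
    set C := Real.cosh (P.aLength i)
    set w := (P.bSide (i + 2)).val (P.corner (i + 1) i)
    set p := (P.bSide (i + 1)).val z
    set q := (P.bSide (i + 2)).val z
    have : (p * 0 + q * w + C * (p * w + q * 0)) / (C ^ 2 - 1) - 0 * 0 =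
      (q + C * p) * w / (C ^ 2 - 1) := by ring
    rw [this, div_pow, mul_pow, h2]
    field_simp
    linear_combination h3
  exact (pow_left_inj₀ (Real.sinh_nonneg_iff.2 dist_nonneg) hz.2.1 two_ne_zero).1 h4

lemma sinh_dist_corner' (hP : P.region.Nonempty) {i : Fin 3} {z : ℍ} (hz : z ∈ P.arc i) :
    Real.sinh (dist z (P.corner (i + 2) i)) = (P.bSide (i + 2)).val z := by
  have hc := P.corner_mem_arc hP (i := i) (Fin3.ne i).2.2.2.1
  have h := P.corner_mem (i + 2) i (Fin3.ne i).2.2.2.1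
  have h1 := P.arc_cosh_dist i z (P.corner (i + 2) i)
  have h2 := P.arc_corner' i
  have h3 := P.arc_norm i z
  rw [mem_arc_iff] at hz hc
  rw [h.1, h.2, hz.1] at h1
  rw [hz.1] at h3
  have hC : 0 < Real.cosh (P.aLength i) ^ 2 - 1 := by nlinarith [P.one_lt_cosh_aLength i]
  rw [Real.sinh_sq] at h2
  have h4 : Real.sinh (dist z (P.corner (i + 2) i)) ^ 2 = (P.bSide (i + 2)).val z ^ 2 := by
    rw [Real.sinh_sq, h1]
    set C := Real.cosh (P.aLength i)
    set w := (P.bSide (i + 1)).val (P.corner (i + 2) i)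
    set p := (P.bSide (i + 1)).val z
    set q := (P.bSide (i + 2)).val z
    have : (p * w + q * 0 + C * (p * 0 + q * w)) / (C ^ 2 - 1) - 0 * 0 =
      (p + C * q) * w / (C ^ 2 - 1) := by ring
    rw [this, div_pow, mul_pow, h2]
    field_simp
    linear_combination h3
  exact (pow_left_inj₀ (Real.sinh_nonneg_iff.2 dist_nonneg) hz.2.2 two_ne_zero).1 h4

/-! #### Topology of the region -/

lemma mem_region_of_combination {x z w : ℍ} (hz : z ∈ P.region) (hw : w ∈ P.region) {a b : ℝ}
    (ha : 0 ≤ a) (hb : 0 ≤ b) (h : pointVec x = a • pointVec z + b • pointVec w) :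
    x ∈ P.region := by
  have key : ∀ u : HalfPlane, u.val x = a * u.val z + b * u.val w := by
    intro u
    rw [HalfPlane.val_eq, h, mink_add_right, mink_smul_right, mink_smul_right,
      ← HalfPlane.val_eq, ← HalfPlane.val_eq]
  intro i
  refine ⟨?_, ?_⟩
  · show 0 ≤ (P.bSide i).val x
    rw [key]
    exact add_nonneg (mul_nonneg ha (hz i).1) (mul_nonneg hb (hw i).1)
  · show 0 ≤ (P.aSide i).val x
    rw [key]
    exact add_nonneg (mul_nonneg ha (hz i).2) (mul_nonneg hb (hw i).2)

lemma isClosed_region : IsClosed P.region := by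
  have : P.region = ⋂ i, ((P.bSide i).val ⁻¹' Set.Ici 0 ∩ (P.aSide i).val ⁻¹' Set.Ici 0) := by
    ext z; simp [mem_region]
  rw [this]
  exact isClosed_iInter fun i => (isClosed_Ici.preimage (HalfPlane.continuous_val _)).inter
    (isClosed_Ici.preimage (HalfPlane.continuous_val _))

lemma isClosed_arc (i : Fin 3) : IsClosed (P.arc i) :=
  P.isClosed_region.inter (isClosed_singleton.preimage (HalfPlane.continuous_val _))

lemma val_mul_dualVal_le {z : ℍ} (hz : z ∈ P.region) (i : Fin 3) :
    (P.aSide i).val z * P.dualVal i z ≤ P.disc := by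
  have h := P.disc_eq_sum i z
  have h1 := mul_nonneg (hz (i + 1)).2 ((P.dualVal_nonneg_iff (i + 1) z).2 (hz _).1)
  have h2 := mul_nonneg (hz (i + 2)).2 ((P.dualVal_nonneg_iff (i + 2) z).2 (hz _).1)
  linarith

/-- A point of the hexagon which is not close to two of the arcs is not far from the third one. -/
lemma cosh_mul_val_le {z : ℍ} (hz : z ∈ P.region) {i : Fin 3} {r r' : ℝ} (hr : 0 < r)
    (hr' : 0 < r') (h : r ≤ (P.aSide i).val z) (h' : r' ≤ (P.aSide (i + 1)).val z) :
    (P.aSide i).val z + Real.cosh (P.bLength (i + 1)) * (P.aSide (i + 2)).val z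
      ≤ Real.sinh (P.bLength (i + 1)) ^ 2 / r + P.cof (i + 2) / r' := by
  have hD := P.disc_pos
  have e := P.disc_mul_add i z
  have y0 := (P.dualVal_nonneg_iff i z).2 (hz _).1
  have y1 := (P.dualVal_nonneg_iff (i + 1) z).2 (hz _).1
  have k0 : P.dualVal i z ≤ P.disc / r := by
    rw [le_div_iff₀ hr]
    nlinarith [P.val_mul_dualVal_le hz i]
  have k1 : P.dualVal (i + 1) z ≤ P.disc / r' := by
    rw [le_div_iff₀ hr']
    nlinarith [P.val_mul_dualVal_le hz (i + 1)]
  have m := P.cof_pos (i + 2)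
  have : P.disc * ((P.aSide i).val z + Real.cosh (P.bLength (i + 1)) * (P.aSide (i + 2)).val z)
      ≤ P.disc * (Real.sinh (P.bLength (i + 1)) ^ 2 / r + P.cof (i + 2) / r') := by
    rw [e]
    calc _ ≤ Real.sinh (P.bLength (i + 1)) ^ 2 * (P.disc / r) + P.cof (i + 2) * (P.disc / r') := by
          gcongr
      _ = _ := by ring
  exact le_of_mul_le_mul_left this hD

lemma isCompact_region : IsCompact P.region := by
  rcases P.region.eq_empty_or_nonempty with h0 | hP
  · rw [h0]; exact isCompact_empty
  refine Metric.isCompact_of_isClosed_isBounded P.isClosed_region ?_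
  -- With this `R`, a point at which all three arc values exceed `R` would contradict
  -- `cosh_mul_val_le`. So every point is within a bounded distance of some arc, measured by Fermi
  -- coordinates.
  set R : ℝ := Real.sinh (P.bLength 1) ^ 2 + P.cof 2 + 1 with hR
  have hR1 : 1 ≤ R := by have := P.cof_pos 2; nlinarith [sq_nonneg (Real.sinh (P.bLength 1))]
  have key : ∀ z ∈ P.region, ∃ i, (P.aSide i).val z ≤ R := by
    intro z hz
    by_contra! h
    have h1 := P.cosh_mul_val_le hz (i := 0) (r := R) (r' := R) (by linarith) (by linarith)
      (h _).le (h _).le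
    have h2 : 0 ≤ Real.cosh (P.bLength (0 + 1)) * (P.aSide (0 + 2)).val z :=
      mul_nonneg (Real.cosh_pos _).le (hz _).2
    have h3 := h 0
    rw [← add_div] at h1
    have h4 : (Real.sinh (P.bLength (0 + 1)) ^ 2 + P.cof (0 + 2)) / R ≤ 1 := by
      rw [div_le_one (by linarith)]
      show Real.sinh (P.bLength 1) ^ 2 + P.cof 2 ≤ R
      linarith
    linarith
  have hsub : P.region ⊆ ⋃ i : Fin 3, Metric.closedBall (P.corner (i + 1) i)
      (Real.cosh (P.aLength i) * Real.cosh (Real.arsinh R)) := by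
    intro z hz
    obtain ⟨i, hi⟩ := key z hz
    refine Set.mem_iUnion.2 ⟨i, ?_⟩
    have hc := P.corner_mem_arc hP (i := i) (Fin3.ne i).2.2.1
    have h1 := P.cosh_dist_le i hz hc.1
    rw [hc.2] at h1
    simp only [Real.arsinh_zero, sub_zero, Real.cosh_zero, mul_one] at h1
    have h2 : Real.cosh (Real.arsinh ((P.aSide i).val z)) ≤ Real.cosh (Real.arsinh R) := by
      rw [Real.cosh_le_cosh, abs_of_nonneg (Real.arsinh_nonneg_iff.2 (hz i).2),
        abs_of_nonneg (Real.arsinh_nonneg_iff.2 (by linarith))]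
      exact Real.arsinh_le_arsinh.2 hi
    rw [Metric.mem_closedBall]
    have h3 := Real.self_le_sinh_iff.2 (dist_nonneg : 0 ≤ dist z (P.corner (i + 1) i))
    have h4 := Real.sinh_lt_cosh (dist z (P.corner (i + 1) i))
    have h5 := P.one_lt_cosh_aLength i
    nlinarith
  exact (Bornology.isBounded_iUnion.2 fun i => Metric.isBounded_closedBall).subset hsub

/-! #### Existence -/

end RightAngledHexagon

/-- The complementary half-plane. -/
def HalfPlane.neg (u : HalfPlane) : HalfPlane :=
  ⟨-u.p, -u.q, -u.r, by rw [← u.norm_eq]; ring⟩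

lemma HalfPlane.neg_val (u : HalfPlane) (z : ℍ) : u.neg.val z = -u.val z := by
  simp only [HalfPlane.neg, HalfPlane.val]; ring

lemma HalfPlane.neg_inner (u v : HalfPlane) : u.neg.inner v.neg = u.inner v := by
  simp only [HalfPlane.neg, HalfPlane.inner]; ring

namespace RightAngledHexagon

/-- The configuration of the complementary half-planes. -/
def neg (P : RightAngledHexagon) : RightAngledHexagon where
  bSide i := (P.bSide i).neg
  aSide i := (P.aSide i).neg
  adjacent i j h := by rw [HalfPlane.neg_inner]; exact P.adjacent i j h
  opposite i := by rw [HalfPlane.neg_inner]; exact P.opposite i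
  bSides i j h := by rw [HalfPlane.neg_inner]; exact P.bSides i j h
  aSides i j h := by rw [HalfPlane.neg_inner]; exact P.aSides i j h
  corner := P.corner
  corner_mem i j h := by
    rw [HalfPlane.neg_val, HalfPlane.neg_val, neg_eq_zero, neg_eq_zero]
    exact P.corner_mem i j h

/-- The axioms are invariant under replacing all half-planes by their complements. The sign of `b₂`
at the common vertex of `b₁` and `a₀` tells which of the two configurations is a hexagon. -/
lemma region_nonempty_or (P : RightAngledHexagon) :
    P.region.Nonempty ∨ P.neg.region.Nonempty := by
  have h := P.corner_mem 1 0 (by decide)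
  rcases le_total 0 ((P.bSide (0 + 2)).val (P.corner 1 0)) with h1 | h1
  · left
    exact ⟨_, P.arc_subset 0 ((P.mem_arc_iff).2 ⟨h.2, h.1.ge, h1⟩)⟩
  · right
    refine ⟨P.corner 1 0, P.neg.arc_subset 0 ((P.neg.mem_arc_iff).2 ⟨?_, ?_, ?_⟩)⟩
    · exact (P.neg.corner_mem 1 0 (by decide)).2
    · exact (P.neg.corner_mem 1 0 (by decide)).1.ge
    · show 0 ≤ (P.bSide (0 + 2)).neg.val (P.corner 1 0)
      rw [HalfPlane.neg_val]; linarith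

/-- There is a right-angled hexagon with prescribed lengths of three alternating sides. -/
lemma exists_of_bLength (b : Fin 3 → ℝ) (hb : ∀ i, 0 < b i) :
    ∃ P : RightAngledHexagon, P.region.Nonempty ∧ ∀ i, P.bLength i = b i := by
  let c : Fin 3 → ℝ := fun i => Real.cosh (b i)
  let s : Fin 3 → ℝ := fun i => Real.sinh (b i)
  let m : Fin 3 → ℝ := fun i => c i + c (i + 1) * c (i + 2)
  let D : ℝ := c 0 ^ 2 + c 1 ^ 2 + c 2 ^ 2 + 2 * c 0 * c 1 * c 2 - 1
  have hc : ∀ i, 1 < c i := fun i => Real.one_lt_cosh.2 (hb i).ne'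
  have hs : ∀ i, 0 < s i := fun i => Real.sinh_pos_iff.2 (hb i)
  have hcs : ∀ i, s i < c i := fun i => Real.sinh_lt_cosh _
  have hsq : ∀ i, s i ^ 2 = c i ^ 2 - 1 := fun i => Real.sinh_sq _
  have hD : ∀ i, D = c i ^ 2 + c (i + 1) ^ 2 + c (i + 2) ^ 2 + 2 * c i * c (i + 1) * c (i + 2) - 1 := by
    intro i; fin_cases i <;> simp [D] <;> ring
  have hDs : ∀ i, s i ^ 2 < D := by
    intro i
    rw [hsq, hD i]
    have h0 := hc i
    have h1 := hc (i + 1)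
    have h2 := hc (i + 2)
    have : 0 < c i * c (i + 1) * c (i + 2) := by positivity
    nlinarith
  have hD0 : 0 < D := (sq_nonneg _).trans_lt (hDs 0)
  have hr0 : 0 < √D := Real.sqrt_pos.2 hD0
  have hr2 : √D ^ 2 = D := Real.sq_sqrt hD0.le
  -- `K` is the hyperbolic cosine of the length of `a₀` dictated by the law of cosines.
  set K : ℝ := m 0 / (s 1 * s 2) with hK
  have hK1 : 1 < K := by
    rw [hK, one_lt_div (mul_pos (hs 1) (hs 2))]
    show s 1 * s 2 < c 0 + c 1 * c 2
    nlinarith [hs 1, hs 2, hcs 1, hcs 2, hc 0]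
  have hKr : √(K ^ 2 - 1) ^ 2 = K ^ 2 - 1 := Real.sq_sqrt (by nlinarith)
  -- The product with `(0, 1, 0)` is the middle coordinate, which fixes two of the products. The
  -- factors `K ± √(K² - 1)` are reciprocal, so the third vector stays a unit vector while its
  -- product with the second becomes `-c 0`.
  let A : Fin 3 → Mink := ![(0, 1, 0), (s 2, -c 2, s 2),
    (s 1 * (K + √(K ^ 2 - 1)), -c 1, s 1 * (K - √(K ^ 2 - 1)))]
  have hA : ∀ i, mink (A i) (A i) = 1 := by
    intro i
    fin_cases i
    · simp [A, mink]
    · have := hsq 2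
      simp [A, mink]; linarith
    · have := hsq 1
      simp [A, mink]
      linear_combination (-1 : ℝ) * this + s 1 ^ 2 * hKr
  have hK2 : s 1 * s 2 * K = c 0 + c 1 * c 2 := by
    rw [hK, mul_div_cancel₀ _ (mul_pos (hs 1) (hs 2)).ne']; rfl
  have hAA : ∀ i, mink (A (i + 1)) (A (i + 2)) = -c i := by
    intro i
    fin_cases i
    · simp [A, mink]
      linear_combination (-1 : ℝ) * hK2
    · simp [A, mink]
    · simp [A, mink]
  have hAA' : ∀ i, mink (A (i + 2)) (A i) = -c (i + 1) := by
    intro i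
    have := hAA (i + 1)
    rwa [(Fin3.add i).1, (Fin3.add i).2.1] at this
  have hAA'' : ∀ i, mink (A i) (A (i + 1)) = -c (i + 2) := by
    intro i
    have := hAA (i + 2)
    rwa [(Fin3.add i).2.2.1, (Fin3.add i).2.2.2] at this
  have hneg : ∀ i j, i ≠ j → mink (A i) (A j) < -1 := by
    intro i j hij
    rcases Fin3.cases i j with rfl | rfl | rfl
    · exact absurd rfl hij
    · rw [hAA'']; linarith [hc (i + 2)]
    · rw [mink_comm, hAA']; linarith [hc (i + 1)]
  -- The vectors of cofactors: up to the factor `-D` they form the dual basis of `A`. Normalised,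
  -- they are the normals of the sides `bᵢ`.
  let E : Fin 3 → Mink := fun i =>
    m (i + 2) • A (i + 1) + m (i + 1) • A (i + 2) - s i ^ 2 • A i
  have hEA : ∀ i, mink (E i) (A i) = -D := by
    intro i
    obtain ⟨e1, e2, e3, e4⟩ := Fin3.add i
    simp only [E, mink_add_left, mink_sub_left, mink_smul_left, hA, hAA']
    rw [mink_comm, hAA'', hD i, hsq]
    simp only [m, e1, e2, e3, e4]
    ring
  have hEA1 : ∀ i, mink (E i) (A (i + 1)) = 0 := by
    intro i
    obtain ⟨e1, e2, e3, e4⟩ := Fin3.add i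
    simp only [E, mink_add_left, mink_sub_left, mink_smul_left, hA, hAA'']
    rw [mink_comm, hAA, hsq]
    simp only [m, e1, e2, e3, e4]
    ring
  have hEA2 : ∀ i, mink (E i) (A (i + 2)) = 0 := by
    intro i
    obtain ⟨e1, e2, e3, e4⟩ := Fin3.add i
    simp only [E, mink_add_left, mink_sub_left, mink_smul_left, hA, hAA]
    rw [mink_comm, hAA', hsq]
    simp only [m, e1, e2, e3, e4]
    ring
  have hEE : ∀ i, mink (E i) (E i) = s i ^ 2 * D := by
    intro i
    have : mink (E i) (E i) = m (i + 2) * mink (E i) (A (i + 1)) + m (i + 1) * mink (E i) (A (i + 2))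
      - s i ^ 2 * mink (E i) (A i) := by
      conv_lhs => rw [show E i = m (i + 2) • A (i + 1) + m (i + 1) • A (i + 2) - s i ^ 2 • A i from rfl,
        mink_sub_right, mink_add_right, mink_smul_right, mink_smul_right, mink_smul_right]
    rw [this, hEA, hEA1, hEA2]; ring
  have hEE1 : ∀ i, mink (E i) (E (i + 1)) = -(m (i + 2) * D) := by
    intro i
    obtain ⟨e1, e2, e3, e4⟩ := Fin3.add i
    have : mink (E i) (E (i + 1)) = m i * mink (E i) (A (i + 2)) + m (i + 2) * mink (E i) (A i)
      - s (i + 1) ^ 2 * mink (E i) (A (i + 1)) := by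
      conv_lhs => rw [show E (i + 1) = m (i + 1 + 2) • A (i + 1 + 1) + m (i + 1 + 1) • A (i + 1 + 2)
        - s (i + 1) ^ 2 • A (i + 1) from rfl,
        mink_sub_right, mink_add_right, mink_smul_right, mink_smul_right, mink_smul_right, e1, e2]
    rw [this, hEA, hEA1, hEA2]; ring
  let B : Fin 3 → Mink := fun i => (√D * s i)⁻¹ • E i
  have hBB : ∀ i, mink (B i) (B i) = 1 := by
    intro i
    have := hs i
    simp only [B, mink_smul_left, mink_smul_right, hEE]
    field_simp
    linarith
  have hBA : ∀ i j, i ≠ j → mink (B i) (A j) = 0 := by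
    intro i j hij
    rcases Fin3.cases i j with rfl | rfl | rfl
    · exact absurd rfl hij
    · simp [B, hEA1]
    · simp [B, hEA2]
  have hBAi : ∀ i, mink (B i) (A i) < -1 := by
    intro i
    have h1 := hs i
    simp only [B, mink_smul_left, hEA]
    have h2 : s i < √D := by
      apply lt_of_pow_lt_pow_left₀ 2 hr0.le
      rw [hr2]; exact hDs i
    rw [mul_neg, neg_lt_neg_iff, inv_mul_eq_div, one_lt_div (by positivity)]
    nlinarith
  have hBB1 : ∀ i, mink (B i) (B (i + 1)) < -1 := by
    intro i
    have h1 := hs i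
    have h2 := hs (i + 1)
    simp only [B, mink_smul_left, mink_smul_right, hEE1]
    have e : (√D * s (i + 1))⁻¹ * ((√D * s i)⁻¹ * -(m (i + 2) * D)) =
      -(m (i + 2) / (s i * s (i + 1))) := by
      field_simp
      rw [hr2]; ring
    rw [e, neg_lt_neg_iff, one_lt_div (by positivity)]
    obtain ⟨e1, e2, e3, e4⟩ := Fin3.add i
    simp only [m, e3, e4]
    nlinarith [hcs i, hcs (i + 1), hc (i + 2)]
  have hnegB : ∀ i j, i ≠ j → mink (B i) (B j) < -1 := by
    intro i j hij
    rcases Fin3.cases i j with rfl | rfl | rfl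
    · exact absurd rfl hij
    · exact hBB1 i
    · have := hBB1 (i + 2)
      rw [(Fin3.add i).2.2.1] at this
      rwa [mink_comm]
  choose uA huA using fun i => exists_halfPlane (hA i)
  choose uB huB using fun i => exists_halfPlane (hBB i)
  have hcorner : ∀ i j, ∃ z : ℍ, i ≠ j → (uB i).val z = 0 ∧ (uA j).val z = 0 := by
    intro i j
    by_cases hij : i = j
    · exact ⟨UpperHalfPlane.I, fun h => absurd hij h⟩
    -- The cross product of two orthogonal unit spacelike vectors has square `-1`: the point where
    -- the two geodesics meet.
    obtain ⟨n, h1, h2, h3⟩ := exists_cross (B i) (A j)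
    rw [hBA i j hij, hBB, hA] at h3
    obtain ⟨z, hz⟩ := exists_point_or (x := n) (by rw [h3]; norm_num)
    refine ⟨z, fun _ => ?_⟩
    rw [HalfPlane.val_eq, HalfPlane.val_eq, huA, huB, mink_comm, mink_comm (A j)]
    rcases hz with hz | hz <;> rw [hz] <;> simp [h1, h2]
  choose z hz using hcorner
  let P : RightAngledHexagon :=
    { bSide := uB
      aSide := uA
      adjacent := fun i j h => by rw [HalfPlane.inner_eq, huA, huB]; exact hBA i j h
      opposite := fun i => by rw [HalfPlane.inner_eq, huA, huB]; exact hBAi i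
      bSides := fun i j h => by rw [HalfPlane.inner_eq, huB, huB]; exact hnegB i j h
      aSides := fun i j h => by rw [HalfPlane.inner_eq, huA, huA]; exact hneg i j h
      corner := z
      corner_mem := fun i j h => hz i j h }
  have hlen : ∀ i, P.bLength i = b i := by
    intro i
    have h1 := P.inner_aSide i
    have h2 : (P.aSide (i + 1)).inner (P.aSide (i + 2)) = -Real.cosh (b i) := by
      show (uA (i + 1)).inner (uA (i + 2)) = -c i
      rw [HalfPlane.inner_eq, huA, huA, hAA]
    have h3 := abs_eq_abs_of_cosh_eq (a := P.bLength i) (b := b i) (by linarith)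
    rwa [abs_of_pos (hb i), abs_of_pos (P.bLength_pos i)] at h3
  rcases P.region_nonempty_or with h | h
  · exact ⟨P, h, hlen⟩
  · exact ⟨P.neg, h, hlen⟩

end RightAngledHexagon


/-! ### Distances defined by lengths of paths -/

/-- `R x y r` is to be read as: the points `x` and `y` are joined by a path of length `r`. -/
structure IsLengthRel {α : Type*} (R : α → α → ℝ → Prop) : Prop where
  refl : ∀ x, R x x 0
  symm : ∀ x y r, R x y r → R y x r
  trans : ∀ x y z r s, R x y r → R y z s → R x z (r + s)
  nonneg : ∀ x y r, R x y r → 0 ≤ r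
  conn : ∀ x y, ∃ r, R x y r

namespace IsLengthRel

variable {α : Type*} {R : α → α → ℝ → Prop} (h : IsLengthRel R)
include h

lemma bddBelow (x y : α) : BddBelow {r | R x y r} := ⟨0, fun _ hr => h.nonneg x y _ hr⟩

lemma sInf_le {x y : α} {r : ℝ} (hr : R x y r) : sInf {r | R x y r} ≤ r :=
  csInf_le (h.bddBelow x y) hr

lemma le_sInf {x y : α} {c : ℝ} (hc : ∀ r, R x y r → c ≤ r) : c ≤ sInf {r | R x y r} :=
  le_csInf (h.conn x y) hc

lemma sInf_nonneg (x y : α) : 0 ≤ sInf {r | R x y r} := h.le_sInf fun _ hr => h.nonneg x y _ hr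

lemma sInf_self (x : α) : sInf {r | R x x r} = 0 :=
  le_antisymm (h.sInf_le (h.refl x)) (h.sInf_nonneg x x)

lemma sInf_comm (x y : α) : sInf {r | R x y r} = sInf {r | R y x r} := by
  congr 1; ext r; exact ⟨h.symm x y r, h.symm y x r⟩

lemma exists_lt {x y : α} {c : ℝ} (hc : sInf {r | R x y r} < c) : ∃ r < c, R x y r := by
  obtain ⟨r, hr, hrc⟩ := exists_lt_of_csInf_lt (h.conn x y) hc
  exact ⟨r, hrc, hr⟩

lemma sInf_triangle (x y z : α) :
    sInf {r | R x z r} ≤ sInf {r | R x y r} + sInf {r | R y z r} := by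
  apply le_of_forall_pos_le_add
  intro ε hε
  obtain ⟨r, hr, hr'⟩ := h.exists_lt (x := x) (y := y) (lt_add_of_pos_right _ (half_pos hε))
  obtain ⟨s, hs, hs'⟩ := h.exists_lt (x := y) (y := z) (lt_add_of_pos_right _ (half_pos hε))
  have := h.sInf_le (h.trans x y z r s hr' hs')
  linarith

end IsLengthRel

/-- A local comparison along an interval implies a global one. -/
lemma le_of_locally_le {D : ℝ → ℝ → ℝ} {V : ℝ → ℝ} (htri : ∀ a b c, D a c ≤ D a b + D b c)
    (h0 : D 0 0 ≤ 0)
    (hloc : ∀ t ∈ Set.Icc (0 : ℝ) 1, ∃ δ > 0, ∀ t' ∈ Set.Icc (0 : ℝ) 1, |t' - t| < δ →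
      (t ≤ t' → D t t' ≤ V t' - V t) ∧ (t' ≤ t → D t' t ≤ V t - V t')) :
    D 0 1 ≤ V 1 - V 0 := by
  set S : Set ℝ := {t | t ∈ Set.Icc (0 : ℝ) 1 ∧ D 0 t ≤ V t - V 0} with hS
  have hS0 : (0 : ℝ) ∈ S := ⟨by simp, by simpa using h0⟩
  have hSb : BddAbove S := ⟨1, fun t ht => ht.1.2⟩
  set τ := sSup S with hτ
  have hτ0 : 0 ≤ τ := le_csSup hSb hS0
  have hτ1 : τ ≤ 1 := csSup_le ⟨0, hS0⟩ fun t ht => ht.1.2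
  obtain ⟨δ, hδ, hl⟩ := hloc τ ⟨hτ0, hτ1⟩
  have hτS : D 0 τ ≤ V τ - V 0 := by
    obtain ⟨t, ht, htτ⟩ := exists_lt_of_lt_csSup ⟨0, hS0⟩ (show τ - δ < τ by linarith)
    have h1 : t ≤ τ := le_csSup hSb ht
    have h2 := (hl t ht.1 (by rw [abs_lt]; constructor <;> linarith)).2 h1
    linarith [htri 0 t τ, ht.2]
  rcases hτ1.eq_or_lt with h1 | h1
  · rwa [h1] at hτS
  · exfalso
    set t := min 1 (τ + δ / 2)
    have ht : τ < t := lt_min h1 (by linarith)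
    have ht1 : t ∈ Set.Icc (0 : ℝ) 1 := ⟨by linarith, min_le_left _ _⟩
    have ht2 : t ≤ τ + δ / 2 := min_le_right _ _
    have h2 := (hl t ht1 (by rw [abs_lt]; constructor <;> linarith)).1 ht.le
    have : t ∈ S := ⟨ht1, by linarith [htri 0 τ t]⟩
    linarith [le_csSup hSb this]

/-- Two points of a metric space are joined by a path of length at most `r`. -/
def JoinedByLength {X : Type*} [PseudoEMetricSpace X] (x y : X) (r : ℝ) : Prop :=
  ∃ γ : Path x y, eVariationOn γ Set.univ ≤ ENNReal.ofReal r

namespace JoinedByLength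

variable {X : Type*} [PseudoEMetricSpace X]

lemma refl (x : X) : JoinedByLength x x 0 :=
  ⟨Path.refl x, by
    rw [eVariationOn.constant_on]
    · simp
    · rintro _ ⟨a, -, rfl⟩ _ ⟨b, -, rfl⟩; rfl⟩

lemma mono {x y : X} {r s : ℝ} (h : JoinedByLength x y r) (hrs : r ≤ s) : JoinedByLength x y s :=
  let ⟨γ, hγ⟩ := h
  ⟨γ, hγ.trans (ENNReal.ofReal_le_ofReal hrs)⟩

lemma trans {x y z : X} {r s : ℝ} (hr : 0 ≤ r) (hs : 0 ≤ s) (h : JoinedByLength x y r)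
    (h' : JoinedByLength y z s) : JoinedByLength x z (r + s) := by
  obtain ⟨γ, hγ⟩ := h
  obtain ⟨γ', hγ'⟩ := h'
  refine ⟨γ.trans γ', ?_⟩
  let m : unitInterval := ⟨1 / 2, by norm_num, by norm_num⟩
  have hu : (Set.univ : Set unitInterval) = Set.Iic m ∪ Set.Ici m := by simp
  rw [hu, eVariationOn.union _ isGreatest_Iic isLeast_Ici, ENNReal.ofReal_add hr hs]
  gcongr
  · have e : Set.EqOn (γ.trans γ') (γ ∘ fun t : unitInterval =>
        Set.projIcc (0 : ℝ) 1 zero_le_one (2 * t)) (Set.Iic m) := by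
      intro t ht
      have ht' : (t : ℝ) ≤ 1 / 2 := ht
      show (if (t : ℝ) ≤ 1 / 2 then γ.extend (2 * t) else γ'.extend (2 * t - 1)) = _
      rw [if_pos ht']; rfl
    rw [eVariationOn.congr e]
    refine (eVariationOn.comp_le_of_monotoneOn γ (s := Set.univ) _ ?_ (Set.mapsTo_univ _ _)).trans hγ
    intro a _ b _ hab
    exact Set.monotone_projIcc _ (by have : (a : ℝ) ≤ b := hab; linarith)
  · have e : Set.EqOn (γ.trans γ') (γ' ∘ fun t : unitInterval =>
        Set.projIcc (0 : ℝ) 1 zero_le_one (2 * t - 1)) (Set.Ici m) := by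
      intro t ht
      have ht' : 1 / 2 ≤ (t : ℝ) := ht
      show (if (t : ℝ) ≤ 1 / 2 then γ.extend (2 * t) else γ'.extend (2 * t - 1)) = _
      split_ifs with h1
      · have h2 : (t : ℝ) = 1 / 2 := le_antisymm h1 ht'
        simp [h2]
      · rfl
    rw [eVariationOn.congr e]
    refine (eVariationOn.comp_le_of_monotoneOn γ' (s := Set.univ) _ ?_ (Set.mapsTo_univ _ _)).trans
      hγ'
    intro a _ b _ hab
    exact Set.monotone_projIcc _ (by have : (a : ℝ) ≤ b := hab; linarith)

end JoinedByLength

lemma JoinedByLength.of_lipschitz {X : Type*} [PseudoMetricSpace X] {f : unitInterval → X} {d : ℝ}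
    (hd : 0 ≤ d) (hf : ∀ s t : unitInterval, dist (f s) (f t) ≤ d * dist s t) :
    JoinedByLength (f 0) (f 1) d := by
  set K : NNReal := ⟨d, hd⟩ with hK
  have hl : LipschitzWith K f := LipschitzWith.of_dist_le_mul hf
  refine ⟨⟨⟨f, hl.continuous⟩, rfl, rfl⟩, ?_⟩
  have h1 : eVariationOn (fun t : unitInterval => (t : ℝ)) Set.univ ≤ ENNReal.ofReal 1 := by
    have h2 : MonotoneOn (fun t : unitInterval => (t : ℝ)) Set.univ := fun a _ b _ h => h
    have := (h2.eVariationOn_eq (a := 0) (b := 1) (Set.mem_univ _) (Set.mem_univ _)).le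
    have h3 : (Set.univ : Set unitInterval) ∩ Set.Icc 0 1 = Set.univ := by
      ext t
      exact ⟨fun _ => Set.mem_univ _, fun _ => ⟨Set.mem_univ _, t.2.1, t.2.2⟩⟩
    rw [h3] at this
    simpa using this
  have h2 : eVariationOn f Set.univ ≤ K *
      eVariationOn (fun t : unitInterval => (t : ℝ)) Set.univ := by
    have hg : LipschitzOnWith K (fun t : ℝ => f (Set.projIcc 0 1 zero_le_one t))
        (Set.Icc 0 1) := by
      apply LipschitzOnWith.of_dist_le_mul
      intro a ha b hb
      rw [Set.projIcc_of_mem _ ha, Set.projIcc_of_mem _ hb]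
      exact hf ⟨a, ha⟩ ⟨b, hb⟩
    have h3 := hg.comp_eVariationOn_le (s := (Set.univ : Set unitInterval))
      (g := fun t : unitInterval => (t : ℝ)) (fun t _ => t.2)
    have h4 : (fun t : ℝ => f (Set.projIcc 0 1 zero_le_one t)) ∘ (fun t : unitInterval => (t : ℝ))
        = f := by
      ext t; simp
    rwa [h4] at h3
  refine h2.trans ?_
  have h5 : (K : ENNReal) = ENNReal.ofReal d := by
    rw [ENNReal.ofReal, Real.toNNReal_of_nonneg hd, hK]; rfl
  rw [h5]
  calc ENNReal.ofReal d * _ ≤ ENNReal.ofReal d * ENNReal.ofReal 1 := by gcongr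
    _ = ENNReal.ofReal d := by simp

/-! ### Developing adjacent hexagons -/

namespace RightAngledHexagon

lemma eq_of_arc_coord (P : RightAngledHexagon) (i : Fin 3) {z w : ℍ}
    (h : (P.aSide i).val z = (P.aSide i).val w)
    (h1 : (P.bSide (i + 1)).val z = (P.bSide (i + 1)).val w)
    (h2 : (P.bSide (i + 2)).val z = (P.bSide (i + 2)).val w) : z = w := by
  have e := P.arc_cosh_dist i z w
  have e' := P.arc_cosh_dist i w w
  rw [h, h1, h2, ← e', dist_self] at e
  have := abs_eq_abs_of_cosh_eq e
  simpa using this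

/-- The isometry which places the second hexagon next to the first one, along an arc of the same
length. -/
lemma exists_develop {P P' : RightAngledHexagon} (hP : P.region.Nonempty)
    (hP' : P'.region.Nonempty) {i j : Fin 3} (h : P'.aLength j = P.aLength i) :
    ∃ g : ℍ ≃ᵢ ℍ, ∀ z, (P.aSide i).val (g z) = -(P'.aSide j).val z ∧
      (P.bSide (i + 1)).val (g z) = (P'.bSide (j + 2)).val z ∧
      (P.bSide (i + 2)).val (g z) = (P'.bSide (j + 1)).val z := by
  have hex : ∀ z, ∃ w, (P.aSide i).val w = -(P'.aSide j).val z ∧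
      (P.bSide (i + 1)).val w = (P'.bSide (j + 2)).val z ∧
      (P.bSide (i + 2)).val w = (P'.bSide (j + 1)).val z := by
    intro z
    apply P.exists_arc_coord i hP (P'.bSide_add_pos hP' (Fin3.ne j).2.2.2.2.2 z)
    have := P'.arc_norm j z
    rw [h] at this
    linear_combination this
  have hex' : ∀ w, ∃ z, (P'.aSide j).val z = -(P.aSide i).val w ∧
      (P'.bSide (j + 1)).val z = (P.bSide (i + 2)).val w ∧
      (P'.bSide (j + 2)).val z = (P.bSide (i + 1)).val w := by
    intro w
    apply P'.exists_arc_coord j hP' (P.bSide_add_pos hP (Fin3.ne i).2.2.2.2.2 w)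
    have := P.arc_norm i w
    rw [h]
    linear_combination this
  choose g hg using hex
  choose g' hg' using hex'
  refine ⟨IsometryEquiv.mk' g g' ?_ ?_, hg⟩
  · intro w
    apply P.eq_of_arc_coord i
    · rw [(hg _).1, (hg' _).1, neg_neg]
    · rw [(hg _).2.1, (hg' _).2.2]
    · rw [(hg _).2.2, (hg' _).2.1]
  · apply Isometry.of_dist_eq
    intro z w
    have e := P.arc_cosh_dist i (g z) (g w)
    have e' := P'.arc_cosh_dist j z w
    rw [(hg z).1, (hg z).2.1, (hg z).2.2, (hg w).1, (hg w).2.1, (hg w).2.2] at e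
    rw [h] at e'
    have := abs_eq_abs_of_cosh_eq (a := dist (g z) (g w)) (b := dist z w) (by rw [e, e']; ring)
    rwa [abs_of_nonneg dist_nonneg, abs_of_nonneg dist_nonneg] at this

end RightAngledHexagon


/-! ### Gluing hexagons -/

/-- Right-angled hexagons, with a pairing of their arcs by arcs of the same length, such that no
hexagon is glued to itself and such that the pairing connects the hexagons. -/
structure HexGluing where
  V : Type
  [fintypeV : Fintype V]
  [nonemptyV : Nonempty V]
  hex : V → RightAngledHexagon
  opp : V × Fin 3 → V × Fin 3
  opp_opp : ∀ h, opp (opp h) = h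
  opp_ne : ∀ h, (opp h).1 ≠ h.1
  nonempty : ∀ v, (hex v).region.Nonempty
  aLength_opp : ∀ h, (hex (opp h).1).aLength (opp h).2 = (hex h.1).aLength h.2
  connected : ∀ v v', Relation.ReflTransGen (fun v v' => ∃ i, (opp (v, i)).1 = v') v v'

namespace HexGluing

variable (S : HexGluing)

/-! ### The chain pseudometric on the disjoint union of the hexagons -/

instance : Fintype S.V := S.fintypeV
instance : Nonempty S.V := S.nonemptyV

/-- The disjoint union of the hexagons. -/
def Pt : Type := {q : S.V × ℍ // q.2 ∈ (S.hex q.1).region}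

variable {S}

/-- The point `z` of the hexagon `v`. -/
def pt (v : S.V) (z : ℍ) (hz : z ∈ (S.hex v).region) : S.Pt := ⟨(v, z), hz⟩

/-- The points which are to be identified. -/
def Glued (q q' : S.Pt) : Prop :=
  ∃ i j, S.opp (q.1.1, i) = (q'.1.1, j) ∧
    ((S.hex q.1.1).aSide i).val q.1.2 = 0 ∧ ((S.hex q'.1.1).aSide j).val q'.1.2 = 0 ∧
    ((S.hex q.1.1).bSide (i + 1)).val q.1.2 = ((S.hex q'.1.1).bSide (j + 2)).val q'.1.2 ∧
    ((S.hex q.1.1).bSide (i + 2)).val q.1.2 = ((S.hex q'.1.1).bSide (j + 1)).val q'.1.2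

lemma Glued.symm {q q' : S.Pt} (h : Glued q q') : Glued q' q := by
  obtain ⟨i, j, h1, h2, h3, h4, h5⟩ := h
  refine ⟨j, i, ?_, h3, h2, h5.symm, h4.symm⟩
  rw [← h1, S.opp_opp]

/-- Chains of segments in the hexagons. -/
inductive Chain (p : S.Pt) : S.Pt → ℝ → Prop
  | refl : Chain p p 0
  | move (q q' : S.Pt) (r : ℝ) : q.1.1 = q'.1.1 → Chain p q r →
      Chain p q' (r + dist q.1.2 q'.1.2)
  | glue (q q' : S.Pt) (r : ℝ) : Glued q q' → Chain p q r → Chain p q' r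

lemma Chain.trans {p q q' : S.Pt} {r s : ℝ} (h : Chain p q r) (h' : Chain q q' s) :
    Chain p q' (r + s) := by
  induction h' with
  | refl => simpa using h
  | move a b s hab _ ih => rw [← add_assoc]; exact ih.move _ _ _ hab
  | glue a b s hab _ ih => exact ih.glue _ _ _ hab

lemma Chain.symm {p q : S.Pt} {r : ℝ} (h : Chain p q r) : Chain q p r := by
  induction h with
  | refl => exact .refl
  | move a b s hab _ ih =>
    have := (Chain.move b a 0 hab.symm .refl).trans ih
    rwa [dist_comm, zero_add, add_comm] at this
  | glue a b s hab _ ih =>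
    have := (Chain.glue b a 0 hab.symm .refl).trans ih
    rwa [zero_add] at this

/-- A corner of one arc, pulled back by the developing isometry, lies on the other arc. Hence chains
can pass between adjacent hexagons and all distances are finite. -/
lemma exists_glued (v : S.V) (i : Fin 3) :
    ∃ q q' : S.Pt, q.1.1 = v ∧ q'.1.1 = (S.opp (v, i)).1 ∧ Glued q q' := by
  obtain ⟨g, hg⟩ := RightAngledHexagon.exists_develop (S.nonempty v) (S.nonempty (S.opp (v, i)).1)
    (S.aLength_opp (v, i))
  have hc := (S.hex v).corner_mem_arc (S.nonempty v) (i := i) (Fin3.ne i).2.2.1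
  set c := (S.hex v).corner (i + 1) i
  obtain ⟨h1, h2, h3⟩ := hg (g.symm c)
  rw [g.apply_symm_apply] at h1 h2 h3
  have hc' := ((S.hex v).mem_arc_iff).1 hc
  have hw : g.symm c ∈ (S.hex (S.opp (v, i)).1).arc (S.opp (v, i)).2 := by
    rw [RightAngledHexagon.mem_arc_iff]
    refine ⟨by linarith [hc'.1], by rw [← h3]; exact hc'.2.2, by rw [← h2]; exact hc'.2.1⟩
  exact ⟨⟨(v, c), hc.1⟩, ⟨((S.opp (v, i)).1, g.symm c), hw.1⟩, rfl, rfl,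
    i, (S.opp (v, i)).2, rfl, hc.2, hw.2, h2, h3⟩

variable (S) in
lemma isLengthRel : IsLengthRel (Chain (S := S)) where
  refl p := .refl
  symm _ _ _ h := h.symm
  trans _ _ _ _ _ h h' := h.trans h'
  nonneg p q r h := by
    induction h with
    | refl => exact le_rfl
    | move a b s hab _ ih => exact add_nonneg ih dist_nonneg
    | glue a b s hab _ ih => exact ih
  conn p q := by
    have key : ∀ v, Relation.ReflTransGen (fun v v' => ∃ i, (S.opp (v, i)).1 = v') p.1.1 v →
        ∀ q : S.Pt, q.1.1 = v → ∃ r, Chain p q r := by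
      intro v hv
      induction hv with
      | refl => exact fun q hq => ⟨_, Chain.move p q 0 hq.symm .refl⟩
      | tail _ h ih =>
        intro q hq
        obtain ⟨i, hi⟩ := h
        obtain ⟨a, b, ha, hb, hab⟩ := exists_glued _ i
        obtain ⟨r, hr⟩ := ih a ha
        exact ⟨_, Chain.move b q r (by rw [hb, hi, hq]) (hr.glue _ _ _ hab)⟩
    exact key q.1.1 (S.connected _ _) q rfl

instance : PseudoMetricSpace S.Pt where
  dist p q := sInf {r | Chain p q r}
  dist_self := S.isLengthRel.sInf_self
  dist_comm := S.isLengthRel.sInf_comm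
  dist_triangle := S.isLengthRel.sInf_triangle

lemma dist_le_of_chain {p q : S.Pt} {r : ℝ} (h : Chain p q r) : dist p q ≤ r :=
  S.isLengthRel.sInf_le h

lemma dist_le_of_eq {p q : S.Pt} (h : p.1.1 = q.1.1) : dist p q ≤ dist p.1.2 q.1.2 := by
  have := dist_le_of_chain (Chain.move p q 0 h .refl)
  rwa [zero_add] at this

lemma dist_eq_zero_of_glued {p q : S.Pt} (h : Glued p q) : dist p q = 0 :=
  le_antisymm (dist_le_of_chain (Chain.glue p q 0 h .refl)) dist_nonneg

/-- Functions that are compatible with the gluing bound the distance from below. -/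
lemma sub_le_dist {F : S.Pt → ℝ}
    (h1 : ∀ q q' : S.Pt, q.1.1 = q'.1.1 → F q' - F q ≤ dist q.1.2 q'.1.2)
    (h2 : ∀ q q' : S.Pt, Glued q q' → F q = F q') (p q : S.Pt) : F q - F p ≤ dist p q := by
  apply S.isLengthRel.le_sInf
  intro r hr
  induction hr with
  | refl => simp
  | move a b s hab _ ih => linarith [h1 a b hab]
  | glue a b s hab _ ih => rw [← h2 a b hab]; exact ih

/-! #### Charts -/

variable (S) in
/-- The union of two adjacent hexagons, developed in `ℍ` by the isometry `g`, around a point `z` of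
the first one, and a radius `δ` such that the balls `B(y,δ)`, for `y` in `B(z,δ)`, do not meet the
arcs other than the common one. -/
structure EdgeChart where
  v : S.V
  i : Fin 3
  v' : S.V
  j : Fin 3
  opp_eq : S.opp (v, i) = (v', j)
  g : ℍ ≃ᵢ ℍ
  hg : ∀ z, ((S.hex v).aSide i).val (g z) = -((S.hex v').aSide j).val z ∧
      ((S.hex v).bSide (i + 1)).val (g z) = ((S.hex v').bSide (j + 2)).val z ∧
      ((S.hex v).bSide (i + 2)).val (g z) = ((S.hex v').bSide (j + 1)).val z
  z : ℍ
  z_mem : z ∈ (S.hex v).region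
  δ : ℝ
  δ_pos : 0 < δ
  far : ∀ k ≠ i, ∀ u ∈ (S.hex v).arc k, 2 * δ ≤ dist u z
  far' : ∀ k ≠ j, ∀ u ∈ (S.hex v').arc k, 2 * δ ≤ dist (g u) z

lemma exists_edgeChart (v : S.V) (i : Fin 3) (z : ℍ) (hz : z ∈ (S.hex v).region)
    (h : ∀ k ≠ i, z ∉ (S.hex v).arc k) : ∃ c : EdgeChart S, c.v = v ∧ c.i = i ∧ c.z = z := by
  obtain ⟨g, hg⟩ := RightAngledHexagon.exists_develop (S.nonempty v) (S.nonempty (S.opp (v, i)).1)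
    (S.aLength_opp (v, i))
  set v' := (S.opp (v, i)).1
  set j := (S.opp (v, i)).2
  have hc : IsClosed ((⋃ k ∈ {k | k ≠ i}, (S.hex v).arc k) ∪
      ⋃ k ∈ {k | k ≠ j}, g '' (S.hex v').arc k) := by
    apply IsClosed.union
    · exact (Set.toFinite _).isClosed_biUnion fun k _ => RightAngledHexagon.isClosed_arc _ _
    · exact (Set.toFinite _).isClosed_biUnion fun k _ =>
        g.toHomeomorph.isClosedMap _ (RightAngledHexagon.isClosed_arc _ _)
  have hz' : z ∈ ((⋃ k ∈ {k | k ≠ i}, (S.hex v).arc k) ∪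
      ⋃ k ∈ {k | k ≠ j}, g '' (S.hex v').arc k)ᶜ := by
    simp only [Set.mem_compl_iff, Set.mem_union, Set.mem_iUnion, not_or, not_exists]
    refine ⟨h, ?_⟩
    -- A point of another arc of the second hexagon has positive distance to the common arc, so it
    -- is developed strictly outside the first half-plane.
    rintro k hk ⟨u, hu, rfl⟩
    have h1 := (hg u).1
    have h2 : 0 < ((S.hex v').aSide j).val u := (S.hex v').aSide_pos hu.1 (Ne.symm hk) hu.2
    have h3 : 0 ≤ ((S.hex v).aSide i).val (g u) := (hz i).2
    linarith
  obtain ⟨ε, hε, hb⟩ := Metric.isOpen_iff.1 hc.isOpen_compl z hz'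
  refine ⟨⟨v, i, v', j, rfl, g, hg, z, hz, ε / 2, by positivity, ?_, ?_⟩, rfl, rfl, rfl⟩
  · intro k hk u hu
    by_contra! hlt
    have := hb (show u ∈ Metric.ball z ε by rw [Metric.mem_ball]; linarith)
    exact this (Or.inl (Set.mem_biUnion (show k ∈ {k | k ≠ i} from hk) hu))
  · intro k hk u hu
    by_contra! hlt
    have := hb (show g u ∈ Metric.ball z ε by rw [Metric.mem_ball]; linarith)
    exact this (Or.inr (Set.mem_biUnion (show k ∈ {k | k ≠ j} from hk) ⟨u, hu, rfl⟩))

namespace EdgeChart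

variable (c : EdgeChart S)

lemma ne : c.v' ≠ c.v := by
  have := S.opp_ne (c.v, c.i)
  rwa [c.opp_eq] at this

lemma opp_eq' : S.opp (c.v', c.j) = (c.v, c.i) := by rw [← c.opp_eq, S.opp_opp]

/-- `c.At q u`: the point `q` of the two hexagons is developed to `u`. -/
def At (q : S.Pt) (u : ℍ) : Prop := (q.1.1 = c.v ∧ u = q.1.2) ∨ (q.1.1 = c.v' ∧ u = c.g q.1.2)

open Classical in
/-- The truncated distance to `y` in the developed hexagons. -/
def bump (y : ℍ) (q : S.Pt) : ℝ :=
  if q.1.1 = c.v then min (dist q.1.2 y) c.δ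
  else if q.1.1 = c.v' then min (dist (c.g q.1.2) y) c.δ else c.δ

lemma bump_at {q : S.Pt} {u y : ℍ} (h : c.At q u) : c.bump y q = min (dist u y) c.δ := by
  rcases h with ⟨h, rfl⟩ | ⟨h, rfl⟩
  · rw [bump, if_pos h]
  · rw [bump, if_neg (by rw [h]; exact c.ne), if_pos h]

lemma bump_not_at {q : S.Pt} {y : ℍ} (h : ¬∃ u, c.At q u) : c.bump y q = c.δ := by
  rw [bump, if_neg fun h1 => h ⟨_, Or.inl ⟨h1, rfl⟩⟩, if_neg fun h1 => h ⟨_, Or.inr ⟨h1, rfl⟩⟩]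

lemma bump_lipschitz (y : ℍ) (q q' : S.Pt) (h : q.1.1 = q'.1.1) :
    c.bump y q' - c.bump y q ≤ dist q.1.2 q'.1.2 := by
  have key : ∀ a b : ℍ, min (dist a y) c.δ - min (dist b y) c.δ ≤ dist b a := by
    intro a b
    have h1 := dist_triangle a b y
    rw [dist_comm b a]
    rcases le_total (dist b y) c.δ with h2 | h2
    · rw [min_eq_left h2]; linarith [min_le_left (dist a y) c.δ]
    · rw [min_eq_right h2]
      linarith [min_le_right (dist a y) c.δ, (dist_nonneg : 0 ≤ dist a b)]
  unfold bump
  rw [h]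
  split_ifs
  · exact key _ _
  · rw [← c.g.dist_eq q.1.2]; exact key _ _
  · simp

/-- The other arcs are at distance at least `2δ` from the base point, so the truncated distance is
constant on them. Therefore the function cannot detect any gluing except that of the common arc. -/
lemma bump_of_ne {y : ℍ} (hy : dist y c.z < c.δ) {q : S.Pt} {k : Fin 3}
    (hq : ((S.hex q.1.1).aSide k).val q.1.2 = 0) (h1 : (q.1.1, k) ≠ (c.v, c.i))
    (h2 : (q.1.1, k) ≠ (c.v', c.j)) : c.bump y q = c.δ := by
  have key : ∀ u : ℍ, 2 * c.δ ≤ dist u c.z → min (dist u y) c.δ = c.δ := by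
    intro u hu
    apply min_eq_right
    linarith [dist_triangle u y c.z]
  obtain ⟨⟨v, w⟩, hw⟩ := q
  simp only at hq h1 h2 hw
  unfold bump
  simp only
  split_ifs with h3 h4
  · subst h3
    exact key _ (c.far k (fun hk => h1 (by rw [hk])) _ ⟨hw, hq⟩)
  · subst h4
    exact key _ (c.far' k (fun hk => h2 (by rw [hk])) _ ⟨hw, hq⟩)
  · rfl

lemma at_of_glued {q q' : S.Pt} {i j : Fin 3} (h : S.opp (q.1.1, i) = (q'.1.1, j))
    (h2 : ((S.hex q.1.1).aSide i).val q.1.2 = 0) (h3 : ((S.hex q'.1.1).aSide j).val q'.1.2 = 0)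
    (h4 : ((S.hex q.1.1).bSide (i + 1)).val q.1.2 = ((S.hex q'.1.1).bSide (j + 2)).val q'.1.2)
    (h5 : ((S.hex q.1.1).bSide (i + 2)).val q.1.2 = ((S.hex q'.1.1).bSide (j + 1)).val q'.1.2)
    (h1 : (q.1.1, i) = (c.v, c.i)) : c.At q q.1.2 ∧ c.At q' q.1.2 := by
  have h6 := h
  rw [h1, c.opp_eq] at h6
  obtain ⟨⟨v, w⟩, hw⟩ := q
  obtain ⟨⟨v', w'⟩, hw'⟩ := q'
  simp only [Prod.mk.injEq] at *
  obtain ⟨rfl, rfl⟩ := h1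
  obtain ⟨rfl, rfl⟩ := h6
  refine ⟨Or.inl ⟨rfl, rfl⟩, Or.inr ⟨rfl, ?_⟩⟩
  obtain ⟨g1, g2, g3⟩ := c.hg w'
  apply (S.hex c.v).eq_of_arc_coord c.i
  · rw [g1, h2, h3, neg_zero]
  · rw [g2, h4]
  · rw [g3, h5]

lemma bump_glued {y : ℍ} (hy : dist y c.z < c.δ) (q q' : S.Pt) (h : Glued q q') :
    c.bump y q = c.bump y q' := by
  obtain ⟨i, j, h1, h2, h3, h4, h5⟩ := h
  have h1' : S.opp (q'.1.1, j) = (q.1.1, i) := by rw [← h1, S.opp_opp]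
  by_cases e1 : (q.1.1, i) = (c.v, c.i)
  · obtain ⟨a, b⟩ := c.at_of_glued h1 h2 h3 h4 h5 e1
    rw [c.bump_at a, c.bump_at b]
  by_cases e2 : (q.1.1, i) = (c.v', c.j)
  · have e3 : (q'.1.1, j) = (c.v, c.i) := by rw [← h1, e2, c.opp_eq']
    obtain ⟨a, b⟩ := c.at_of_glued h1' h3 h2 h5.symm h4.symm e3
    rw [c.bump_at a, c.bump_at b]
  · rw [c.bump_of_ne hy h2 e1 e2, c.bump_of_ne hy h3]
    · intro e; apply e2; rw [← h1', e, c.opp_eq]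
    · intro e; apply e1; rw [← h1', e, c.opp_eq']

/-- The function `bump` centred at `u` is compatible with all gluings and 1-Lipschitz on each
hexagon, hence 1-Lipschitz for the chain distance. This is the lower bound that prevents shortcuts
through distant hexagons. -/
lemma min_le_dist {p q : S.Pt} {u u' : ℍ} (hp : c.At p u) (hu : dist u c.z < c.δ)
    (hq : c.At q u') : min (dist u u') c.δ ≤ dist p q := by
  have := sub_le_dist (c.bump_lipschitz u) (c.bump_glued hu) p q
  rw [c.bump_at hp, c.bump_at hq, dist_self, min_eq_left c.δ_pos.le, sub_zero, dist_comm] at this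
  exact this

lemma le_dist {p q : S.Pt} {u : ℍ} (hp : c.At p u) (hu : dist u c.z < c.δ)
    (hq : ¬∃ u', c.At q u') : c.δ ≤ dist p q := by
  have := sub_le_dist (c.bump_lipschitz u) (c.bump_glued hu) p q
  rwa [c.bump_at hp, c.bump_not_at hq, dist_self, min_eq_left c.δ_pos.le, sub_zero] at this

/-- A point of the line of the common arc and between the two sides perpendicular to it belongs to
both hexagons. -/
lemma exists_glued_at {y : ℍ} (h : ((S.hex c.v).aSide c.i).val y = 0)
    (h1 : 0 ≤ ((S.hex c.v).bSide (c.i + 1)).val y) (h2 : 0 ≤ ((S.hex c.v).bSide (c.i + 2)).val y) :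
    ∃ q q' : S.Pt, q.1 = (c.v, y) ∧ q'.1 = (c.v', c.g.symm y) ∧ Glued q q' := by
  have hy := ((S.hex c.v).mem_arc_iff).2 ⟨h, h1, h2⟩
  obtain ⟨g1, g2, g3⟩ := c.hg (c.g.symm y)
  rw [c.g.apply_symm_apply] at g1 g2 g3
  have hy' : c.g.symm y ∈ (S.hex c.v').arc c.j := by
    rw [RightAngledHexagon.mem_arc_iff]
    exact ⟨by linarith, by rw [← g3]; exact h2, by rw [← g2]; exact h1⟩
  exact ⟨⟨(c.v, y), hy.1⟩, ⟨(c.v', c.g.symm y), hy'.1⟩, rfl, rfl, c.i, c.j, c.opp_eq, hy.2, hy'.2,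
    g2, g3⟩

/-- The geodesic between the developed points crosses the line of the common arc, by the
intermediate value theorem. By convexity the crossing point lies between the two perpendicular
sides, hence on the arc itself, so the geodesic splits into a chain of two segments. -/
lemma dist_le_of_mem {p q : S.Pt} (hp : p.1.1 = c.v) (hq : q.1.1 = c.v') :
    dist p q ≤ dist p.1.2 (c.g q.1.2) := by
  obtain ⟨γ, γ0, γ1, hd, hγ⟩ := exists_geodesic p.1.2 (c.g q.1.2)
  have hcont : ContinuousOn γ (Set.Icc 0 1) := by
    have : LipschitzOnWith (nndist p.1.2 (c.g q.1.2)) γ (Set.Icc 0 1) := by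
      apply LipschitzOnWith.of_dist_le_mul
      intro s hs t ht
      rw [hd s hs t ht, mul_comm, Real.dist_eq, coe_nndist]
    exact this.continuousOn
  have hpr := p.2
  have hqr := q.2
  simp only [hp] at hpr
  simp only [hq] at hqr
  obtain ⟨g1, g2, g3⟩ := c.hg q.1.2
  have hz0 : 0 ∈ (((S.hex c.v).aSide c.i).val ∘ γ) '' Set.Icc 0 1 := by
    have := intermediate_value_Icc' (zero_le_one' ℝ)
      ((((S.hex c.v).aSide c.i).continuous_val.comp_continuousOn hcont))
    apply this
    simp only [Function.comp, γ0, γ1, g1]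
    exact ⟨by linarith [show 0 ≤ ((S.hex c.v').aSide c.j).val q.1.2 from (hqr c.j).2], (hpr c.i).2⟩
  obtain ⟨t, ht, ht0⟩ := hz0
  obtain ⟨a, b, ha, hb, hab⟩ := hγ t ht
  have key : ∀ u : HalfPlane, u.val (γ t) = a * u.val p.1.2 + b * u.val (c.g q.1.2) := by
    intro u
    rw [HalfPlane.val_eq, hab, mink_add_right, mink_smul_right, mink_smul_right,
      ← HalfPlane.val_eq, ← HalfPlane.val_eq]
  have k1 : 0 ≤ ((S.hex c.v).bSide (c.i + 1)).val (γ t) := by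
    rw [key, g2]
    exact add_nonneg (mul_nonneg ha (hpr _).1) (mul_nonneg hb (hqr _).1)
  have k2 : 0 ≤ ((S.hex c.v).bSide (c.i + 2)).val (γ t) := by
    rw [key, g3]
    exact add_nonneg (mul_nonneg ha (hpr _).1) (mul_nonneg hb (hqr _).1)
  obtain ⟨a, b, ha, hb, hab⟩ := c.exists_glued_at ht0 k1 k2
  have d1 : dist p a ≤ dist p.1.2 (γ t) := by
    have := dist_le_of_eq (p := p) (q := a) (by rw [ha, hp])
    rwa [ha] at this
  have d2 : dist b q ≤ dist (γ t) (c.g q.1.2) := by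
    have := dist_le_of_eq (p := b) (q := q) (by rw [hb, hq])
    rw [hb, ← c.g.dist_eq] at this
    simpa using this
  have d3 := dist_eq_zero_of_glued hab
  have d4 : dist p.1.2 (c.g q.1.2) = dist p.1.2 (γ t) + dist (γ t) (c.g q.1.2) := by
    have e1 := hd 0 (by simp) t ht
    have e2 := hd t ht 1 (by simp)
    rw [γ0] at e1
    rw [γ1] at e2
    rw [e1, e2, zero_sub, abs_neg, abs_of_nonneg ht.1, abs_of_nonpos (by linarith [ht.2])]
    ring
  linarith [dist_triangle p a q, dist_triangle a b q]

lemma dist_le {p q : S.Pt} {u u' : ℍ} (hp : c.At p u) (hq : c.At q u') :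
    dist p q ≤ dist u u' := by
  rcases hp with ⟨hp, rfl⟩ | ⟨hp, rfl⟩ <;> rcases hq with ⟨hq, rfl⟩ | ⟨hq, rfl⟩
  · exact dist_le_of_eq (by rw [hp, hq])
  · exact c.dist_le_of_mem hp hq
  · rw [dist_comm, dist_comm _ q.1.2]; exact c.dist_le_of_mem hq hp
  · rw [c.g.dist_eq]; exact dist_le_of_eq (by rw [hp, hq])

lemma dist_eq {p q : S.Pt} {u u' : ℍ} (hp : c.At p u) (hq : c.At q u')
    (hu : dist u c.z < c.δ / 2) (hu' : dist u' c.z < c.δ / 2) : dist p q = dist u u' := by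
  apply le_antisymm (c.dist_le hp hq)
  have h1 := c.min_le_dist hp (by linarith [c.δ_pos]) hq
  have h2 : dist u u' < c.δ := by linarith [dist_triangle_right u u' c.z]
  rwa [min_eq_left h2.le] at h1

/-- The base point of the chart. -/
def base : S.Pt := pt c.v c.z c.z_mem

lemma at_base : c.At c.base c.z := Or.inl ⟨rfl, rfl⟩

lemma exists_at {q : S.Pt} (h : dist c.base q < c.δ) : ∃ u, c.At q u ∧ dist u c.z = dist c.base q := by
  have h0 : dist c.z c.z < c.δ := by rw [dist_self]; exact c.δ_pos
  by_cases hq : ∃ u', c.At q u'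
  · obtain ⟨u, hu⟩ := hq
    refine ⟨u, hu, ?_⟩
    have h1 := c.min_le_dist c.at_base h0 hu
    have h2 := c.dist_le c.at_base hu
    rw [dist_comm]
    apply le_antisymm _ h2
    rcases min_le_iff.1 h1 with h3 | h3
    · exact h3
    · linarith
  · linarith [c.le_dist c.at_base h0 hq]

end EdgeChart

end HexGluing


/-! ### Local structure of the glued space -/

namespace HexGluing

variable {S : HexGluing}

/-- The chart at `z` across the arc `i` should miss the other arcs and the side `bᵢ`. At most one
arc passes through `z`, and then `bᵢ` does not; off the arcs, at most one side `bᵢ` has to be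
avoided. -/
lemma exists_index (v : S.V) {z : ℍ} (hz : z ∈ (S.hex v).region) :
    ∃ i, (∀ k ≠ i, 0 < ((S.hex v).aSide k).val z) ∧ 0 < ((S.hex v).bSide i).val z := by
  set P := S.hex v
  by_cases h : ∃ i, (P.aSide i).val z = 0
  · obtain ⟨i, hi⟩ := h
    exact ⟨i, fun k hk => P.aSide_pos hz hk hi, P.bSide_pos_of_aSide hz hi⟩
  · push Not at h
    have ha : ∀ k, 0 < (P.aSide k).val z := fun k => lt_of_le_of_ne (hz k).2 (h k).symm
    by_cases hb : (P.bSide 0).val z = 0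
    · exact ⟨1, fun k _ => ha k, P.bSide_pos hz (by decide) hb⟩
    · exact ⟨0, fun k _ => ha k, lt_of_le_of_ne (hz 0).1 (Ne.symm hb)⟩

/-- A chart at a given point which is adapted to the local structure. -/
lemma exists_chart_at (p : S.Pt) :
    ∃ c : EdgeChart S, c.base = p ∧ (∀ k ≠ c.i, 0 < ((S.hex c.v).aSide k).val c.z) ∧
      0 < ((S.hex c.v).bSide c.i).val c.z := by
  obtain ⟨⟨v, z⟩, hz⟩ := p
  obtain ⟨i, h1, h2⟩ := exists_index v hz
  obtain ⟨c, rfl, rfl, rfl⟩ := exists_edgeChart v i z hz fun k hk h => (h1 k hk).ne' h.2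
  exact ⟨c, rfl, h1, h2⟩

/-- In a chart based at `p`, a point at distance zero is developed to the same point of `ℍ`. In the
second hexagon this puts it on the common arc, because the two arc values are nonnegative and
opposite. No transitive closure of the gluing is needed. -/
lemma dist_eq_zero_iff {p q : S.Pt} : dist p q = 0 ↔ p = q ∨ Glued p q := by
  constructor
  · intro h
    obtain ⟨c, rfl, -, -⟩ := exists_chart_at p
    obtain ⟨u, hu, hu0⟩ := c.exists_at (q := q) (by rw [h]; exact c.δ_pos)
    have hu1 : u = c.z := by
      apply dist_eq_zero.1
      rw [hu0]; exact h
    subst hu1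
    obtain ⟨⟨w, y⟩, hy⟩ := q
    rcases hu with ⟨h1, h2⟩ | ⟨h1, h2⟩
    · left
      simp only at h1 h2
      subst h1
      subst h2
      rfl
    · right
      simp only at h1 h2 hy
      subst h1
      obtain ⟨g1, g2, g3⟩ := c.hg y
      rw [← h2] at g1 g2 g3
      have k1 : 0 ≤ ((S.hex c.v).aSide c.i).val c.z := (c.z_mem c.i).2
      have k2 : 0 ≤ ((S.hex c.v').aSide c.j).val y := (hy c.j).2
      exact ⟨c.i, c.j, c.opp_eq, by show ((S.hex c.v).aSide c.i).val c.z = 0; linarith,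
        by show ((S.hex c.v').aSide c.j).val y = 0; linarith, g2, g3⟩
  · rintro (rfl | h)
    · exact dist_self _
    · exact dist_eq_zero_of_glued h

namespace EdgeChart

variable (c : EdgeChart S)

/-- Near the base point, the image of the chart is bounded by the two sides that are perpendicular
to the common arc. -/
lemma eventually_exists_at (ha : ∀ k ≠ c.i, 0 < ((S.hex c.v).aSide k).val c.z)
    (hb : 0 < ((S.hex c.v).bSide c.i).val c.z) :
    ∀ᶠ y in 𝓝 c.z, 0 ≤ ((S.hex c.v).bSide (c.i + 1)).val y →
      0 ≤ ((S.hex c.v).bSide (c.i + 2)).val y → ∃ q, c.At q y := by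
  have pos : ∀ (u : HalfPlane) (z : ℍ), 0 < u.val z → ∀ᶠ y in 𝓝 z, 0 < u.val y := fun u z h =>
    (u.continuous_val.tendsto z).eventually (lt_mem_nhds h)
  have e1 : ∀ᶠ y in 𝓝 c.z, ∀ k, k ≠ c.i → 0 < ((S.hex c.v).aSide k).val y := by
    rw [eventually_all]
    intro k
    by_cases hk : k = c.i
    · simp [hk]
    · filter_upwards [pos _ _ (ha k hk)] with y hy _ using hy
  have e2 := pos _ _ hb
  have hz0 : 0 ≤ ((S.hex c.v).aSide c.i).val c.z := (c.z_mem c.i).2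
  have e3 : ∀ᶠ y in 𝓝 c.z, 0 < ((S.hex c.v).aSide c.i).val y ∨
      ((∀ k, k ≠ c.j → 0 < ((S.hex c.v').aSide k).val (c.g.symm y)) ∧
        0 < ((S.hex c.v').bSide c.j).val (c.g.symm y)) := by
    rcases hz0.eq_or_lt with h | h
    · have hs : Tendsto c.g.symm (𝓝 c.z) (𝓝 (c.g.symm c.z)) := c.g.symm.continuous.tendsto _
      obtain ⟨g1, g2, g3⟩ := c.hg (c.g.symm c.z)
      rw [c.g.apply_symm_apply] at g1 g2 g3
      have hm : c.g.symm c.z ∈ (S.hex c.v').arc c.j := by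
        rw [RightAngledHexagon.mem_arc_iff]
        exact ⟨by linarith, by rw [← g3]; exact (c.z_mem _).1, by rw [← g2]; exact (c.z_mem _).1⟩
      have f1 : ∀ᶠ y in 𝓝 c.z, ∀ k, k ≠ c.j → 0 < ((S.hex c.v').aSide k).val (c.g.symm y) := by
        rw [eventually_all]
        intro k
        by_cases hk : k = c.j
        · simp [hk]
        · filter_upwards [hs.eventually (pos _ _ ((S.hex c.v').aSide_pos hm.1 hk hm.2))]
            with y hy _ using hy
      have f2 := hs.eventually (pos _ _ ((S.hex c.v').bSide_pos_of_aSide hm.1 hm.2))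
      filter_upwards [f1, f2] with y h1 h2 using Or.inr ⟨h1, h2⟩
    · filter_upwards [pos _ _ h] with y hy using Or.inl hy
  filter_upwards [e1, e2, e3] with y h1 h2 h3 k1 k2
  have in_v : 0 ≤ ((S.hex c.v).aSide c.i).val y → ∃ q, c.At q y := by
    intro h
    refine ⟨⟨(c.v, y), fun k => ?_⟩, Or.inl ⟨rfl, rfl⟩⟩
    rcases Fin3.cases c.i k with hk | hk | hk
    · subst hk; exact ⟨h2.le, h⟩
    · subst hk; exact ⟨k1, (h1 _ (Fin3.ne c.i).2.2.1).le⟩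
    · subst hk; exact ⟨k2, (h1 _ (Fin3.ne c.i).2.2.2.1).le⟩
  rcases le_total 0 (((S.hex c.v).aSide c.i).val y) with h | h
  · exact in_v h
  · rcases h3 with h3 | ⟨h3, h4⟩
    · exact in_v h3.le
    obtain ⟨g1, g2, g3⟩ := c.hg (c.g.symm y)
    rw [c.g.apply_symm_apply] at g1 g2 g3
    refine ⟨⟨(c.v', c.g.symm y), fun k => ?_⟩, Or.inr ⟨rfl, (c.g.apply_symm_apply y).symm⟩⟩
    rcases Fin3.cases c.j k with hk | hk | hk
    · subst hk; exact ⟨h4.le, by show 0 ≤ ((S.hex c.v').aSide c.j).val (c.g.symm y); linarith⟩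
    · subst hk
      exact ⟨by show 0 ≤ ((S.hex c.v').bSide (c.j + 1)).val (c.g.symm y); rw [← g3]; exact k2,
        (h3 _ (Fin3.ne c.j).2.2.1).le⟩
    · subst hk
      exact ⟨by show 0 ≤ ((S.hex c.v').bSide (c.j + 2)).val (c.g.symm y); rw [← g2]; exact k1,
        (h3 _ (Fin3.ne c.j).2.2.2.1).le⟩

lemma nonneg_of_at {q : S.Pt} {y : ℍ} (h : c.At q y) :
    0 ≤ ((S.hex c.v).bSide (c.i + 1)).val y ∧ 0 ≤ ((S.hex c.v).bSide (c.i + 2)).val y := by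
  have hq := q.2
  rcases h with ⟨h, rfl⟩ | ⟨h, rfl⟩
  · rw [h] at hq
    exact ⟨(hq _).1, (hq _).1⟩
  · rw [h] at hq
    obtain ⟨g1, g2, g3⟩ := c.hg q.1.2
    rw [g2, g3]
    exact ⟨(hq _).1, (hq _).1⟩

/-- Near the base point, the image of the chart is a half-plane. -/
lemma exists_halfPlane_at (ha : ∀ k ≠ c.i, 0 < ((S.hex c.v).aSide k).val c.z)
    (hb : 0 < ((S.hex c.v).bSide c.i).val c.z) :
    ∃ u : HalfPlane, ∀ᶠ y in 𝓝 c.z, y ∈ u.carrier ↔ ∃ q, c.At q y := by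
  have pos : ∀ (u : HalfPlane) (z : ℍ), 0 < u.val z → ∀ᶠ y in 𝓝 z, 0 < u.val y := fun u z h =>
    (u.continuous_val.tendsto z).eventually (lt_mem_nhds h)
  have h := c.eventually_exists_at ha hb
  have k1 : 0 ≤ ((S.hex c.v).bSide (c.i + 1)).val c.z := (c.z_mem _).1
  rcases k1.eq_or_lt with h1 | h1
  · have h2 := (S.hex c.v).bSide_pos c.z_mem (i := c.i + 1) (j := c.i + 2)
      (Fin3.ne c.i).2.2.2.2.2 h1.symm
    refine ⟨(S.hex c.v).bSide (c.i + 1), ?_⟩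
    filter_upwards [h, pos _ _ h2] with y hy hy2
    exact ⟨fun hu => hy hu hy2.le, fun ⟨q, hq⟩ => (c.nonneg_of_at hq).1⟩
  · refine ⟨(S.hex c.v).bSide (c.i + 2), ?_⟩
    filter_upwards [h, pos _ _ h1] with y hy hy2
    exact ⟨fun hu => hy hy2.le hu, fun ⟨q, hq⟩ => (c.nonneg_of_at hq).2⟩

end EdgeChart

/-! #### The surface -/

variable (S) in
/-- The surface obtained by gluing. -/
abbrev Surface : Type := SeparationQuotient S.Pt

/-- The projection of the disjoint union of the hexagons to the surface. -/
def proj (q : S.Pt) : S.Surface := SeparationQuotient.mk q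

@[simp] lemma dist_proj (p q : S.Pt) : dist (proj p) (proj q) = dist p q :=
  SeparationQuotient.dist_mk p q

lemma proj_surjective (x : S.Surface) : ∃ q, proj q = x := SeparationQuotient.surjective_mk x

lemma proj_eq_iff {p q : S.Pt} : proj p = proj q ↔ p = q ∨ Glued p q := by
  rw [← dist_eq_zero, dist_proj, dist_eq_zero_iff]

/-- The chart map is the development of the two hexagons. A glued point has two representatives, but
`EdgeChart.dist_eq` shows that they develop to the same point, so any choice of representatives
gives the same map near the base point. -/
lemma local_model (x : S.Surface) : ∃ r > 0, ∃ (u : HalfPlane) (φ : S.Surface → ℍ),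
    (∀ y ∈ Metric.ball x r, ∀ z ∈ Metric.ball x r, dist (φ y) (φ z) = dist y z) ∧
      φ '' Metric.ball x r = Metric.ball (φ x) r ∩ u.carrier := by
  obtain ⟨p, rfl⟩ := proj_surjective x
  obtain ⟨c, rfl, ha, hb⟩ := exists_chart_at p
  obtain ⟨u, hu⟩ := c.exists_halfPlane_at ha hb
  obtain ⟨ε, hε, hball⟩ := Metric.eventually_nhds_iff.1 hu
  set r := min ε (c.δ / 2) with hr
  have hr0 : 0 < r := lt_min hε (half_pos c.δ_pos)
  have hrε : r ≤ ε := min_le_left _ _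
  have hrδ : r ≤ c.δ / 2 := min_le_right _ _
  have hex : ∀ y ∈ Metric.ball (proj c.base) r, ∃ w, ∃ q, proj q = y ∧ c.At q w ∧
      dist w c.z = dist y (proj c.base) := by
    intro y hy
    obtain ⟨q, rfl⟩ := proj_surjective y
    rw [Metric.mem_ball, dist_comm, dist_proj] at hy
    obtain ⟨w, hw, hw'⟩ := c.exists_at (q := q) (by linarith [c.δ_pos])
    exact ⟨w, q, rfl, hw, by rw [hw', dist_comm, dist_proj]⟩
  choose! φ hφ using hex
  have hφd : ∀ q w, c.At q w → dist w c.z < r → φ (proj q) = w := by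
    intro q w hq hw
    have hq1 : dist (proj q) (proj c.base) < r := by
      rw [dist_proj]; exact (c.dist_le hq c.at_base).trans_lt hw
    obtain ⟨q', h1, h2, h3⟩ := hφ (proj q) hq1
    have h4 := c.dist_eq hq h2 (by linarith) (by rw [h3]; linarith)
    rw [← dist_proj, h1, dist_self] at h4
    exact (dist_eq_zero.1 h4.symm).symm
  have hφ0 : φ (proj c.base) = c.z := hφd _ _ c.at_base (by rwa [dist_self])
  refine ⟨r, hr0, u, φ, ?_, ?_⟩
  · intro y hy z hz
    obtain ⟨q, h1, h2, h3⟩ := hφ y hy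
    obtain ⟨q', h1', h2', h3'⟩ := hφ z hz
    have hy' := Metric.mem_ball.1 hy
    have hz' := Metric.mem_ball.1 hz
    rw [← c.dist_eq h2 h2' (by linarith) (by linarith), ← dist_proj, h1, h1']
  · show φ '' Metric.ball (proj c.base) r = Metric.ball (φ (proj c.base)) r ∩ u.carrier
    rw [hφ0]
    ext w
    constructor
    · rintro ⟨y, hy, rfl⟩
      obtain ⟨q, h1, h2, h3⟩ := hφ y hy
      have hy' := Metric.mem_ball.1 hy
      refine ⟨Metric.mem_ball.2 (by linarith), (hball ?_).2 ⟨q, h2⟩⟩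
      linarith
    · rintro ⟨h1, h2⟩
      rw [Metric.mem_ball] at h1
      obtain ⟨q, hq⟩ := (hball (by linarith)).1 h2
      refine ⟨proj q, ?_, hφd q w hq h1⟩
      rw [Metric.mem_ball, dist_proj]
      exact (c.dist_le hq c.at_base).trans_lt h1

/-- The inclusion of a hexagon in the surface (extended by an arbitrary value). -/
def tile (v : S.V) (z : ℍ) : S.Surface :=
  open Classical in
  if h : z ∈ (S.hex v).region then proj (pt v z h)
  else proj (pt v _ (S.nonempty v).choose_spec)

lemma tile_of_mem {v : S.V} {z : ℍ} (h : z ∈ (S.hex v).region) : tile v z = proj (pt v z h) :=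
  dif_pos h

lemma dist_tile_le {v : S.V} {z w : ℍ} (hz : z ∈ (S.hex v).region) (hw : w ∈ (S.hex v).region) :
    dist (tile v z) (tile v w) ≤ dist z w := by
  rw [tile_of_mem hz, tile_of_mem hw, dist_proj]
  exact dist_le_of_eq rfl

lemma tile_isometry (v : S.V) (x : ℍ) (hx : x ∈ (S.hex v).region) : ∃ r > 0,
    ∀ y ∈ (S.hex v).region ∩ Metric.ball x r, ∀ z ∈ (S.hex v).region ∩ Metric.ball x r,
      dist (tile v y) (tile v z) = dist y z := by
  obtain ⟨c, hc, -, -⟩ := exists_chart_at (pt v x hx)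
  obtain ⟨rfl, rfl⟩ : c.v = v ∧ c.z = x :=
    ⟨congrArg (fun q : S.Pt => q.1.1) hc, congrArg (fun q : S.Pt => q.1.2) hc⟩
  refine ⟨c.δ / 2, half_pos c.δ_pos, ?_⟩
  rintro y ⟨hy, hy'⟩ z ⟨hz, hz'⟩
  rw [tile_of_mem hy, tile_of_mem hz, dist_proj]
  exact c.dist_eq (Or.inl ⟨rfl, rfl⟩) (Or.inl ⟨rfl, rfl⟩) hy' hz'

lemma tile_cover (x : S.Surface) : ∃ v, ∃ z ∈ (S.hex v).region, tile v z = x := by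
  obtain ⟨⟨⟨v, z⟩, hz⟩, rfl⟩ := proj_surjective x
  exact ⟨v, z, hz, tile_of_mem hz⟩

lemma joinedByLength_of_chain {p q : S.Pt} {r : ℝ} (h : Chain p q r) :
    JoinedByLength (proj p) (proj q) r := by
  induction h with
  | refl => exact .refl _
  | glue a b s hab _ ih =>
    rwa [proj_eq_iff.2 (Or.inr hab)] at ih
  | move a b s hab h ih =>
    refine ih.trans (S.isLengthRel.nonneg _ _ _ h) dist_nonneg ?_
    obtain ⟨⟨v, z⟩, hz⟩ := a
    obtain ⟨⟨v', w⟩, hw⟩ := b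
    simp only at hab
    subst hab
    obtain ⟨γ, γ0, γ1, hd, hγ⟩ := exists_geodesic z w
    have hm : ∀ t : unitInterval, γ t ∈ (S.hex v).region := by
      intro t
      obtain ⟨a, b, ha, hb, hab⟩ := hγ t t.2
      exact (S.hex v).mem_region_of_combination hz hw ha hb hab
    have := JoinedByLength.of_lipschitz (f := fun t : unitInterval => tile v (γ t))
      (dist_nonneg (x := z) (y := w)) (fun s t => by
        refine (dist_tile_le (hm s) (hm t)).trans ?_
        rw [hd s s.2 t t.2, mul_comm, Subtype.dist_eq, Real.dist_eq])
    simp only [Set.Icc.coe_zero, Set.Icc.coe_one, γ0, γ1] at this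
    rw [tile_of_mem hz, tile_of_mem hw] at this
    exact this

variable (S) in
lemma isHyperbolicSurface : IsHyperbolicSurface S.Surface where
  compact := by
    have hc : ∀ v : S.V, IsCompact (tile v '' (S.hex v).region) := by
      intro v
      apply (S.hex v).isCompact_region.image_of_continuousOn
      have : LipschitzOnWith 1 (tile v) (S.hex v).region := by
        apply LipschitzOnWith.of_dist_le_mul
        intro z hz w hw
        simpa using dist_tile_le hz hw
      exact this.continuousOn
    have hu : (⋃ v : S.V, tile v '' (S.hex v).region) = Set.univ := by
      rw [Set.eq_univ_iff_forall]
      intro x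
      obtain ⟨v, z, hz, rfl⟩ := tile_cover x
      exact Set.mem_iUnion.2 ⟨v, z, hz, rfl⟩
    exact ⟨by rw [← hu]; exact isCompact_iUnion hc⟩
  connected := by
    have v : S.V := Classical.arbitrary _
    have : PathConnectedSpace S.Surface := by
      refine ⟨⟨tile v (S.nonempty v).choose⟩, ?_⟩
      intro x y
      obtain ⟨p, rfl⟩ := proj_surjective x
      obtain ⟨q, rfl⟩ := proj_surjective y
      obtain ⟨r, hr⟩ := S.isLengthRel.conn p q
      exact ⟨(joinedByLength_of_chain hr).choose⟩
    infer_instance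
  length_metric x y ε hε := by
    obtain ⟨p, rfl⟩ := proj_surjective x
    obtain ⟨q, rfl⟩ := proj_surjective y
    obtain ⟨r, hr, hc⟩ := S.isLengthRel.exists_lt (x := p) (y := q)
      (c := dist (proj p) (proj q) + ε) (by rw [dist_proj]; exact lt_add_of_pos_right _ hε)
    exact (joinedByLength_of_chain hc).mono hr.le
  local_model := local_model

end HexGluing


/-! ### Surfaces with prescribed coordinates, and rays -/

namespace FatGraph

variable (G : FatGraph)

/-- The fixed point free involution of the half-edges given by the gluing. -/
def opp : G.Vertex × Fin 3 → G.Vertex × Fin 3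
  | (Sum.inl n, i) => (Sum.inr (G.glue (n, i)).1, (G.glue (n, i)).2)
  | (Sum.inr m, j) => (Sum.inl (G.glue.symm (m, j)).1, (G.glue.symm (m, j)).2)

lemma opp_inl (n : G.W) (i : Fin 3) :
    G.opp (Sum.inl n, i) = (Sum.inr (G.glue (n, i)).1, (G.glue (n, i)).2) := rfl

lemma opp_inr (m : G.B) (j : Fin 3) :
    G.opp (Sum.inr m, j) = (Sum.inl (G.glue.symm (m, j)).1, (G.glue.symm (m, j)).2) := rfl

lemma opp_opp (h : G.Vertex × Fin 3) : G.opp (G.opp h) = h := by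
  obtain ⟨n | m, i⟩ := h <;> simp [opp_inl, opp_inr]

lemma opp_ne (h : G.Vertex × Fin 3) : (G.opp h).1 ≠ h.1 := by
  obtain ⟨n | m, i⟩ := h <;> simp [opp_inl, opp_inr]

lemma nonempty_vertex : Nonempty G.Vertex := G.connected.nonempty

lemma nonempty_edge : Nonempty G.Edge := by
  obtain ⟨n | m⟩ := G.nonempty_vertex
  · exact ⟨(n, 0)⟩
  · exact ⟨G.glue.symm (m, 0)⟩

lemma reflTransGen_opp (v v' : G.Vertex) :
    Relation.ReflTransGen (fun v v' => ∃ i, (G.opp (v, i)).1 = v') v v' := by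
  have h := G.connected.preconnected v v'
  rw [SimpleGraph.reachable_iff_reflTransGen] at h
  refine Relation.ReflTransGen.mono ?_ _ _ h
  rintro a b hab
  rw [SimpleGraph.fromRel_adj] at hab
  obtain ⟨-, ⟨⟨n, i⟩, rfl, rfl⟩ | ⟨⟨n, i⟩, rfl, rfl⟩⟩ := hab
  · exact ⟨i, rfl⟩
  · refine ⟨(G.glue (n, i)).2, ?_⟩
    simp [opp_inr]

variable {G}

open RightAngledHexagon in
/-- A surface with prescribed positive orthogeodesic coordinates. -/
lemma exists_teich {b : G.W × Fin 3 → ℝ} (hb : ∀ k, 0 < b k) : ∃ m : G.Teich, m.coord = b := by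
  choose P hP hPb using fun n : G.W => exists_of_bLength (fun i => b (n, i)) fun i => hb (n, i)
  -- Here the lengths of the arcs are prescribed, so the hexagon is built with them as `b`-lengths
  -- and then its two triples of sides are exchanged.
  choose Q hQ hQb using fun m : G.B => exists_of_bLength
    (fun j => (P (G.glue.symm (m, j)).1).aLength (G.glue.symm (m, j)).2)
    fun j => aLength_pos _ _
  let hex : G.Vertex → RightAngledHexagon := Sum.elim P fun m => (Q m).swap
  have hQa : ∀ m j, (Q m).swap.aLength j =
    (P (G.glue.symm (m, j)).1).aLength (G.glue.symm (m, j)).2 := fun m j => hQb m j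
  have hlen : ∀ h, (hex (G.opp h).1).aLength (G.opp h).2 = (hex h.1).aLength h.2 := by
    rintro ⟨n | m, i⟩
    · rw [opp_inl]
      show (Q _).swap.aLength _ = (P n).aLength i
      rw [hQa]; simp
    · rw [opp_inr]
      exact (hQa m i).symm
  have hne : ∀ v, (hex v).region.Nonempty := by
    rintro (n | m)
    · exact hP n
    · show (Q m).swap.region.Nonempty
      rw [swap_region]; exact hQ m
  have := G.nonempty_vertex
  let S : HexGluing :=
    { V := G.Vertex
      hex := hex
      opp := G.opp
      opp_opp := G.opp_opp
      opp_ne := G.opp_ne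
      nonempty := hne
      aLength_opp := hlen
      connected := G.reflTransGen_opp }
  have heq : ∀ (v v' : G.Vertex) (z z' : ℍ) (hz : z ∈ (hex v).region) (hz' : z' ∈ (hex v').region),
      HexGluing.tile (S := S) v z = HexGluing.tile (S := S) v' z' ↔
        (v = v' ∧ z = z') ∨
          HexGluing.Glued (S := S) (HexGluing.pt v z hz) (HexGluing.pt v' z' hz') := by
    intro v v' z z' hz hz'
    rw [HexGluing.tile_of_mem (S := S) hz, HexGluing.tile_of_mem (S := S) hz',
      HexGluing.proj_eq_iff]
    refine or_congr ⟨fun h => ?_, ?_⟩ Iff.rfl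
    · exact ⟨congrArg (fun q : S.Pt => q.1.1) h, congrArg (fun q : S.Pt => q.1.2) h⟩
    · rintro ⟨rfl, rfl⟩; rfl
  refine ⟨{ Carrier := S.Surface
            hyperbolic := S.isHyperbolicSurface
            hex := hex
            tile := HexGluing.tile (S := S)
            tile_isometry := HexGluing.tile_isometry (S := S)
            cover := HexGluing.tile_cover (S := S)
            arc_length := fun e => (hlen (Sum.inl e.1, e.2)).symm
            tile_white := ?_
            tile_black := ?_
            tile_glue := ?_ }, ?_⟩
  · intro n n' z hz z' hz'
    rw [heq _ _ _ _ hz hz']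
    constructor
    · rintro (h | ⟨i, j, h, -⟩)
      · exact ⟨Sum.inl_injective h.1, h.2⟩
      · exact absurd (congrArg Prod.fst h) (by rintro ⟨⟩)
    · rintro ⟨rfl, rfl⟩; exact Or.inl ⟨rfl, rfl⟩
  · intro n n' z hz z' hz'
    rw [heq _ _ _ _ hz hz']
    constructor
    · rintro (h | ⟨i, j, h, -⟩)
      · exact ⟨Sum.inr_injective h.1, h.2⟩
      · exact absurd (congrArg Prod.fst h) (by rintro ⟨⟩)
    · rintro ⟨rfl, rfl⟩; exact Or.inl ⟨rfl, rfl⟩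
  · intro n m z hz z' hz'
    rw [heq _ _ _ _ hz hz']
    have hn := hne (Sum.inl n)
    have hm := hne (Sum.inr m)
    constructor
    · rintro (h | ⟨i, j, h, h2, h3, h4, h5⟩)
      · exact absurd h.1 (by rintro ⟨⟩)
      · have ha : z ∈ (hex (Sum.inl n)).arc i := ⟨hz, h2⟩
        have ha' : z' ∈ (hex (Sum.inr m)).arc j := ⟨hz', h3⟩
        refine ⟨i, j, ?_, ha, ha', ?_⟩
        · have h' : G.opp (Sum.inl n, i) = (Sum.inr m, j) := h
          rw [opp_inl, Prod.mk.injEq] at h'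
          exact Prod.ext (Sum.inr_injective h'.1) h'.2
        · apply Real.sinh_injective
          rw [sinh_dist_corner _ hn ha, sinh_dist_corner' _ hm ha']
          exact h4
    · rintro ⟨i, j, h, ha, ha', hd⟩
      right
      have h0 : G.opp (Sum.inl n, i) = (Sum.inr m, j) := by rw [opp_inl, h]
      have hC := hlen (Sum.inl n, i)
      rw [h0] at hC
      simp only at hC
      have h4 := congrArg Real.sinh hd
      rw [sinh_dist_corner _ hn ha, sinh_dist_corner' _ hm ha'] at h4
      refine ⟨i, j, h0, ha.2, ha'.2, h4, ?_⟩
      show ((hex (Sum.inl n)).bSide (i + 2)).val z = ((hex (Sum.inr m)).bSide (j + 1)).val z'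
      have n1 := (hex (Sum.inl n)).arc_norm i z
      have n2 := (hex (Sum.inr m)).arc_norm j z'
      rw [ha.2, h4] at n1
      rw [ha'.2, hC] at n2
      have p1 : 0 ≤ ((hex (Sum.inl n)).bSide (i + 2)).val z := (hz _).1
      have p2 : 0 ≤ ((hex (Sum.inr m)).bSide (j + 1)).val z' := (hz' _).1
      have p3 : 0 ≤ ((hex (Sum.inr m)).bSide (j + 2)).val z' := (hz' _).1
      have hc := (hex (Sum.inl n)).one_lt_cosh_aLength i
      set C := Real.cosh ((hex (Sum.inl n)).aLength i)
      set p := ((hex (Sum.inl n)).bSide (i + 2)).val z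
      set q := ((hex (Sum.inr m)).bSide (j + 1)).val z'
      set t := ((hex (Sum.inr m)).bSide (j + 2)).val z'
      -- On an arc the norm relation and one side value determine the other: a quadratic equation
      -- with at most one nonnegative solution.
      have h6 : (p - q) * (p + q + 2 * C * t) = 0 := by linear_combination n1 - n2
      have h7 : 0 ≤ 2 * C * t := by positivity
      rcases mul_eq_zero.1 h6 with h8 | h8
      · linarith
      · linarith
  · funext k
    exact hPb k.1 k.2

/-- The sum of two of the three strict triangle inequalities. -/
lemma cone_pos {b : G.W × Fin 3 → ℝ} (hb : b ∈ G.cone) (k : G.W × Fin 3) : 0 < b k := by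
  obtain ⟨n, i⟩ := k
  have h1 := hb n (i + 1)
  have h2 := hb n (i + 2)
  obtain ⟨e1, e2, e3, e4⟩ := Fin3.add i
  rw [e1, e2] at h1
  rw [e3, e4] at h2
  linarith

lemma exists_ray {b : G.W × Fin 3 → ℝ} (hb : b ∈ G.cone) : ∃ m : ℝ → G.Teich, IsRay b m := by
  have : ∀ t : ℝ, ∃ m : G.Teich, 0 < t → m.coord = t • b := by
    intro t
    by_cases ht : 0 < t
    · obtain ⟨m, hm⟩ := exists_teich (b := t • b) fun k => mul_pos ht (cone_pos hb k)
      exact ⟨m, fun _ => hm⟩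
    -- For `t ≤ 0` a ray is unconstrained, and any surface serves.
    · obtain ⟨m, -⟩ := exists_teich (b := b) (cone_pos hb)
      exact ⟨m, fun h => absurd h ht⟩
  choose m hm using this
  exact ⟨m, hm⟩

end FatGraph


namespace FatGraph

variable {G : FatGraph}

/-! ### Growth of the number of closed geodesics -/

/-- Two consecutive oriented edges of a geodesic. -/
def Next (o o' : G.OrientedEdge) : Prop := tail o' = head o ∧ o' ≠ reverse o

/-- The rotation of an oriented edge around its final vertex. -/
def turn (k : Fin 3) (o : G.OrientedEdge) : G.OrientedEdge :=
  if o.2 then (G.glue.symm ((G.glue o.1).1, (G.glue o.1).2 + k), false)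
  else ((o.1.1, o.1.2 + k), true)

lemma turn_true (k : Fin 3) (e : G.Edge) :
    turn k (e, true) = (G.glue.symm ((G.glue e).1, (G.glue e).2 + k), false) := rfl

lemma turn_false (k : Fin 3) (e : G.Edge) :
    turn k ((e, false) : G.OrientedEdge) = ((e.1, e.2 + k), true) := rfl

lemma next_turn {k : Fin 3} (hk : k ≠ 0) (o : G.OrientedEdge) : Next o (turn k o) := by
  obtain ⟨e, _ | _⟩ := o
  · refine ⟨by simp [turn_false, tail, head, reverse], ?_⟩
    intro h
    have h1 := congrArg (fun o : G.OrientedEdge => o.1.2) h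
    exact hk (by simpa [turn_false, reverse] using h1)
  · refine ⟨by simp [turn_true, tail, head, reverse], ?_⟩
    intro h
    have h1 := congrArg (fun o : G.OrientedEdge => (G.glue o.1).2) h
    exact hk (by simpa [turn_true, reverse] using h1)

lemma turn_ne (o : G.OrientedEdge) : turn 1 o ≠ turn 2 o := by
  obtain ⟨e, _ | _⟩ := o
  · intro h
    have h1 := congrArg (fun o : G.OrientedEdge => o.1.2) h
    simp [turn_false] at h1
  · intro h
    have h1 := congrArg (fun o : G.OrientedEdge => (G.glue o.1).2) h
    simp [turn_true] at h1

lemma turn_injective (k : Fin 3) : Function.Injective (turn k : G.OrientedEdge → _) := by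
  rintro ⟨⟨n, i⟩, _ | _⟩ ⟨⟨n', i'⟩, _ | _⟩ h
  · simpa [turn_false] using h
  · simp [turn_false, turn_true] at h
  · simp [turn_false, turn_true] at h
  · simp only [turn_true, Prod.mk.injEq, EmbeddingLike.apply_eq_iff_eq, add_left_inj, and_true] at h
    have := G.glue.injective (Prod.ext h.1 h.2)
    rw [this]

/-- Oriented edges joined by a geodesic path. -/
def Reach (o o' : G.OrientedEdge) : Prop :=
  Relation.ReflTransGen (fun a b => ∃ k, k ≠ 0 ∧ b = turn k a) o o'

lemma reach_turn (o : G.OrientedEdge) {k : Fin 3} (hk : k ≠ 0) : Reach o (turn k o) :=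
  .single ⟨k, hk, rfl⟩

/-- Always turning the same way permutes a finite set, so the path eventually comes back. This makes
reachability symmetric. -/
lemma turn_reach (o : G.OrientedEdge) {k : Fin 3} (hk : k ≠ 0) : Reach (turn k o) o := by
  obtain ⟨n, hn, hp⟩ := (turn_injective k).mem_periodicPts o
  obtain ⟨m, rfl⟩ := Nat.exists_eq_succ_of_ne_zero hn.ne'
  have key : ∀ m, Reach (turn k o) ((turn k)^[m] (turn k o)) := by
    intro m
    induction m with
    | zero => exact .refl
    | succ m ih =>
      rw [Function.iterate_succ_apply']
      exact ih.trans (reach_turn _ hk)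
  have := key m
  rwa [← Function.iterate_succ_apply, hp] at this

lemma Reach.symm {o o' : G.OrientedEdge} (h : Reach o o') : Reach o' o := by
  induction h with
  | refl => exact .refl
  | tail _ h ih =>
    obtain ⟨k, hk, rfl⟩ := h
    exact (turn_reach _ hk).trans ih

lemma Reach.next {o o' : G.OrientedEdge} (h : Reach o o') : Relation.ReflTransGen Next o o' :=
  Relation.ReflTransGen.mono (by rintro a b ⟨k, hk, rfl⟩; exact next_turn hk a) _ _ h

/-- An edge entering the vertex reaches both of the other edges leaving it. By symmetry these reach
each other, and trivalence then connects all six oriented edges at the vertex. -/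
lemma reach_white (n : G.W) (i i' : Fin 3) (b b' : Bool) :
    Reach (((n, i), b) : G.OrientedEdge) ((n, i'), b') := by
  have h1 : ∀ i (k : Fin 3), k ≠ 0 → Reach (((n, i), false) : G.OrientedEdge) ((n, i + k), true) :=
    fun i k hk => reach_turn ((n, i), false) hk
  have h2 : ∀ i, Reach (((n, i + 1), true) : G.OrientedEdge) ((n, i + 2), true) := fun i =>
    (h1 i 1 (by decide)).symm.trans (h1 i 2 (by decide))
  have h3 : ∀ i, Reach (((n, i), true) : G.OrientedEdge) ((n, i + 1), true) := fun i => by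
    have := h2 (i + 2)
    rwa [(Fin3.add i).2.2.1, (Fin3.add i).2.2.2] at this
  have h4 : ∀ i i', Reach (((n, i), true) : G.OrientedEdge) ((n, i'), true) := fun i i' => by
    rcases Fin3.cases i i' with rfl | rfl | rfl
    · exact .refl
    · exact h3 i
    · exact (h3 i).trans (h2 i)
  have h5 : ∀ i b, Reach (((n, i), b) : G.OrientedEdge) ((n, 0), true) := fun i b => by
    cases b
    · exact (h1 i 1 (by decide)).trans (h4 _ _)
    · exact h4 _ _
  exact (h5 i b).trans (h5 i' b').symm

lemma reach_black (m : G.B) (i i' : Fin 3) (b b' : Bool) :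
    Reach ((G.glue.symm (m, i), b) : G.OrientedEdge) (G.glue.symm (m, i'), b') := by
  have h1 : ∀ i (k : Fin 3), k ≠ 0 →
      Reach ((G.glue.symm (m, i), true) : G.OrientedEdge) (G.glue.symm (m, i + k), false) :=
    fun i k hk => by
      have := reach_turn (G := G) (G.glue.symm (m, i), true) hk
      rwa [turn_true, Equiv.apply_symm_apply] at this
  have h2 : ∀ i, Reach ((G.glue.symm (m, i + 1), false) : G.OrientedEdge)
      (G.glue.symm (m, i + 2), false) := fun i =>
    (h1 i 1 (by decide)).symm.trans (h1 i 2 (by decide))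
  have h3 : ∀ i, Reach ((G.glue.symm (m, i), false) : G.OrientedEdge)
      (G.glue.symm (m, i + 1), false) := fun i => by
    have := h2 (i + 2)
    rwa [(Fin3.add i).2.2.1, (Fin3.add i).2.2.2] at this
  have h4 : ∀ i i', Reach ((G.glue.symm (m, i), false) : G.OrientedEdge)
      (G.glue.symm (m, i'), false) := fun i i' => by
    rcases Fin3.cases i i' with rfl | rfl | rfl
    · exact .refl
    · exact h3 i
    · exact (h3 i).trans (h2 i)
  have h5 : ∀ i b, Reach ((G.glue.symm (m, i), b) : G.OrientedEdge)
      (G.glue.symm (m, 0), false) := fun i b => by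
    cases b
    · exact h4 _ _
    · exact (h1 i 1 (by decide)).trans (h4 _ _)
  exact (h5 i b).trans (h5 i' b').symm

/-- The graph of oriented edges is strongly connected. -/
lemma reach_all (o o' : G.OrientedEdge) : Reach o o' := by
  let rep : G.Vertex → G.OrientedEdge :=
    Sum.elim (fun n => ((n, 0), true)) fun m => (G.glue.symm (m, 0), true)
  have h1 : ∀ v v', Reach (rep v) (rep v') := by
    intro v v'
    have h := G.reflTransGen_opp v v'
    induction h with
    | refl => exact .refl
    | tail _ h ih =>
      obtain ⟨i, rfl⟩ := h
      refine ih.trans ?_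
      rename_i a _
      obtain n | m := a
      · refine (reach_white n 0 i true true).trans ?_
        have := reach_black (G.glue (n, i)).1 (G.glue (n, i)).2 0 true true
        rwa [Prod.mk.eta, Equiv.symm_apply_apply] at this
      · refine (reach_black m 0 i true true).trans ?_
        have := reach_white (G.glue.symm (m, i)).1 (G.glue.symm (m, i)).2 0 true true
        rwa [Prod.mk.eta] at this
  have h2 : ∀ o : G.OrientedEdge, Reach o (rep (Sum.inl o.1.1)) := fun o =>
    reach_white o.1.1 o.1.2 0 o.2 true
  exact (h2 o).trans ((h1 _ _).trans (h2 o').symm)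

/-- The path is sought up to an edge `a` with `turn 1 a = o'`, so that the last step is a proper
turn even when `o` already equals `a`. -/
lemma exists_connector (o o' : G.OrientedEdge) :
    ∃ c : List G.OrientedEdge, List.IsChain Next (o :: (c ++ [o'])) := by
  obtain ⟨a, rfl⟩ := (Finite.injective_iff_surjective.1 (turn_injective (G := G) 1)) o'
  have h := (reach_all o a).next
  induction h using Relation.ReflTransGen.head_induction_on with
  | refl => exact ⟨[], by simpa using next_turn (by decide) a⟩
  | head h _ ih =>
    obtain ⟨c, hc⟩ := ih
    exact ⟨_ :: c, List.IsChain.cons_cons h hc⟩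

/-- The length of a list of oriented edges. -/
def wordLength (l : G.Edge → ℝ) (w : List G.OrientedEdge) : ℝ := (w.map fun o => l o.1).sum

lemma wordLength_append (l : G.Edge → ℝ) (w w' : List G.OrientedEdge) :
    wordLength l (w ++ w') = wordLength l w + wordLength l w' := by
  simp [wordLength]

lemma wordLength_cons (l : G.Edge → ℝ) (o : G.OrientedEdge) (w : List G.OrientedEdge) :
    wordLength l (o :: w) = l o.1 + wordLength l w := by
  simp [wordLength]

/-- The geodesic paths of length less than `T`. -/
def words (l : G.Edge → ℝ) (T : ℝ) : Set (List G.OrientedEdge) :=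
  {w | List.IsChain Next w ∧ wordLength l w < T}

section Metric

variable {l : G.Edge → ℝ}

lemma wordLength_nonneg (hl : l ∈ G.metrics) (w : List G.OrientedEdge) : 0 ≤ wordLength l w :=
  List.sum_nonneg fun x hx => by
    obtain ⟨o, -, rfl⟩ := List.mem_map.1 hx
    exact (hl _).le

lemma exists_bounds (hl : l ∈ G.metrics) : ∃ a b : ℝ, 0 < a ∧ ∀ e, a ≤ l e ∧ l e ≤ b := by
  have := G.nonempty_edge
  obtain ⟨e, he⟩ := Finite.exists_min l
  obtain ⟨e', he'⟩ := Finite.exists_max l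
  exact ⟨l e, l e', hl e, fun x => ⟨he x, he' x⟩⟩

lemma length_mul_le {a : ℝ} (ha : ∀ e, a ≤ l e) (w : List G.OrientedEdge) :
    w.length * a ≤ wordLength l w := by
  induction w with
  | nil => simp [wordLength]
  | cons o w ih =>
    rw [wordLength_cons, List.length_cons]
    push_cast
    linarith [ha o.1]

lemma wordLength_le {b : ℝ} (hb : ∀ e, l e ≤ b) (w : List G.OrientedEdge) :
    wordLength l w ≤ w.length * b := by
  induction w with
  | nil => simp [wordLength]
  | cons o w ih =>
    rw [wordLength_cons, List.length_cons]
    push_cast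
    linarith [hb o.1]

lemma finite_words (hl : l ∈ G.metrics) (T : ℝ) : (words l T).Finite := by
  obtain ⟨a, b, ha, hab⟩ := exists_bounds hl
  refine (List.finite_length_le G.OrientedEdge ⌊T / a⌋₊).subset ?_
  rintro w ⟨-, hw⟩
  have := length_mul_le (fun e => (hab e).1) w
  refine Nat.le_floor ?_
  rw [le_div_iff₀ ha]
  linarith

lemma words_mono {S T : ℝ} (h : S ≤ T) : words l S ⊆ words l T := fun _ hw => ⟨hw.1, hw.2.trans_le h⟩

lemma nil_mem_words {T : ℝ} (hT : 0 < T) : [] ∈ words l T :=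
  ⟨List.isChain_nil, by simpa [wordLength] using hT⟩

lemma one_le_ncard_words (hl : l ∈ G.metrics) {T : ℝ} (hT : 0 < T) : 1 ≤ (words l T).ncard :=
  (Set.ncard_pos (finite_words hl T)).2 ⟨_, nil_mem_words hT⟩

lemma exists_split (w : List G.OrientedEdge) : ∀ S : ℝ, 0 < S → S ≤ wordLength l w →
    ∃ p o r, w = p ++ o :: r ∧ wordLength l p < S ∧ S ≤ wordLength l p + l o.1 := by
  induction w with
  | nil =>
    intro S h1 h2
    simp [wordLength] at h2
    linarith
  | cons o w ih =>
    intro S h1 h2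
    rw [wordLength_cons] at h2
    by_cases h : S ≤ l o.1
    · exact ⟨[], o, w, rfl, by simpa [wordLength] using h1, by simpa [wordLength] using h⟩
    · obtain ⟨p, o', r, rfl, h3, h4⟩ := ih (S - l o.1) (by linarith) (by linarith)
      exact ⟨o :: p, o', r, rfl, by rw [wordLength_cons]; linarith,
        by rw [wordLength_cons]; linarith⟩

/-- A path is cut at the edge at which its length reaches `S`: it is recovered from the part before,
that edge, and the part after. The value `none` encodes paths shorter than `S`. -/
lemma ncard_words_add_le (hl : l ∈ G.metrics) {S T : ℝ} (hS : 0 < S) (hT : 0 < T) :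
    (words l (S + T)).ncard ≤
      (Nat.card (Option G.OrientedEdge)) * ((words l S).ncard * (words l T).ncard) := by
  let dec : Option G.OrientedEdge × List G.OrientedEdge × List G.OrientedEdge →
    List G.OrientedEdge := fun x => x.2.1 ++ (x.1.elim [] fun o => o :: x.2.2)
  have hsub : words l (S + T) ⊆ dec '' (Set.univ ×ˢ (words l S ×ˢ words l T)) := by
    rintro w ⟨hw, hw'⟩
    by_cases h : wordLength l w < S
    · exact ⟨(none, w, []), ⟨Set.mem_univ _, ⟨hw, h⟩, nil_mem_words hT⟩, by simp [dec]⟩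
    · obtain ⟨p, o, r, rfl, h1, h2⟩ := exists_split w S hS (not_lt.1 h)
      refine ⟨(some o, p, r), ⟨Set.mem_univ _, ⟨hw.left_of_append, h1⟩, ?_, ?_⟩, rfl⟩
      · exact hw.right_of_append.tail
      · rw [wordLength_append, wordLength_cons] at hw'
        show wordLength l r < T
        linarith
  have hfin : (Set.univ ×ˢ (words l S ×ˢ words l T) :
      Set (Option G.OrientedEdge × List G.OrientedEdge × List G.OrientedEdge)).Finite :=
    Set.finite_univ.prod ((finite_words hl S).prod (finite_words hl T))
  calc _ ≤ (dec '' (Set.univ ×ˢ (words l S ×ˢ words l T))).ncard :=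
        Set.ncard_le_ncard hsub (hfin.image _)
    _ ≤ _ := Set.ncard_image_le hfin
    _ = _ := by rw [Set.ncard_prod, Set.ncard_prod, Set.ncard_univ]

/-- The geodesic path with given initial edge and given turns. -/
def walk (o : G.OrientedEdge) : List Bool → List G.OrientedEdge
  | [] => []
  | b :: bs => (if b then turn 1 o else turn 2 o) :: walk (if b then turn 1 o else turn 2 o) bs

lemma isChain_walk (o : G.OrientedEdge) (bs : List Bool) : List.IsChain Next (o :: walk o bs) := by
  induction bs generalizing o with
  | nil => exact List.isChain_singleton _
  | cons b bs ih =>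
    refine List.IsChain.cons_cons ?_ (ih _)
    cases b
    · exact next_turn (by decide) o
    · exact next_turn (by decide) o

lemma length_walk (o : G.OrientedEdge) (bs : List Bool) : (walk o bs).length = bs.length := by
  induction bs generalizing o with
  | nil => rfl
  | cons b bs ih => simp [walk, ih]

lemma walk_injective (o : G.OrientedEdge) : Function.Injective (walk o) := by
  intro bs
  induction bs generalizing o with
  | nil =>
    intro bs' h
    cases bs' with
    | nil => rfl
    | cons b' bs' => simp [walk] at h
  | cons b bs ih =>
    intro bs' h
    cases bs' with
    | nil => simp [walk] at h
    | cons b' bs' =>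
      rw [walk, walk, List.cons.injEq] at h
      obtain ⟨h1, h2⟩ := h
      have hb : b = b' := by
        have := turn_ne o
        cases b <;> cases b' <;> simp_all
      subst hb
      rw [ih _ h2]

lemma two_pow_le_ncard_words (hl : l ∈ G.metrics) {b : ℝ} (hb : ∀ e, l e ≤ b) {k : ℕ} {T : ℝ}
    (hT : k * b < T) : 2 ^ k ≤ (words l T).ncard := by
  obtain ⟨e⟩ := G.nonempty_edge
  let o : G.OrientedEdge := (e, true)
  have h1 : (Set.univ : Set (List.Vector Bool k)).ncard ≤ (words l T).ncard := by
    apply Set.ncard_le_ncard_of_injOn (fun v => walk o v.1) (ht := finite_words hl T)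
    · intro v _
      refine ⟨(isChain_walk o v.1).tail, ?_⟩
      have := wordLength_le hb (walk o v.1)
      rw [length_walk, v.2] at this
      linarith
    · intro v _ v' _ h
      exact Subtype.ext (walk_injective o h)
  rwa [Set.ncard_univ, Nat.card_eq_fintype_card, card_vector, Fintype.card_bool] at h1

/-- The number of geodesic paths grows exponentially. -/
lemma exists_growth (hl : l ∈ G.metrics) : ∃ h > 0,
    Tendsto (fun n : ℕ => Real.log ((words l n).ncard) / n) atTop (𝓝 h) := by
  have := G.nonempty_edge
  set K : ℝ := (Nat.card (Option G.OrientedEdge) : ℝ) with hK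
  have hK1 : 1 ≤ K := by
    rw [hK, ← Nat.cast_one, Nat.cast_le]
    exact Nat.card_pos
  -- The factor `K` turns the inequality for cut paths into subadditivity, and Fekete's lemma gives
  -- the limit. At `n = 0` there are no paths, and the convention `log 0 = 0` gives `u 0 = 0`.
  let u : ℕ → ℝ := fun n => Real.log (K * (words l n).ncard)
  have hcard : ∀ n : ℕ, 0 < n → (1 : ℝ) ≤ (words l n).ncard := fun n hn => by
    exact_mod_cast one_le_ncard_words hl (by exact_mod_cast hn)
  have hu0 : u 0 = 0 := by
    have : words l ((0 : ℕ) : ℝ) = ∅ := by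
      rw [Set.eq_empty_iff_forall_notMem]
      rintro w ⟨-, hw⟩
      rw [Nat.cast_zero] at hw
      linarith [wordLength_nonneg hl w]
    show Real.log (K * (words l ((0 : ℕ) : ℝ)).ncard) = 0
    rw [this]
    simp
  have hu : Subadditive u := by
    intro m n
    rcases Nat.eq_zero_or_pos m with rfl | hm
    · rw [zero_add, hu0, zero_add]
    rcases Nat.eq_zero_or_pos n with rfl | hn
    · rw [add_zero, hu0, add_zero]
    have c1 := hcard m hm
    have c2 := hcard n hn
    have c3 := hcard (m + n) (by omega)
    rw [← Real.log_mul (by positivity) (by positivity)]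
    apply Real.log_le_log (by positivity)
    have h1 : ((words l ((m + n : ℕ) : ℝ)).ncard : ℝ) ≤
        K * ((words l m).ncard * (words l n).ncard) := by
      have := ncard_words_add_le hl (S := m) (T := n) (by exact_mod_cast hm)
        (by exact_mod_cast hn)
      rw [hK, Nat.cast_add]
      rw [← Nat.cast_mul, ← Nat.cast_mul, Nat.cast_le]
      exact this
    calc K * ((words l ((m + n : ℕ) : ℝ)).ncard : ℝ) ≤
        K * (K * ((words l m).ncard * (words l n).ncard)) := by gcongr
      _ = _ := by ring
  have hunn : ∀ n, 0 ≤ u n := by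
    intro n
    rcases Nat.eq_zero_or_pos n with rfl | hn
    · rw [hu0]
    · exact Real.log_nonneg (by nlinarith [hcard n hn])
  have hlim := hu.tendsto_lim ⟨0, by
    rintro _ ⟨n, rfl⟩
    exact div_nonneg (hunn n) n.cast_nonneg⟩
  obtain ⟨a, b, ha, hab⟩ := exists_bounds hl
  obtain ⟨q, hq⟩ := exists_nat_gt b
  have hb0 : 0 < b := by
    obtain ⟨e⟩ := G.nonempty_edge
    linarith [(hab e).1, (hab e).2]
  have hq0 : (0 : ℝ) < q := hb0.trans hq
  refine ⟨hu.lim, ?_, ?_⟩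
  · have hsub : Tendsto (fun k : ℕ => q * k) atTop atTop :=
      tendsto_id.const_mul_atTop' (by exact_mod_cast hq0)
    have h1 := hlim.comp hsub
    -- Positivity: with `q` larger than every edge length, the `2 ^ k` sequences of left and right
    -- turns are paths shorter than `q k`.
    have h2 : Real.log 2 / q ≤ hu.lim := by
      refine ge_of_tendsto h1 ?_
      filter_upwards [eventually_gt_atTop 0] with k hk
      have hk' : (0 : ℝ) < k := by exact_mod_cast hk
      have h3 := two_pow_le_ncard_words hl (fun e => (hab e).2) (k := k) (T := ((q * k : ℕ) : ℝ))
        (by push_cast; nlinarith)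
      have h4 : (k : ℝ) * Real.log 2 ≤ u (q * k) := by
        rw [← Real.log_pow]
        apply Real.log_le_log (by positivity)
        have h5 : (2 : ℝ) ^ k ≤ (words l ((q * k : ℕ) : ℝ)).ncard := by exact_mod_cast h3
        nlinarith [pow_pos (two_pos : (0 : ℝ) < 2) k]
      show Real.log 2 / q ≤ u (q * k) / ((q * k : ℕ) : ℝ)
      rw [div_le_div_iff₀ hq0 (by push_cast; positivity)]
      push_cast
      nlinarith
    exact lt_of_lt_of_le (div_pos (Real.log_pos one_lt_two) hq0) h2
  · have h1 : Tendsto (fun n : ℕ => Real.log K / n) atTop (𝓝 0) :=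
      tendsto_const_div_atTop_nhds_zero_nat _
    have h2 := hlim.sub h1
    rw [sub_zero] at h2
    refine h2.congr' ?_
    filter_upwards [eventually_gt_atTop 0] with n hn
    have := hcard n hn
    rw [← sub_div]
    simp only [u]
    rw [Real.log_mul (by positivity) (by positivity), add_sub_cancel_left]

end Metric

end FatGraph


/-! ### From geodesic paths to closed geodesics -/

namespace FatGraph

variable {G : FatGraph}

lemma shift_iterate (n : ℕ) (γ : ℤ → G.OrientedEdge) (k : ℤ) :
    shift^[n] γ k = γ (k + n) := by
  induction n generalizing k with
  | zero => simp
  | succ n ih =>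
    rw [Function.iterate_succ_apply', shift, ih]
    push_cast
    congr 1
    ring

lemma eq_emod_of_periodic {α : Type*} {γ : ℤ → α} {p : ℤ} (h : ∀ k, γ (k + p) = γ k) (k : ℤ) :
    γ k = γ (k % p) := by
  have h1 : Function.Periodic γ p := h
  have h2 := (h1.int_mul (k / p)) (k % p)
  rw [← h2]
  congr 1
  have := Int.emod_add_mul_ediv k p
  push_cast
  linarith [mul_comm p (k / p)]

lemma sum_range_eq_wordLength (l : G.Edge → ℝ) (γ : ℤ → G.OrientedEdge) (n : ℕ) :
    ∑ i ∈ Finset.range n, l (γ (i : ℤ)).1 =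
      wordLength l ((List.range n).map fun i : ℕ => γ i) := by
  induction n with
  | zero => simp [wordLength]
  | succ n ih =>
    rw [Finset.sum_range_succ, ih, List.range_succ, List.map_append, wordLength_append]
    simp [wordLength]

lemma isChain_range {γ : ℤ → G.OrientedEdge} (h : IsGeodesic γ) (n : ℕ) :
    List.IsChain Next ((List.range n).map fun i : ℕ => γ i) := by
  rw [List.isChain_iff_getElem]
  intro i hi
  have := h i
  simpa [Next] using this

/-- The word is repeated periodically; the hypothesis covers the step from its last letter back to
the first. The default value of `getD` is never reached. -/
lemma exists_periodic {V : List G.OrientedEdge} (hV : V ≠ [])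
    (h : List.IsChain Next (V ++ [V.head hV])) : ∃ γ : ℤ → G.OrientedEdge, IsGeodesic γ ∧
      (∀ k, γ (k + V.length) = γ k) ∧ V = (List.range V.length).map fun i : ℕ => γ i := by
  have hN : 0 < V.length := List.length_pos_iff.2 hV
  have hN' : (0 : ℤ) < V.length := by exact_mod_cast hN
  refine ⟨fun k => V.getD (k % V.length).toNat (V.head hV), ?_, ?_, ?_⟩
  · intro k
    rw [List.isChain_iff_getElem] at h
    have h1 := Int.emod_nonneg k hN'.ne'
    have h2 := Int.emod_lt_of_pos k hN'
    obtain ⟨r, hr⟩ := Int.eq_ofNat_of_zero_le h1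
    have hr' : r < V.length := by omega
    have h3 := h r (by simp; omega)
    have h4 : V.getD (k % V.length).toNat (V.head hV) = (V ++ [V.head hV])[r]'(by simp; omega) := by
      rw [hr, Int.toNat_natCast, List.getD_eq_getElem _ _ hr', List.getElem_append_left hr']
    have h5 : V.getD ((k + 1) % V.length).toNat (V.head hV) =
        (V ++ [V.head hV])[r + 1]'(by simp; omega) := by
      rcases Nat.lt_or_ge (r + 1) V.length with h6 | h6
      · have : (k + 1) % (V.length : ℤ) = ((r + 1 : ℕ) : ℤ) := by
          have e := Int.emod_add_mul_ediv k V.length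
          rw [hr] at e
          rw [← e, add_right_comm, Int.add_mul_emod_self_left, Int.emod_eq_of_lt]
          · rfl
          · exact Int.add_nonneg (Int.natCast_nonneg r) zero_le_one
          · show (r : ℤ) + 1 < _
            exact_mod_cast h6
        rw [this, Int.toNat_natCast, List.getD_eq_getElem _ _ h6, List.getElem_append_left h6]
      · have h7 : r + 1 = V.length := by omega
        have : (k + 1) % (V.length : ℤ) = 0 := by
          have := Int.emod_add_mul_ediv k V.length
          apply Int.emod_eq_zero_of_dvd
          refine ⟨k / V.length + 1, ?_⟩
          rw [mul_add, mul_one]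
          have h8 : ((r : ℕ) : ℤ) + 1 = V.length := by exact_mod_cast h7
          linarith
        rw [this, List.getElem_append_right h6]
        simp [List.head_eq_getElem, hN]
    simp only [] at h4 h5 ⊢
    rw [h4, h5]
    exact h3
  · intro k
    simp
  · apply List.ext_getElem
    · simp
    · intro i h1 h2
      have : ((i : ℤ) % (V.length : ℤ)).toNat = i := by
        rw [Int.emod_eq_of_lt (by omega) (by omega), Int.toNat_natCast]
      simp [this, h1]

section Metric

variable {l : G.Edge → ℝ}

/-- A closed geodesic is determined by the path that it traces over its least period. Hence closed
geodesics are at most as many as paths. -/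
lemma closedGeodesics_subset (l : G.Edge → ℝ) (T : ℝ) :
    closedGeodesics l T ⊆ (fun w : List G.OrientedEdge =>
      {δ : ℤ → G.OrientedEdge | ∃ k : ℤ, ∀ j : ℤ, some (δ j) = w[((j + k) % w.length).toNat]?}) ''
        words l T := by
  rintro O ⟨γ, h1, h2, rfl, h3⟩
  set p := Function.minimalPeriod shift γ with hp
  have hp0 : (0 : ℤ) < p := by exact_mod_cast h2
  have hper : ∀ k, γ (k + p) = γ k := fun k => by
    have := congrFun (Function.iterate_minimalPeriod (f := shift) (x := γ)) k
    rwa [shift_iterate] at this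
  refine ⟨(List.range p).map fun i : ℕ => γ i, ⟨isChain_range h1 p, ?_⟩, ?_⟩
  · rwa [← sum_range_eq_wordLength]
  · ext δ
    have key : ∀ j : ℤ, ((List.range p).map fun i : ℕ => γ i)[(j %
        (((List.range p).map fun i : ℕ => γ i).length : ℤ)).toNat]? = some (γ j) := by
      intro j
      have e1 := Int.emod_nonneg j hp0.ne'
      have e2 := Int.emod_lt_of_pos j hp0
      rw [List.length_map, List.length_range, List.getElem?_map,
        List.getElem?_range (by omega), Option.map_some, Int.toNat_of_nonneg e1,
        ← eq_emod_of_periodic hper]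
    simp only [key, Set.mem_ofPred_eq, Option.some.injEq, Set.mem_range, funext_iff]
    exact exists_congr fun k => forall_congr' fun j => eq_comm

lemma finite_closedGeodesics (hl : l ∈ G.metrics) (T : ℝ) : (closedGeodesics l T).Finite :=
  ((finite_words hl T).image _).subset (closedGeodesics_subset l T)

lemma ncard_closedGeodesics_le (hl : l ∈ G.metrics) (T : ℝ) :
    (closedGeodesics l T).ncard ≤ (words l T).ncard :=
  (Set.ncard_le_ncard (closedGeodesics_subset l T) ((finite_words hl T).image _)).trans
    (Set.ncard_image_le (finite_words hl T))

/-- A path is closed up by a connector from its last edge to its first. There are finitely many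
connectors to choose, so their lengths are bounded; the extra `l e` covers the empty path, which is
replaced by a single edge. -/
lemma exists_closed_extension (hl : l ∈ G.metrics) : ∃ C : ℝ, 0 ≤ C ∧ ∀ T, ∀ w ∈ words l T,
    ∃ γ : ℤ → G.OrientedEdge, ∃ N : ℕ, IsGeodesic γ ∧ 0 < N ∧ w.length ≤ N ∧
      (∀ k, γ (k + N) = γ k) ∧ wordLength l ((List.range N).map fun i : ℕ => γ i) < T + C ∧
      w = (List.range w.length).map fun i : ℕ => γ i := by
  choose c hc using fun x : G.OrientedEdge × G.OrientedEdge => exists_connector x.1 x.2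
  obtain ⟨e⟩ := G.nonempty_edge
  have hne : Nonempty (G.OrientedEdge × G.OrientedEdge) := ⟨((e, true), (e, true))⟩
  obtain ⟨x, hx⟩ := Finite.exists_max fun x => wordLength l (c x)
  have hmain : ∀ w : List G.OrientedEdge, w ≠ [] → List.IsChain Next w →
    ∃ γ : ℤ → G.OrientedEdge, ∃ N : ℕ, IsGeodesic γ ∧ 0 < N ∧ w.length ≤ N ∧
      (∀ k, γ (k + N) = γ k) ∧
      wordLength l ((List.range N).map fun i : ℕ => γ i) ≤ wordLength l w + wordLength l (c x) ∧
      w = (List.range w.length).map fun i : ℕ => γ i := by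
    intro w hw hch
    obtain ⟨u, o, rfl⟩ := (List.eq_nil_or_concat w).resolve_left hw
    rw [List.concat_eq_append] at *
    set y : G.OrientedEdge × G.OrientedEdge := (o, (u ++ [o]).head hw) with hy
    have hV : u ++ [o] ++ c y ≠ [] := by simp
    have hhead : (u ++ [o] ++ c y).head hV = (u ++ [o]).head hw := List.head_append_of_ne_nil hw
    have hchain : List.IsChain Next (u ++ [o] ++ c y ++ [(u ++ [o] ++ c y).head hV]) := by
      rw [hhead, List.append_assoc, List.append_assoc, List.singleton_append]
      exact List.isChain_split.2 ⟨hch, hc y⟩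
    obtain ⟨γ, h1, h2, h3⟩ := exists_periodic hV hchain
    refine ⟨γ, _, h1, List.length_pos_iff.2 hV, by simp, h2, ?_, ?_⟩
    · rw [← h3, wordLength_append]
      linarith [hx y]
    · apply List.ext_getElem
      · simp
      · intro i e1 e2
        have e3 : i < (u ++ [o] ++ c y).length := by rw [List.length_append]; omega
        have : (u ++ [o])[i] = (u ++ [o] ++ c y)[i] := (List.getElem_append_left e1).symm
        rw [this, List.getElem_of_eq h3]
        simp
  refine ⟨l e + wordLength l (c x), add_nonneg (hl e).le (wordLength_nonneg hl _), ?_⟩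
  rintro T w ⟨hw, hw'⟩
  by_cases h : w = []
  · subst h
    obtain ⟨γ, N, h1, h2, -, h3, h4, -⟩ := hmain [(e, true)] (by simp) (List.isChain_singleton _)
    refine ⟨γ, N, h1, h2, by simp, h3, ?_, by simp⟩
    simp only [wordLength, List.map_cons, List.map_nil, List.sum_cons, List.sum_nil] at h4 hw' ⊢
    linarith
  · obtain ⟨γ, N, h1, h2, h3, h4, h5, h6⟩ := hmain w h hw
    exact ⟨γ, N, h1, h2, h3, h4, by linarith [hl e], h6⟩

/-- A path is read off from the orbit of its closed extension, a starting index and its length. Both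
integers are at most `(T + C) / a`, so only a polynomial factor is lost. -/
lemma ncard_words_le (hl : l ∈ G.metrics) {a : ℝ} (ha : 0 < a) (hla : ∀ e, a ≤ l e) :
    ∃ C : ℝ, 0 ≤ C ∧ ∀ T, (words l T).ncard ≤
      (closedGeodesics l (T + C)).ncard * (⌊(T + C) / a⌋₊ + 1) ^ 2 := by
  obtain ⟨C, hC, h⟩ := exists_closed_extension hl
  refine ⟨C, hC, fun T => ?_⟩
  have := G.nonempty_edge
  let rep : Set (ℤ → G.OrientedEdge) → ℤ → G.OrientedEdge := fun O => Classical.epsilon (· ∈ O)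
  let dec : Set (ℤ → G.OrientedEdge) × ℕ × ℕ → List G.OrientedEdge := fun x =>
    (List.range x.2.2).map fun i : ℕ => rep x.1 (i + x.2.1)
  set M := ⌊(T + C) / a⌋₊ with hM
  have hfin : ((closedGeodesics l (T + C)) ×ˢ (Set.Iic M ×ˢ Set.Iic M) :
      Set (Set (ℤ → G.OrientedEdge) × ℕ × ℕ)).Finite :=
    (finite_closedGeodesics hl _).prod ((Set.finite_Iic M).prod (Set.finite_Iic M))
  have hsub : words l T ⊆ dec '' ((closedGeodesics l (T + C)) ×ˢ (Set.Iic M ×ˢ Set.Iic M)) := by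
    intro w hw
    obtain ⟨γ, N, h1, h2, h3, h4, h5, h6⟩ := h T w hw
    have hN : (0 : ℤ) < N := by exact_mod_cast h2
    have hNM : N ≤ M := by
      have := length_mul_le hla ((List.range N).map fun i : ℕ => γ i)
      rw [List.length_map, List.length_range] at this
      refine Nat.le_floor ?_
      rw [le_div_iff₀ ha]
      linarith
    have hpt : Function.IsPeriodicPt shift N γ := by
      funext k
      rw [shift_iterate, h4]
    set O : Set (ℤ → G.OrientedEdge) := Set.range (fun (k : ℤ) (j : ℤ) => γ (j + k)) with hO
    have hOn : O.Nonempty := Set.range_nonempty _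
    have hrep : rep O ∈ O := Classical.epsilon_spec hOn
    obtain ⟨k, hk⟩ := hrep
    have hrep' : ∀ j, rep O j = γ (j + k) := fun j => (congrFun hk j).symm
    have hk0 := Int.emod_nonneg (-k) hN.ne'
    have hk1 := Int.emod_lt_of_pos (-k) hN
    refine ⟨(O, ((-k) % N).toNat, w.length), ⟨⟨γ, h1, hpt.minimalPeriod_pos h2, rfl, ?_⟩, ?_, ?_⟩,
      ?_⟩
    · refine lt_of_le_of_lt ?_ h5
      rw [← sum_range_eq_wordLength]
      refine Finset.sum_le_sum_of_subset_of_nonneg ?_ fun i _ _ => (hl _).le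
      -- The period `N` need not be the least one; the sum over the least period is only smaller.
      exact Finset.range_mono (hpt.minimalPeriod_le h2)
    · show ((-k) % N).toNat ≤ M
      omega
    · exact h3.trans hNM
    · conv_rhs => rw [h6]
      simp only [dec]
      apply List.map_congr_left
      intro i _
      rw [hrep', Int.toNat_of_nonneg hk0, eq_emod_of_periodic h4, eq_emod_of_periodic h4 (i : ℤ)]
      congr 1
      rw [Int.emod_def (-k), show (i : ℤ) + (-k - N * (-k / N)) + k = i - N * (-k / N) by ring,
        Int.sub_mul_emod_self_left]
  calc _ ≤ _ := Set.ncard_le_ncard hsub (hfin.image _)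
    _ ≤ _ := Set.ncard_image_le hfin
    _ = _ := by
      rw [Set.ncard_prod, Set.ncard_prod, ← Finset.coe_Iic, Set.ncard_coe_finset, Nat.card_Iic,
        pow_two]

/-- The entropy of a metric exists and is positive. -/
lemma exists_entropy (hl : l ∈ G.metrics) : ∃ h > 0, HasEntropy l h := by
  obtain ⟨h, h0, hlim⟩ := exists_growth hl
  obtain ⟨a, b, ha, hab⟩ := exists_bounds hl
  obtain ⟨C, hC, hB⟩ := ncard_words_le hl ha fun e => (hab e).1
  refine ⟨h, h0, ?_⟩
  have hT0 : Tendsto (fun T : ℝ => T - C) atTop atTop := tendsto_atTop_add_const_right _ _ tendsto_id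
  have hratio : Tendsto (fun T : ℝ => (T - C) / T) atTop (𝓝 1) := by
    have h1 : Tendsto (fun T : ℝ => C / T) atTop (𝓝 0) := tendsto_const_nhds.div_atTop tendsto_id
    have h2 := h1.const_sub 1
    rw [sub_zero] at h2
    refine h2.congr' ?_
    filter_upwards [eventually_gt_atTop 0] with T hT
    field_simp
  have hlow1 : Tendsto (fun T : ℝ => Real.log ((words l (⌊T - C⌋₊ : ℝ)).ncard) / T) atTop (𝓝 h) := by
    have h1 := (hlim.comp (tendsto_nat_floor_atTop.comp hT0)).mul
      ((tendsto_nat_floor_div_atTop.comp hT0).mul hratio)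
    rw [mul_one, mul_one] at h1
    refine h1.congr' ?_
    filter_upwards [eventually_gt_atTop (C + 1)] with T hT
    have h2 : (0 : ℝ) < (⌊T - C⌋₊ : ℝ) := by
      exact_mod_cast Nat.floor_pos.2 (by linarith)
    have h3 : 0 < T - C := by linarith
    simp only [Function.comp]
    field_simp
  have hlow2 : Tendsto (fun T : ℝ => Real.log (T / a + 1) / T) atTop (𝓝 0) := by
    have h1 := (Real.tendsto_pow_log_div_mul_add_atTop a (-a) 1 ha.ne').comp
      (tendsto_atTop_add_const_right _ (1 : ℝ) (tendsto_id.atTop_div_const ha))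
    refine h1.congr fun T => ?_
    simp only [Function.comp, pow_one, id]
    congr 1
    field_simp
    ring
  have hlow := hlow1.sub (hlow2.const_mul 2)
  rw [mul_zero, sub_zero] at hlow
  have hup : Tendsto (fun T : ℝ => Real.log ((words l (⌈T⌉₊ : ℝ)).ncard) / T) atTop (𝓝 h) := by
    have h1 := (hlim.comp tendsto_nat_ceil_atTop).mul (tendsto_nat_ceil_div_atTop (R := ℝ))
    rw [mul_one] at h1
    refine h1.congr' ?_
    filter_upwards [eventually_gt_atTop 0] with T hT
    have h2 : (0 : ℝ) < (⌈T⌉₊ : ℝ) := by exact_mod_cast Nat.ceil_pos.2 hT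
    simp only [Function.comp]
    field_simp
  have hcount : ∀ T : ℝ, C + 1 < T → (1 : ℝ) ≤ (words l (⌊T - C⌋₊ : ℝ)).ncard ∧
      ((words l (⌊T - C⌋₊ : ℝ)).ncard : ℝ) ≤ (closedGeodesics l T).ncard * (T / a + 1) ^ 2 := by
    intro T hT
    have h1 : (0 : ℝ) < (⌊T - C⌋₊ : ℝ) := by exact_mod_cast Nat.floor_pos.2 (by linarith)
    refine ⟨by exact_mod_cast one_le_ncard_words hl h1, ?_⟩
    have h2 := hB (T - C)
    rw [sub_add_cancel] at h2
    have h3 := (Set.ncard_le_ncard (words_mono (Nat.floor_le (by linarith : 0 ≤ T - C)))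
      (finite_words hl _)).trans h2
    have h4 : ((⌊T / a⌋₊ : ℕ) : ℝ) ≤ T / a := Nat.floor_le (div_nonneg (by linarith) ha.le)
    have h5 : 0 < T := by linarith
    calc ((words l (⌊T - C⌋₊ : ℝ)).ncard : ℝ) ≤
        (((closedGeodesics l T).ncard * (⌊T / a⌋₊ + 1) ^ 2 : ℕ) : ℝ) := by exact_mod_cast h3
      _ ≤ _ := by push_cast; gcongr
  -- The closed geodesics are squeezed between paths of length `⌊T - C⌋`, up to a quadratic factor
  -- with vanishing logarithmic rate, and paths of length `⌈T⌉`.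
  refine tendsto_of_tendsto_of_tendsto_of_le_of_le' hlow hup ?_ ?_
  · filter_upwards [eventually_gt_atTop (C + 1)] with T hT
    obtain ⟨h1, h2⟩ := hcount T hT
    have hT0 : 0 < T := by linarith
    have h3 : (0 : ℝ) < (closedGeodesics l T).ncard := by
      by_contra h4
      have : ((closedGeodesics l T).ncard : ℝ) * (T / a + 1) ^ 2 ≤ 0 :=
        mul_nonpos_of_nonpos_of_nonneg (not_lt.1 h4) (by positivity)
      linarith
    rw [mul_div_assoc' , ← sub_div]
    apply div_le_div_of_nonneg_right _ hT0.le
    have h5 := Real.log_le_log (by linarith) h2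
    rw [Real.log_mul h3.ne' (by positivity), Real.log_pow] at h5
    push_cast at h5
    linarith
  · filter_upwards [eventually_gt_atTop (C + 1)] with T hT
    obtain ⟨h1, h2⟩ := hcount T hT
    have hT0 : 0 < T := by linarith
    apply div_le_div_of_nonneg_right _ hT0.le
    rcases Nat.eq_zero_or_pos (closedGeodesics l T).ncard with h3 | h3
    · rw [h3]
      simp only [Nat.cast_zero, Real.log_zero]
      apply Real.log_nonneg
      exact_mod_cast one_le_ncard_words hl (by exact_mod_cast Nat.ceil_pos.2 hT0)
    · apply Real.log_le_log (by exact_mod_cast h3)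
      exact_mod_cast (ncard_closedGeodesics_le hl T).trans
        (Set.ncard_le_ncard (words_mono (Nat.le_ceil T)) (finite_words hl _))

/-- Scaling the metric by `c` replaces the bound `T` by `T / c`, so the entropy is homogeneous of
degree `-1`. -/
lemma HasEntropy.smul {h c : ℝ} (hl : HasEntropy l h) (hc : 0 < c) :
    HasEntropy (c • l) (h / c) := by
  have h1 : ∀ T, closedGeodesics (c • l) T = closedGeodesics l (T / c) := by
    intro T
    ext O
    simp only [closedGeodesics, Set.mem_ofPred_eq, Pi.smul_apply, smul_eq_mul, lt_div_iff₀ hc,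
      mul_comm c, Finset.sum_mul]
  have h2 := (Tendsto.comp hl (tendsto_id.atTop_div_const hc)).div_const c
  refine h2.congr fun T => ?_
  simp only [Function.comp, id, h1]
  field_simp

lemma HasEntropy.unique {h h' : ℝ} (hl : HasEntropy l h) (hl' : HasEntropy l h') : h = h' :=
  tendsto_nhds_unique hl hl'

end Metric

end FatGraph


namespace FatGraph

variable {G : FatGraph} {l : G.Edge → ℝ}

/-! ### The path metric of a metric graph -/

lemma PathOfLength.trans {x y z : G.Point} {r s : ℝ} (h : PathOfLength l x y r)
    (h' : PathOfLength l y z s) : PathOfLength l x z (r + s) := by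
  induction h' with
  | refl => simpa using h
  | segment e t t' s _ ih => rw [← add_assoc]; exact .segment e t t' _ ih
  | white e e' s he _ ih => exact .white e e' _ he ih
  | black e e' s he _ ih => exact .black e e' _ he ih

lemma pathOfLength_segment (e : G.Edge) (t t' : Set.Icc (0 : ℝ) 1) :
    PathOfLength l (e, t) (e, t') (l e * |(t : ℝ) - t'|) := by
  simpa using PathOfLength.segment (l := l) e t t' 0 .refl

lemma PathOfLength.symm {x y : G.Point} {r : ℝ} (h : PathOfLength l x y r) :
    PathOfLength l y x r := by
  induction h with
  | refl => exact .refl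
  | segment e t t' s _ ih =>
    rw [add_comm, abs_sub_comm]
    exact (pathOfLength_segment e t' t).trans ih
  | white e e' s he _ ih => simpa using (PathOfLength.white e' e 0 he.symm .refl).trans ih
  | black e e' s he _ ih => simpa using (PathOfLength.black e' e 0 he.symm .refl).trans ih

/-- Induction along the path. Test functions that agree at the vertices thus give lower bounds for
the graph distance. -/
lemma PathOfLength.le_add (K : ℝ) {Φ : G.Point → ℝ}
    (h1 : ∀ e t t', Φ (e, t') ≤ Φ (e, t) + K * (l e * |(t : ℝ) - t'|))
    (h2 : ∀ e e' : G.Edge, e.1 = e'.1 → Φ (e, 0) = Φ (e', 0))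
    (h3 : ∀ e e' : G.Edge, (G.glue e).1 = (G.glue e').1 → Φ (e, 1) = Φ (e', 1))
    {x y : G.Point} {r : ℝ} (h : PathOfLength l x y r) : Φ y ≤ Φ x + K * r := by
  induction h with
  | refl => simp
  | segment e t t' s _ ih => linarith [h1 e t t']
  | white e e' s he _ ih => rwa [← h2 e e' he]
  | black e e' s he _ ih => rwa [← h3 e e' he]

lemma exists_pathOfLength (l : G.Edge → ℝ) (x y : G.Point) : ∃ r, PathOfLength l x y r := by
  let rep : G.Vertex → G.Point :=
    Sum.elim (fun n => ((n, 0), 0)) fun m => (G.glue.symm (m, 0), 1)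
  have hw : ∀ e : G.Edge, PathOfLength l (rep (Sum.inl e.1)) (e, 0) 0 := fun e =>
    .white (e.1, 0) e 0 rfl .refl
  have hb : ∀ e : G.Edge, PathOfLength l (rep (Sum.inr (G.glue e).1)) (e, 1) 0 := fun e =>
    .black (G.glue.symm ((G.glue e).1, 0)) e 0 (by simp) .refl
  have h1 : ∀ v v', ∃ r, PathOfLength l (rep v) (rep v') r := by
    intro v v'
    have h := G.reflTransGen_opp v v'
    induction h with
    | refl => exact ⟨0, .refl⟩
    | tail _ h ih =>
      obtain ⟨i, rfl⟩ := h
      obtain ⟨r, hr⟩ := ih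
      rename_i a _
      obtain n | m := a
      · exact ⟨_, (hr.trans (hw (n, i))).trans ((pathOfLength_segment _ _ _).trans (hb (n, i)).symm)⟩
      · have h2 := hb (G.glue.symm (m, i))
        rw [Equiv.apply_symm_apply] at h2
        exact ⟨_, (hr.trans h2).trans ((pathOfLength_segment _ _ _).trans
          (hw (G.glue.symm (m, i))).symm)⟩
  obtain ⟨e, t⟩ := x
  obtain ⟨e', t'⟩ := y
  obtain ⟨r, hr⟩ := h1 (Sum.inl e.1) (Sum.inl e'.1)
  exact ⟨_, (pathOfLength_segment e t 0).trans ((hw e).symm.trans (hr.trans ((hw e').trans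
    (pathOfLength_segment e' 0 t'))))⟩

lemma isLengthRel_pathOfLength (hl : l ∈ G.metrics) : IsLengthRel (PathOfLength l) where
  refl _ := .refl
  symm _ _ _ h := h.symm
  trans _ _ _ _ _ h h' := h.trans h'
  nonneg x y r h := by
    have := h.le_add 1 (Φ := fun _ => 0)
      (fun e t t' => by have := mul_nonneg (hl e).le (abs_nonneg ((t : ℝ) - t')); linarith)
      (fun _ _ _ => rfl) fun _ _ _ => rfl
    linarith
  conn := exists_pathOfLength l

section Metric

variable (hl : l ∈ G.metrics)
include hl

lemma graphDist_nonneg (x y : G.Point) : 0 ≤ graphDist l x y :=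
  (isLengthRel_pathOfLength hl).sInf_nonneg x y

lemma graphDist_self (x : G.Point) : graphDist l x x = 0 := (isLengthRel_pathOfLength hl).sInf_self x

lemma graphDist_comm (x y : G.Point) : graphDist l x y = graphDist l y x :=
  (isLengthRel_pathOfLength hl).sInf_comm x y

lemma graphDist_triangle (x y z : G.Point) :
    graphDist l x z ≤ graphDist l x y + graphDist l y z :=
  (isLengthRel_pathOfLength hl).sInf_triangle x y z

lemma graphDist_le {x y : G.Point} {r : ℝ} (h : PathOfLength l x y r) : graphDist l x y ≤ r :=
  (isLengthRel_pathOfLength hl).sInf_le h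

/-- A function on the graph which is Lipschitz on each edge is Lipschitz. -/
lemma le_add_graphDist {K : ℝ} (hK : 0 ≤ K) {Φ : G.Point → ℝ}
    (h1 : ∀ e t t', Φ (e, t') ≤ Φ (e, t) + K * (l e * |(t : ℝ) - t'|))
    (h2 : ∀ e e' : G.Edge, e.1 = e'.1 → Φ (e, 0) = Φ (e', 0))
    (h3 : ∀ e e' : G.Edge, (G.glue e).1 = (G.glue e').1 → Φ (e, 1) = Φ (e', 1))
    (x y : G.Point) : Φ y ≤ Φ x + K * graphDist l x y := by
  apply le_of_forall_pos_le_add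
  intro ε hε
  obtain ⟨r, hr, hxy⟩ := (isLengthRel_pathOfLength hl).exists_lt (x := x) (y := y)
    (lt_add_of_pos_right _ (show 0 < ε / (K + 1) by positivity))
  have h := hxy.le_add K h1 h2 h3
  have h4 : K * r ≤ K * (graphDist l x y + ε / (K + 1)) := mul_le_mul_of_nonneg_left hr.le hK
  have h5 : K * (ε / (K + 1)) ≤ ε := by
    rw [mul_div_assoc', div_le_iff₀ (by positivity)]
    nlinarith
  linarith

lemma exists_graphDist_le : ∃ D, ∀ x y, graphDist l x y ≤ D := by
  have := G.nonempty_edge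
  have hne : Nonempty (G.Edge × G.Edge) := inferInstance
  obtain ⟨⟨e0, e1⟩, h0⟩ := Finite.exists_max fun p : G.Edge × G.Edge =>
    graphDist l (p.1, 0) (p.2, 0) + (l p.1 + l p.2)
  refine ⟨graphDist l (e0, 0) (e1, 0) + (l e0 + l e1), ?_⟩
  rintro ⟨e, t⟩ ⟨e', t'⟩
  refine le_trans ?_ (h0 (e, e'))
  have h1 := graphDist_le hl (pathOfLength_segment e t 0)
  have h2 := graphDist_le hl (pathOfLength_segment e' 0 t')
  have h3 := graphDist_triangle hl (e, t) (e, 0) (e', t')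
  have h4 := graphDist_triangle hl (e, 0) (e', 0) (e', t')
  have h5 : ∀ t : Set.Icc (0 : ℝ) 1, |(t : ℝ)| ≤ 1 := fun t => abs_le.2 ⟨by linarith [t.2.1], t.2.2⟩
  have h6 : l e * |(t : ℝ) - (0 : Set.Icc (0 : ℝ) 1)| ≤ l e := by
    simpa using mul_le_mul_of_nonneg_left (h5 t) (hl e).le
  have h7 : l e' * |((0 : Set.Icc (0 : ℝ) 1) : ℝ) - t'| ≤ l e' := by
    simpa using mul_le_mul_of_nonneg_left (h5 t') (hl e').le
  simp only
  linarith

/-- Upper bounds for a distance by the distance of a metric graph, from upper bounds on the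
edges. -/
lemma dist_le_graphDist {X : Type*} {δ : X → X → ℝ}
    (hδ : ∀ x y z, δ x z ≤ δ x y + δ y z) (hδc : ∀ x y, δ x y = δ y x) {a κ : ℝ} (ha : 0 < a)
    (hla : ∀ e, a ≤ l e) (hκ : 0 ≤ κ) {Over : X → G.Point → Prop}
    (hO : ∀ x y e t t', Over x (e, t) → Over y (e, t') → δ x y ≤ l e * |(t : ℝ) - t'| + κ)
    (c : G.Vertex → X) (hw : ∀ e : G.Edge, Over (c (Sum.inl e.1)) (e, 0))
    (hb : ∀ e : G.Edge, Over (c (Sum.inr (G.glue e).1)) (e, 1)) {x y : X} {p q : G.Point}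
    (hx : Over x p) (hy : Over y q) : δ x y ≤ (1 + κ / a) * graphDist l p q + 2 * κ := by
  classical
  set K := 1 + κ / a with hK
  have hK1 : 1 ≤ K := by have : 0 ≤ κ / a := by positivity
                         linarith
  have hKl : ∀ e, l e + κ ≤ K * l e := by
    intro e
    have : κ ≤ κ / a * l e := by
      rw [div_mul_eq_mul_div, le_div_iff₀ ha]
      exact mul_le_mul_of_nonneg_left (hla e) hκ
    rw [hK]; linarith
  -- The additive error `κ` of a full edge is absorbed into the slope `K`, since edges have length
  -- at least `a`. Only the errors on the two partial edges at the ends remain; one of them is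
  -- subtracted here.
  let φ : G.Vertex → ℝ := fun v => max 0 (δ x (c v) - κ)
  have hφ0 : ∀ v, 0 ≤ φ v := fun v => le_max_left _ _
  have hφ1 : ∀ v, δ x (c v) ≤ φ v + κ := fun v => by linarith [le_max_right 0 (δ x (c v) - κ)]
  have hl0 : ∀ e, 0 < l e := hl
  have hcc : ∀ e : G.Edge, δ (c (Sum.inl e.1)) (c (Sum.inr (G.glue e).1)) ≤ K * l e := by
    intro e
    have := hO _ _ _ _ _ (hw e) (hb e)
    simp only [Set.Icc.coe_zero, Set.Icc.coe_one, zero_sub, abs_neg, abs_one, mul_one] at this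
    linarith [hKl e]
  have hφw : ∀ e : G.Edge, φ (Sum.inl e.1) ≤ φ (Sum.inr (G.glue e).1) + K * l e := by
    intro e
    have h1 := hδ x (c (Sum.inr (G.glue e).1)) (c (Sum.inl e.1))
    rw [hδc (c (Sum.inr (G.glue e).1))] at h1
    have h2 := hcc e
    have h3 := hφ1 (Sum.inr (G.glue e).1)
    have h4 := mul_pos (lt_of_lt_of_le one_pos hK1) (hl0 e)
    exact max_le (by linarith [hφ0 (Sum.inr (G.glue e).1)])
      (by linarith [le_max_right 0 (δ x (c (Sum.inr (G.glue e).1)) - κ)])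
  have hφb : ∀ e : G.Edge, φ (Sum.inr (G.glue e).1) ≤ φ (Sum.inl e.1) + K * l e := by
    intro e
    have h1 := hδ x (c (Sum.inl e.1)) (c (Sum.inr (G.glue e).1))
    have h2 := hcc e
    have h4 := mul_pos (lt_of_lt_of_le one_pos hK1) (hl0 e)
    exact max_le (by linarith [hφ0 (Sum.inl e.1)])
      (by linarith [le_max_right 0 (δ x (c (Sum.inl e.1)) - κ)])
  obtain ⟨e0, t0⟩ := p
  have hφw0 : φ (Sum.inl e0.1) ≤ K * (l e0 * t0) := by
    have h1 := hO _ _ _ _ _ hx (hw e0)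
    simp only [Set.Icc.coe_zero, sub_zero, abs_of_nonneg t0.2.1] at h1
    have h2 := mul_nonneg (hl0 e0).le t0.2.1
    exact max_le (by positivity) (by nlinarith)
  have hφb0 : φ (Sum.inr (G.glue e0).1) ≤ K * (l e0 * (1 - t0)) := by
    have h1 := hO _ _ _ _ _ hx (hb e0)
    rw [Set.Icc.coe_one, abs_sub_comm, abs_of_nonneg (by linarith [t0.2.2])] at h1
    have h2 := mul_nonneg (hl0 e0).le (by linarith [t0.2.2] : 0 ≤ 1 - (t0 : ℝ))
    exact max_le (by positivity) (by nlinarith)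
  let Ψ : G.Point → ℝ := fun q => min (φ (Sum.inl q.1.1) + K * (l q.1 * q.2))
    (φ (Sum.inr (G.glue q.1).1) + K * (l q.1 * (1 - q.2)))
  -- `Ψ` extends `φ` over the edges with slope `K`. On the edge of `p` a competing direct route is
  -- added, so that the function vanishes at `p` and controls points joined to `p` inside that edge.
  let Φ : G.Point → ℝ := fun q =>
    if q.1 = e0 then min (Ψ q) (K * (l e0 * |(q.2 : ℝ) - t0|)) else Ψ q
  have hΨ : ∀ e t t', Ψ (e, t') ≤ Ψ (e, t) + K * (l e * |(t : ℝ) - t'|) := by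
    intro e t t'
    have hKe : 0 ≤ K * l e := mul_nonneg (by linarith) (hl0 e).le
    have h1 := mul_le_mul_of_nonneg_left (neg_abs_le ((t : ℝ) - t')) hKe
    have h2 := mul_le_mul_of_nonneg_left (le_abs_self ((t : ℝ) - t')) hKe
    simp only [Ψ]
    rw [← min_add_add_right]
    exact min_le_min (by nlinarith) (by nlinarith)
  have hΨ0 : ∀ e : G.Edge, Ψ (e, 0) = φ (Sum.inl e.1) := by
    intro e
    simp only [Ψ, Set.Icc.coe_zero, mul_zero, add_zero, sub_zero, mul_one]
    exact min_eq_left (hφw e)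
  have hΨ1 : ∀ e : G.Edge, Ψ (e, 1) = φ (Sum.inr (G.glue e).1) := by
    intro e
    simp only [Ψ, Set.Icc.coe_one, mul_one, sub_self, mul_zero, add_zero]
    exact min_eq_right (hφb e)
  have hΦ0 : ∀ e : G.Edge, Φ (e, 0) = φ (Sum.inl e.1) := by
    intro e
    simp only [Φ]
    split_ifs with h
    · subst h
      rw [hΨ0]
      apply min_eq_left
      simpa [abs_of_nonneg t0.2.1] using hφw0
    · exact hΨ0 e
  have hΦ1 : ∀ e : G.Edge, Φ (e, 1) = φ (Sum.inr (G.glue e).1) := by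
    intro e
    simp only [Φ]
    split_ifs with h
    · subst h
      rw [hΨ1]
      apply min_eq_left
      rwa [Set.Icc.coe_one, abs_of_nonneg (by linarith [t0.2.2])]
    · exact hΨ1 e
  have hΦ : ∀ e t t', Φ (e, t') ≤ Φ (e, t) + K * (l e * |(t : ℝ) - t'|) := by
    intro e t t'
    simp only [Φ]
    split_ifs with h
    · subst h
      rw [← min_add_add_right]
      refine min_le_min (hΨ e t t') ?_
      rw [← mul_add, ← mul_add]
      refine mul_le_mul_of_nonneg_left (mul_le_mul_of_nonneg_left ?_ (hl0 e).le) (by linarith)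
      have := abs_sub_le (t' : ℝ) t t0
      rw [abs_sub_comm (t' : ℝ) t] at this
      linarith
    · exact hΨ e t t'
  have hmain := le_add_graphDist hl (by linarith : 0 ≤ K) hΦ
    (fun e e' h => by rw [hΦ0, hΦ0, h]) (fun e e' h => by rw [hΦ1, hΦ1, h]) (e0, t0) q
  have hstart : Φ (e0, t0) ≤ 0 := by
    simp only [Φ, if_true]
    refine (min_le_right _ _).trans (by simp)
  have hend : δ x y ≤ Φ q + 2 * κ := by
    obtain ⟨e, t⟩ := q
    have hΨe : δ x y ≤ Ψ (e, t) + 2 * κ := by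
      simp only [Ψ]
      rw [← min_add_add_right]
      apply le_min
      · have h1 := hδ x (c (Sum.inl e.1)) y
        have h2 := hO _ _ _ _ _ (hw e) hy
        rw [Set.Icc.coe_zero, zero_sub, abs_neg, abs_of_nonneg t.2.1] at h2
        have h3 := mul_nonneg (hl0 e).le t.2.1
        nlinarith [hφ1 (Sum.inl e.1)]
      · have h1 := hδ x (c (Sum.inr (G.glue e).1)) y
        have h2 := hO _ _ _ _ _ (hb e) hy
        rw [Set.Icc.coe_one, abs_of_nonneg (by linarith [t.2.2])] at h2
        have h3 := mul_nonneg (hl0 e).le (by linarith [t.2.2] : 0 ≤ 1 - (t : ℝ))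
        nlinarith [hφ1 (Sum.inr (G.glue e).1)]
    simp only [Φ]
    split_ifs with h
    · subst h
      rw [← min_add_add_right]
      refine le_min hΨe ?_
      have h1 := hO _ _ _ _ _ hx hy
      rw [abs_sub_comm] at h1
      have h3 := mul_nonneg (hl0 e).le (abs_nonneg ((t : ℝ) - t0))
      nlinarith
    · exact hΨe
  linarith

end Metric

end FatGraph


/-! ### Local geometry of marked surfaces -/

/-- Two points of a right-angled sector are closer than opposite points as seen from its vertex. -/
lemma cosh_dist_le_of_sector {u v : HalfPlane} (h : u.inner v = 0) {c z w : ℍ}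
    (hu : u.val c = 0) (hv : v.val c = 0) (huz : 0 ≤ u.val z) (hvz : 0 ≤ v.val z)
    (huw : 0 ≤ u.val w) (hvw : 0 ≤ v.val w) :
    Real.cosh (dist z w) ≤ Real.cosh (dist c z) * Real.cosh (dist c w) := by
  rw [HalfPlane.val_eq] at hu hv huz hvz huw hvw
  rw [HalfPlane.inner_eq] at h
  set U := u.normal with hU
  set V := v.normal with hV
  set X := pointVec c with hX
  have hUU : mink U U = 1 := u.normal_self
  have hVV : mink V V = 1 := v.normal_self
  have hXX : mink X X = -1 := mink_point_self c
  have hVU : mink V U = 0 := by rw [mink_comm, h]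
  have hXU : mink X U = 0 := by rw [mink_comm, hu]
  have hXV : mink X V = 0 := by rw [mink_comm, hv]
  have key : ∀ y : Mink, y = mink U y • U + mink V y • V + (-mink X y) • X := by
    intro y
    apply Mink.ext_of_mink (x := U) (y := V) (z := X)
    · simp only [gram, hUU, hVV, hXX, h, hu, hv]; norm_num
    · simp [hUU, h, hu]
    · simp [hVV, hVU, hv]
    · simp [hXX, hXU, hXV]
  have h1 : mink (pointVec z) (pointVec w) = mink U (pointVec z) * mink U (pointVec w) +
      mink V (pointVec z) * mink V (pointVec w) - mink X (pointVec z) * mink X (pointVec w) := by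
    conv_lhs => rw [key (pointVec z)]
    simp only [mink_add_left, mink_smul_left]
    ring
  rw [mink_point, hX, mink_point, mink_point] at h1
  have h2 := mul_nonneg huz huw
  have h3 := mul_nonneg hvz hvw
  linarith

/-- In a half-plane, each point is the midpoint of geodesic segments. -/
lemma HalfPlane.exists_opposite (u : HalfPlane) {x : ℍ} (hx : 0 ≤ u.val x) {t : ℝ} (ht : 0 ≤ t) :
    ∃ y z : ℍ, 0 ≤ u.val y ∧ 0 ≤ u.val z ∧ dist y x = t ∧ dist z x = t ∧ dist y z = 2 * t := by
  -- Along the geodesic through `x` in the direction orthogonal to the normal, the value of `u` is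
  -- multiplied by `cosh t`, so both end points stay in the half-plane.
  obtain ⟨n, h1, h2, h3⟩ := exists_cross u.normal (pointVec x)
  set X := pointVec x with hX
  have hXX : mink X X = -1 := mink_point_self x
  rw [u.normal_self, hXX] at h3
  have h4 : 0 < mink n n := by rw [h3]; nlinarith [sq_nonneg (mink u.normal X)]
  set q := Real.sqrt (mink n n) with hq
  have hq0 : 0 < q := Real.sqrt_pos.2 h4
  have hqq : q ^ 2 = mink n n := Real.sq_sqrt h4.le
  set N := q⁻¹ • n with hN
  have hNN : mink N N = 1 := by
    rw [hN, mink_smul_left, mink_smul_right, ← hqq]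
    field_simp
  have hNX : mink N X = 0 := by rw [hN, mink_smul_left, h2, mul_zero]
  have hXN : mink X N = 0 := by rw [mink_comm, hNX]
  have hNu : mink u.normal N = 0 := by rw [hN, mink_smul_right, mink_comm, h1, mul_zero]
  have hpt : ∀ s : ℝ, ∃ y : ℍ, pointVec y = Real.cosh s • X + Real.sinh s • N := by
    intro s
    have hcs := Real.cosh_sq s
    obtain ⟨y, hy | hy⟩ := exists_point_or (x := Real.cosh s • X + Real.sinh s • N) (by
      simp only [mink_add_left, mink_add_right, mink_smul_left, mink_smul_right, hXX, hNN, hXN,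
        hNX]
      linarith)
    · exact ⟨y, hy⟩
    · exfalso
      have e1 := mink_point y x
      rw [hy, ← hX] at e1
      simp only [mink_neg_left, mink_add_left, mink_smul_left, hXX, hNX] at e1
      linarith [Real.one_le_cosh s, Real.one_le_cosh (dist y x)]
  obtain ⟨y, hy⟩ := hpt t
  obtain ⟨z, hz⟩ := hpt (-t)
  rw [Real.cosh_neg, Real.sinh_neg] at hz
  have hval : ∀ w : ℍ, ∀ s : ℝ, pointVec w = Real.cosh t • X + s • N → 0 ≤ u.val w ∧
      dist w x = t := by
    intro w s hw
    constructor
    · rw [HalfPlane.val_eq, hw]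
      simp only [mink_add_right, mink_smul_right, hNu, mul_zero, add_zero]
      rw [hX, ← HalfPlane.val_eq]
      exact mul_nonneg (Real.cosh_pos t).le hx
    · have e1 := mink_point w x
      rw [hw, ← hX] at e1
      simp only [mink_add_left, mink_smul_left, hXX, hNX] at e1
      have := abs_eq_abs_of_cosh_eq (a := dist w x) (b := t) (by linarith)
      rwa [abs_of_nonneg dist_nonneg, abs_of_nonneg ht] at this
  refine ⟨y, z, (hval y _ hy).1, (hval z _ hz).1, (hval y _ hy).2, (hval z _ hz).2, ?_⟩
  have e1 := mink_point y z
  rw [hy, hz] at e1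
  simp only [mink_add_left, mink_add_right, mink_smul_left, mink_smul_right, hXX, hNN, hXN,
        hNX] at e1
  have := abs_eq_abs_of_cosh_eq (a := dist y z) (b := 2 * t) (by rw [Real.cosh_two_mul]; nlinarith)
  rwa [abs_of_nonneg dist_nonneg, abs_of_nonneg (by linarith)] at this

namespace FatGraph

variable {G : FatGraph}

namespace Teich

variable (m : G.Teich)

lemma tile_eq {v v' : G.Vertex} {z z' : ℍ} (hz : z ∈ (m.hex v).region)
    (hz' : z' ∈ (m.hex v').region) (h : m.tile v z = m.tile v' z') :
    (v = v' ∧ z = z') ∨ ∃ i j, G.opp (v, i) = (v', j) ∧ z ∈ (m.hex v).arc i ∧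
      z' ∈ (m.hex v').arc j := by
  obtain n | b := v <;> obtain n' | b' := v'
  · obtain ⟨rfl, h1⟩ := (m.tile_white n n' z hz z' hz').1 h
    exact Or.inl ⟨rfl, h1⟩
  · obtain ⟨i, j, h1, h2, h3, -⟩ := (m.tile_glue n b' z hz z' hz').1 h
    exact Or.inr ⟨i, j, by simp [opp_inl, h1], h2, h3⟩
  · obtain ⟨i, j, h1, h2, h3, -⟩ := (m.tile_glue n' b z' hz' z hz).1 h.symm
    exact Or.inr ⟨j, i, by simp [opp_inr, ← h1], h3, h2⟩
  · obtain ⟨rfl, h1⟩ := (m.tile_black b b' z hz z' hz').1 h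
    exact Or.inl ⟨rfl, h1⟩

lemma tile_injOn (v : G.Vertex) : Set.InjOn (m.tile v) (m.hex v).region := by
  intro z hz z' hz' h
  obtain n | b := v
  · exact ((m.tile_white n n z hz z' hz').1 h).2
  · exact ((m.tile_black b b z hz z' hz').1 h).2

lemma continuousOn_tile (v : G.Vertex) : ContinuousOn (m.tile v) (m.hex v).region := by
  intro z hz
  obtain ⟨r, hr, h⟩ := m.tile_isometry v z hz
  rw [Metric.continuousWithinAt_iff]
  intro ε hε
  refine ⟨min ε r, lt_min hε hr, fun w hw hwz => ?_⟩
  rw [h w ⟨hw, hwz.trans_le (min_le_right _ _)⟩ z ⟨hz, Metric.mem_ball_self hr⟩]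
  exact hwz.trans_le (min_le_left _ _)

/-- Near a point of the surface, the distance to the point is the distance in the hexagons. -/
lemma exists_local (x : m.Carrier) : ∃ r > 0, ∀ v, ∀ w ∈ (m.hex v).region,
    dist (m.tile v w) x < r → ∃ z ∈ (m.hex v).region, m.tile v z = x ∧ dist w z = dist (m.tile v w) x ∧
      ∀ w' ∈ (m.hex v).region, dist (m.tile v w') x < r →
        dist (m.tile v w) (m.tile v w') = dist w w' := by
  have key : ∀ v, ∃ r > 0, ∀ w ∈ (m.hex v).region,
    dist (m.tile v w) x < r → ∃ z ∈ (m.hex v).region, m.tile v z = x ∧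
      dist w z = dist (m.tile v w) x ∧
      ∀ w' ∈ (m.hex v).region, dist (m.tile v w') x < r →
        dist (m.tile v w) (m.tile v w') = dist w w' := by
    intro v
    -- The image of a compact piece that misses `x` stays at positive distance from `x`. So the
    -- points of a hexagon mapped near `x` are near its preimage, where the tile is isometric.
    have hsep : ∀ K ⊆ (m.hex v).region, IsCompact K → x ∉ m.tile v '' K →
        ∃ r > 0, ∀ w ∈ K, ¬ dist (m.tile v w) x < r := by
      intro K hK hKc hxK
      have h1 : IsClosed (m.tile v '' K) :=
        (hKc.image_of_continuousOn ((m.continuousOn_tile v).mono hK)).isClosed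
      obtain ⟨r, hr, h2⟩ := Metric.isOpen_iff.1 h1.isOpen_compl x hxK
      exact ⟨r, hr, fun w hw h3 => h2 h3 ⟨w, hw, rfl⟩⟩
    by_cases hx : x ∈ m.tile v '' (m.hex v).region
    · obtain ⟨z, hz, rfl⟩ := hx
      obtain ⟨r0, hr0, h0⟩ := m.tile_isometry v z hz
      obtain ⟨r, hr, h1⟩ := hsep ((m.hex v).region \ Metric.ball z r0) Set.sdiff_subset
        ((m.hex v).isCompact_region.diff Metric.isOpen_ball) (by
          rintro ⟨w, hw, h⟩
          rw [m.tile_injOn v hw.1 hz h] at hw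
          exact hw.2 (Metric.mem_ball_self hr0))
      have h2 : ∀ w ∈ (m.hex v).region, dist (m.tile v w) (m.tile v z) < r →
          w ∈ (m.hex v).region ∩ Metric.ball z r0 := fun w hw hwr =>
        ⟨hw, by by_contra h; exact h1 w ⟨hw, h⟩ hwr⟩
      refine ⟨r, hr, fun w hw hwr => ⟨z, hz, rfl, ?_, fun w' hw' hwr' => ?_⟩⟩
      · exact (h0 w (h2 w hw hwr) z ⟨hz, Metric.mem_ball_self hr0⟩).symm
      · exact h0 w (h2 w hw hwr) w' (h2 w' hw' hwr')
    · obtain ⟨r, hr, h⟩ := hsep _ subset_rfl (m.hex v).isCompact_region hx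
      exact ⟨r, hr, fun w hw hwr => absurd hwr (h w hw)⟩
  choose r hr h using key
  have := G.nonempty_vertex
  obtain ⟨v0, h0⟩ := Finite.exists_min r
  refine ⟨r v0, hr v0, fun v w hw hwr => ?_⟩
  obtain ⟨z, hz, h1, h2, h3⟩ := h v w hw (hwr.trans_le (h0 v))
  exact ⟨z, hz, h1, h2, fun w' hw' hwr' => h3 w' hw' (hwr'.trans_le (h0 v))⟩

/-- The axioms of a marked surface do not exclude empty hexagons directly. But if the neighbour
across an arc were empty, a corner on that arc would have a neighbourhood contained in a
right-angled sector, whereas in the local model every point is the midpoint of short geodesic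
segments. -/
lemma region_nonempty (v : G.Vertex) : (m.hex v).region.Nonempty := by
  have hne := m.hyperbolic.connected.toNonempty
  obtain ⟨x⟩ := hne
  obtain ⟨v0, z0, hz0, -⟩ := m.cover x
  have h := G.reflTransGen_opp v0 v
  induction h with
  | refl => exact ⟨z0, hz0⟩
  | tail _ h ih =>
    obtain ⟨i, rfl⟩ := h
    rename_i v' _
    by_contra hemp
    rw [Set.not_nonempty_iff_eq_empty] at hemp
    set c := (m.hex v').corner (i + 1) i with hc
    have hji : i + 1 ≠ i := by simp
    have hca : c ∈ (m.hex v').arc i := (m.hex v').corner_mem_arc ih hji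
    obtain ⟨hc1, hc2⟩ := (m.hex v').corner_mem (i + 1) i hji
    have honly : ∀ w z, z ∈ (m.hex w).region → m.tile w z = m.tile v' c → w = v' ∧ z = c := by
      intro w z hz hzc
      rcases m.tile_eq hca.1 hz hzc.symm with ⟨h1, h2⟩ | ⟨i', j, h1, h2, h3⟩
      · exact ⟨h1.symm, h2.symm⟩
      · obtain rfl := (m.hex v').arc_disjoint hca h2
        rw [h1] at hemp
        exact absurd hz (by rw [hemp]; exact Set.notMem_empty z)
    obtain ⟨r, hr, hloc⟩ := m.exists_local (m.tile v' c)
    obtain ⟨r', hr', u, φ, hφ, hφi⟩ := m.hyperbolic.local_model (m.tile v' c)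
    set t := min r r' / 2 with ht
    have hrr : 0 < min r r' := lt_min hr hr'
    have ht0 : 0 < t := by positivity
    have htr : t < r := by linarith [min_le_left r r']
    have htr' : t < r' := by linarith [min_le_right r r']
    have hself : m.tile v' c ∈ Metric.ball (m.tile v' c) r' := Metric.mem_ball_self hr'
    have hux : φ (m.tile v' c) ∈ u.carrier := by
      have : φ (m.tile v' c) ∈ φ '' Metric.ball (m.tile v' c) r' := ⟨_, hself, rfl⟩
      rw [hφi] at this
      exact this.2
    obtain ⟨y, z, hy, hz, hyx, hzx, hyz⟩ := u.exists_opposite hux ht0.le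
    have hpre : ∀ y : ℍ, 0 ≤ u.val y → dist y (φ (m.tile v' c)) = t → ∃ w ∈ (m.hex v').region,
        m.tile v' w ∈ Metric.ball (m.tile v' c) r' ∧ φ (m.tile v' w) = y ∧
          dist (m.tile v' w) (m.tile v' c) = t ∧ dist w c = t := by
      intro y hy hyx
      have hmem : y ∈ φ '' Metric.ball (m.tile v' c) r' := by
        rw [hφi]
        exact ⟨by rw [Metric.mem_ball, hyx]; exact htr', hy⟩
      obtain ⟨p, hp, hpy⟩ := hmem
      have hpd : dist p (m.tile v' c) = t := by rw [← hφ p hp _ hself, hpy, hyx]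
      obtain ⟨w, z, hz, rfl⟩ := m.cover p
      obtain ⟨z', hz', h1, h2, h3⟩ := hloc w z hz (by rw [hpd]; exact htr)
      obtain ⟨rfl, rfl⟩ := honly w z' hz' h1
      exact ⟨z, hz, hp, hpy, hpd, by rw [h2, hpd]⟩
    obtain ⟨w, hw, hwb, hwy, hwd, hwc⟩ := hpre y hy hyx
    obtain ⟨w', hw', hwb', hwy', hwd', hwc'⟩ := hpre z hz hzx
    obtain ⟨-, -, -, -, h3⟩ := hloc v' w hw (by rw [hwd]; exact htr)
    have h4 := h3 w' hw' (by rw [hwd']; exact htr)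
    rw [← hφ _ hwb _ hwb', hwy, hwy', hyz] at h4
    -- In the sector the two opposite points would satisfy `cosh (2t) ≤ cosh² t`, which is false for
    -- `t > 0`.
    have h5 := cosh_dist_le_of_sector ((m.hex v').adjacent (i + 1) i hji) hc1 hc2 (hw (i + 1)).1
      (hw i).2 (hw' (i + 1)).1 (hw' i).2
    rw [← h4, dist_comm c w, dist_comm c w', hwc, hwc', Real.cosh_two_mul] at h5
    have h6 : 0 < Real.sinh t := Real.sinh_pos_iff.2 ht0
    nlinarith

/-- The hexagons are mapped to the surface without increasing distances. -/
lemma dist_tile_le (v : G.Vertex) {z w : ℍ} (hz : z ∈ (m.hex v).region)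
    (hw : w ∈ (m.hex v).region) : dist (m.tile v z) (m.tile v w) ≤ dist z w := by
  obtain ⟨γ, h0, h1, h2, h3⟩ := exists_geodesic z w
  have hγ : ∀ t ∈ Set.Icc (0 : ℝ) 1, γ t ∈ (m.hex v).region := by
    intro t ht
    obtain ⟨a, b, ha, hb, h⟩ := h3 t ht
    exact (m.hex v).mem_region_of_combination hz hw ha hb h
  have := le_of_locally_le (D := fun s t => dist (m.tile v (γ s)) (m.tile v (γ t)))
    (V := fun t => t * dist z w) (fun a b c => dist_triangle _ _ _) (by simp) (by
      intro t ht
      obtain ⟨r, hr, h⟩ := m.tile_isometry v (γ t) (hγ t ht)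
      refine ⟨r / (dist z w + 1), by positivity, fun t' ht' htt => ?_⟩
      have hd : dist (γ t') (γ t) < r := by
        rw [h2 t' ht' t ht]
        rw [lt_div_iff₀ (by positivity)] at htt
        nlinarith [abs_nonneg (t' - t), dist_nonneg (x := z) (y := w)]
      have e1 := h (γ t') ⟨hγ t' ht', hd⟩ (γ t) ⟨hγ t ht, Metric.mem_ball_self hr⟩
      rw [h2 t' ht' t ht] at e1
      constructor
      · intro htt'
        rw [dist_comm, e1, abs_of_nonneg (by linarith), sub_mul]
      · intro htt'
        rw [e1, abs_of_nonpos (by linarith)]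
        linarith)
  simpa [h0, h1] using this

end Teich

end FatGraph


/-! ### Long hexagons are close to tripods -/

lemma exp_div_four_le_sinh {x : ℝ} (hx : 1 ≤ x) : Real.exp x / 4 ≤ Real.sinh x := by
  rw [Real.sinh_eq]
  have h1 : (2 : ℝ) ≤ Real.exp x := by linarith [Real.add_one_le_exp x]
  have h2 : Real.exp (-x) ≤ 1 := Real.exp_le_one_iff.2 (by linarith)
  linarith

lemma cosh_le_exp {x : ℝ} (hx : 0 ≤ x) : Real.cosh x ≤ Real.exp x := by
  rw [Real.cosh_eq]
  have := Real.exp_le_exp.2 (show -x ≤ x by linarith)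
  linarith

lemma exp_div_two_le_cosh (x : ℝ) : Real.exp x / 2 ≤ Real.cosh x := by
  rw [Real.cosh_eq]
  linarith [Real.exp_pos (-x)]

/-- Numerical factors are moved into the exponent, where they become bounded additive errors in
lengths. -/
lemma two_pow_mul_exp_le (n : ℕ) (x : ℝ) : 2 ^ n * Real.exp x ≤ Real.exp (x + n) := by
  rw [Real.exp_add, mul_comm, ← Real.exp_one_pow]
  have : (2 : ℝ) ≤ Real.exp 1 := by linarith [Real.add_one_le_exp (1 : ℝ)]
  gcongr

lemma div_le_four_mul_exp {x r A B C : ℝ} (hx : x ≤ Real.exp A) (hr : Real.exp B / 4 ≤ r)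
    (hC : A - B ≤ C) : x / r ≤ 4 * Real.exp C := by
  have hr0 : 0 < r := lt_of_lt_of_le (by positivity) hr
  rw [div_le_iff₀ hr0]
  have h1 : Real.exp A ≤ Real.exp (C + B) := Real.exp_le_exp.2 (by linarith)
  rw [Real.exp_add] at h1
  nlinarith [Real.exp_pos C]

namespace RightAngledHexagon

/-- A right-angled hexagon which is close to a tripod with long legs of lengths `Λ i`. -/
structure IsLong (P : RightAngledHexagon) (Λ : Fin 3 → ℝ) : Prop where
  nonempty : P.region.Nonempty
  long : ∀ i, 100 ≤ Λ i
  bLength_le : ∀ i, P.bLength i ≤ Λ (i + 1) + Λ (i + 2) + 4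
  le_bLength : ∀ i, Λ (i + 1) + Λ (i + 2) - 4 ≤ P.bLength i
  cosh_aLength_le : ∀ i, Real.cosh (P.aLength i) - 1 ≤ 32 * Real.exp (-(2 * Λ i))

/-- The distance to the side `aᵢ`. -/
def depth (P : RightAngledHexagon) (i : Fin 3) (z : ℍ) : ℝ := Real.arsinh ((P.aSide i).val z)

lemma depth_nonneg {P : RightAngledHexagon} {z : ℍ} (hz : z ∈ P.region) (i : Fin 3) :
    0 ≤ P.depth i z := Real.arsinh_nonneg_iff.2 (hz i).2

lemma depth_sub_le (P : RightAngledHexagon) (i : Fin 3) (z w : ℍ) :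
    P.depth i z - P.depth i w ≤ dist z w :=
  (le_abs_self _).trans ((P.aSide i).arsinh_val_sub_le z w)

lemma sinh_depth (P : RightAngledHexagon) (i : Fin 3) (z : ℍ) :
    Real.sinh (P.depth i z) = (P.aSide i).val z := Real.sinh_arsinh _

lemma depth_eq_zero {P : RightAngledHexagon} {i : Fin 3} {z : ℍ} (hz : z ∈ P.arc i) :
    P.depth i z = 0 := by rw [depth, hz.2, Real.arsinh_zero]

lemma continuous_depth (P : RightAngledHexagon) (i : Fin 3) : Continuous (P.depth i) :=
  Real.continuous_arsinh.comp (P.aSide i).continuous_val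

lemma bLength_le_depth_add {P : RightAngledHexagon} {z : ℍ} (hz : z ∈ P.region) (i : Fin 3) :
    P.bLength i ≤ P.depth (i + 1) z + P.depth (i + 2) z :=
  HalfPlane.le_arsinh_add (P.bLength_pos i).le (P.inner_aSide i) (hz _).2 (hz _).2

namespace IsLong

variable {P : RightAngledHexagon} {Λ : Fin 3 → ℝ} (h : P.IsLong Λ)
include h

/-- Two depths add up to at least the length of the side joining the two arcs, which is at least `Λ
i + Λ j - 4`. With the threshold `Λ i - 4` for the leg `i`, the legs are disjoint. -/
lemma lt_depth_add {z : ℍ} (hz : z ∈ P.region) {i j : Fin 3} (hij : i ≠ j) :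
    (Λ i - 4) + (Λ j - 4) < P.depth i z + P.depth j z := by
  have key : ∀ i, (Λ (i + 1) - 4) + (Λ (i + 2) - 4) < P.depth (i + 1) z + P.depth (i + 2) z :=
    fun i => by linarith [h.le_bLength i, bLength_le_depth_add hz i]
  obtain ⟨e1, e2, e3, e4⟩ := Fin3.add i
  rcases Fin3.cases i j with rfl | rfl | rfl
  · exact absurd rfl hij
  · have := key (i + 2)
    rwa [e3, e4] at this
  · have := key (i + 1)
    rw [e1, e2] at this
    linarith


/-- On the central part of the hexagon, the distances to the sides `aᵢ` are about `Λ i`. -/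
lemma depth_le_of_core {z : ℍ} (hz : z ∈ P.region) (hc : ∀ i, Λ i - 4 ≤ P.depth i z) (k : Fin 3) :
    P.depth k z ≤ Λ k + 18 := by
  obtain ⟨i, rfl⟩ : ∃ i, i + 2 = k := ⟨k + 1, (Fin3.add k).2.1⟩
  obtain ⟨e1, e2, e3, e4⟩ := Fin3.add i
  set r := Real.sinh (Λ i - 4) with hr
  set r' := Real.sinh (Λ (i + 1) - 4) with hr'
  have l0 := h.long i
  have l1 := h.long (i + 1)
  have l2 := h.long (i + 2)
  have hr4 : Real.exp (Λ i - 4) / 4 ≤ r := exp_div_four_le_sinh (by linarith)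
  have hr4' : Real.exp (Λ (i + 1) - 4) / 4 ≤ r' := exp_div_four_le_sinh (by linarith)
  have hr0 : 0 < r := lt_of_lt_of_le (by positivity) hr4
  have hr0' : 0 < r' := lt_of_lt_of_le (by positivity) hr4'
  have hv : r ≤ (P.aSide i).val z := by
    rw [← P.sinh_depth]; exact Real.sinh_le_sinh.2 (hc i)
  have hv' : r' ≤ (P.aSide (i + 1)).val z := by
    rw [← P.sinh_depth]; exact Real.sinh_le_sinh.2 (hc (i + 1))
  have key := P.cosh_mul_val_le hz hr0 hr0' hv hv'
  rw [cof, e4, e3, ← P.sinh_depth (i + 2)] at key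
  have b0 := h.bLength_le i
  have b1 := h.bLength_le (i + 1)
  have b2 := h.bLength_le (i + 2)
  have b1' := h.le_bLength (i + 1)
  rw [e1, e2] at b1 b1'
  rw [e4, e3] at b2
  have c0 := (cosh_le_exp (P.bLength_pos i).le).trans (Real.exp_le_exp.2 b0)
  have c1 := (cosh_le_exp (P.bLength_pos (i + 1)).le).trans (Real.exp_le_exp.2 b1)
  have c2 := (cosh_le_exp (P.bLength_pos (i + 2)).le).trans (Real.exp_le_exp.2 b2)
  have c1' := (div_le_div_of_nonneg_right (Real.exp_le_exp.2 b1') zero_le_two).trans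
    (exp_div_two_le_cosh _)
  set C0 := Real.cosh (P.bLength i)
  set C1 := Real.cosh (P.bLength (i + 1)) with hC1
  set C2 := Real.cosh (P.bLength (i + 2))
  have hC1p : 0 < C1 := Real.cosh_pos _
  have hs : Real.sinh (P.bLength (i + 1)) ^ 2 ≤ C1 ^ 2 := by
    rw [hC1, Real.cosh_sq]; linarith
  have h1 : C1 / r ≤ 4 * Real.exp (Λ (i + 2) + 12) := div_le_four_mul_exp c1 hr4 (by linarith)
  have h2 : C0 / r' ≤ 4 * Real.exp (Λ (i + 2) + 12) := div_le_four_mul_exp c0 hr4' (by linarith)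
  have h3 : C2 / C1 ≤ 4 * Real.exp (Λ (i + 1) - Λ (i + 2) + 8) :=
    div_le_four_mul_exp (B := Λ (i + 2) + Λ i - 4) c2
      (by linarith [Real.exp_pos (Λ (i + 2) + Λ i - 4)]) (by linarith)
  have h4 : C2 / C1 / r' ≤ 16 * Real.exp (Λ (i + 2) + 12) / 2 := by
    have e5 := two_pow_mul_exp_le 2 (Λ (i + 1) - Λ (i + 2) + 8)
    have e6 := div_le_four_mul_exp (C := Λ (i + 2) + 12)
      (h3.trans (by norm_num at e5 ⊢; exact e5)) hr4' (by linarith)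
    linarith [Real.exp_pos (Λ (i + 2) + 12)]
  -- The three terms of the bound, divided by the coefficient `C1`, contribute 4, 4 and 8. Passing
  -- from `sinh` to `exp` costs another 4, and `64 = 2 ^ 6` turns 12 into 18.
  have h5 : Real.sinh (P.depth (i + 2) z) ≤ 16 * Real.exp (Λ (i + 2) + 12) := by
    have e5 : C1 * Real.sinh (P.depth (i + 2) z) ≤ C1 * (C1 / r + C0 / r' + C2 / C1 / r') := by
      have e6 : C1 * (C1 / r + C0 / r' + C2 / C1 / r') = C1 ^ 2 / r + (C2 + C0 * C1) / r' := by
        field_simp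
        ring
      have e7 := div_le_div_of_nonneg_right hs hr0.le
      linarith
    linarith [le_of_mul_le_mul_left e5 hC1p]
  rcases le_total (P.depth (i + 2) z) 1 with h6 | h6
  · linarith
  · have h7 := exp_div_four_le_sinh h6
    have h8 := two_pow_mul_exp_le 6 (Λ (i + 2) + 12)
    norm_num at h8
    have h9 : Real.exp (P.depth (i + 2) z) ≤ Real.exp (Λ (i + 2) + 12 + 6) := by linarith
    linarith [Real.exp_le_exp.1 h9]

/-- The legs are thin. -/
lemma dist_le_depth_sub {z w : ℍ} (hz : z ∈ P.region) (hw : w ∈ P.region) {i : Fin 3}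
    (hzi : P.depth i z ≤ Λ i + 18) (hwi : P.depth i w ≤ Λ i + 18) :
    dist z w ≤ |P.depth i z - P.depth i w| + 43 := by
  wlog hle : P.depth i w ≤ P.depth i z generalizing z w
  · rw [dist_comm, abs_sub_comm]
    exact this hw hz hwi hzi (le_of_not_ge hle)
  have h0 := depth_nonneg hz i
  have h0' := depth_nonneg hw i
  have h1 := P.cosh_dist_le i hz hw
  change _ ≤ Real.cosh (P.depth i z - P.depth i w) + (Real.cosh (P.aLength i) - 1) *
    (Real.cosh (P.depth i z) * Real.cosh (P.depth i w)) at h1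
  set ρ := P.depth i z
  set ρ' := P.depth i w
  have h2 : Real.cosh ρ * Real.cosh ρ' ≤ Real.exp ρ * Real.exp ρ' :=
    mul_le_mul (cosh_le_exp h0) (cosh_le_exp h0') (Real.cosh_pos _).le (Real.exp_pos _).le
  have h3 : (Real.cosh (P.aLength i) - 1) * (Real.cosh ρ * Real.cosh ρ') ≤
      32 * Real.exp (-(2 * Λ i)) * (Real.exp ρ * Real.exp ρ') :=
    mul_le_mul (h.cosh_aLength_le i) h2 (by positivity) (by positivity)
  -- The smaller depth is at most `Λ i + 18`, so the widening of the leg is still comparable to the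
  -- main term `exp (ρ - ρ')`. The total factor 66 is below `2 ^ 7`, whence `36 + 7 = 43`.
  have h4 : Real.exp (-(2 * Λ i)) * (Real.exp ρ * Real.exp ρ') ≤ Real.exp (ρ - ρ' + 36) := by
    rw [← Real.exp_add, ← Real.exp_add]
    exact Real.exp_le_exp.2 (by linarith)
  have h5 : Real.cosh (ρ - ρ') ≤ Real.exp (ρ - ρ' + 36) :=
    (cosh_le_exp (by linarith)).trans (Real.exp_le_exp.2 (by linarith))
  have h6 := two_pow_mul_exp_le 7 (ρ - ρ' + 36)
  have h7 := exp_div_two_le_cosh (dist z w)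
  norm_num at h6
  have h8 : Real.exp (dist z w) ≤ Real.exp (ρ - ρ' + 36 + 7) := by
    nlinarith [Real.exp_pos (ρ - ρ' + 36)]
  have h9 := Real.exp_le_exp.1 h8
  rw [abs_of_nonneg (by linarith)]
  linarith

/-- Along a geodesic of the hexagon from a corner on `aᵢ` to a corner on another arc, the depth
rises continuously from `0` past `Λ i - 4`. -/
lemma exists_depth_eq (i : Fin 3) {ρ : ℝ} (h0 : 0 ≤ ρ) (hρ : ρ ≤ Λ i - 4) :
    ∃ z ∈ P.region, P.depth i z = ρ := by
  have h1 := P.corner_mem_arc h.nonempty (show i + 1 ≠ i by simp)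
  have h2 := P.corner_mem_arc h.nonempty (show i ≠ i + 1 by simp)
  obtain ⟨γ, g0, g1, g2, g3⟩ := exists_geodesic (P.corner (i + 1) i) (P.corner i (i + 1))
  have hγ : ContinuousOn γ (Set.Icc 0 1) := by
    refine LipschitzOnWith.continuousOn
      (K := ⟨dist (P.corner (i + 1) i) (P.corner i (i + 1)), dist_nonneg⟩) ?_
    refine LipschitzOnWith.of_dist_le_mul fun s hs t ht => ?_
    rw [g2 s hs t ht, Real.dist_eq, mul_comm]
    rfl
  have hd : P.depth i (γ 1) ≥ Λ i - 4 := by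
    have := h.lt_depth_add h2.1 (show i ≠ i + 1 by simp)
    rw [depth_eq_zero h2] at this
    rw [g1]
    linarith [h.long (i + 1)]
  have hiv := intermediate_value_Icc zero_le_one ((P.continuous_depth i).comp_continuousOn hγ)
  obtain ⟨t, ht, hte⟩ := hiv (show ρ ∈ Set.Icc _ _ from ⟨by
    show P.depth i (γ 0) ≤ ρ
    rwa [g0, depth_eq_zero h1], hρ.trans hd⟩)
  obtain ⟨a, b, ha, hb, hab⟩ := g3 t ht
  exact ⟨γ t, P.mem_region_of_combination h1.1 h2.1 ha hb hab, hte⟩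

/-- A point exactly at the inner end of one leg cannot be on another, because `lt_depth_add` is
strict. -/
lemma exists_core : ∃ z ∈ P.region, ∀ i, Λ i - 4 ≤ P.depth i z := by
  obtain ⟨z, hz, h0⟩ := h.exists_depth_eq 0 (by linarith [h.long 0]) le_rfl
  refine ⟨z, hz, fun i => ?_⟩
  rcases eq_or_ne 0 i with rfl | hi
  · exact h0.ge
  · linarith [h.lt_depth_add hz hi]

end IsLong

/-- The position of a point on the leg which ends at the side `aᵢ`; it is `0` on `aᵢ` and `1` on the
central part of the hexagon. -/
def pos (P : RightAngledHexagon) (Λ : Fin 3 → ℝ) (i : Fin 3) (z : ℍ) : ℝ :=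
  min (P.depth i z / (Λ i - 4)) 1

open Classical in
/-- The leg which contains a given point (any leg, for points of the central part). -/
def leg (P : RightAngledHexagon) (Λ : Fin 3 → ℝ) (z : ℍ) : Fin 3 :=
  if h : ∃ i, P.depth i z < Λ i - 4 then h.choose else 0

namespace IsLong

variable {P : RightAngledHexagon} {Λ : Fin 3 → ℝ} (h : P.IsLong Λ)
include h

lemma leg_eq {z : ℍ} (hz : z ∈ P.region) {i : Fin 3} (hi : P.depth i z < Λ i - 4) :
    P.leg Λ z = i := by
  have hex : ∃ i, P.depth i z < Λ i - 4 := ⟨i, hi⟩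
  rw [leg, dif_pos hex]
  by_contra hne
  linarith [h.lt_depth_add hz hne, hex.choose_spec]

lemma depth_leg_le {z : ℍ} (hz : z ∈ P.region) :
    P.depth (P.leg Λ z) z ≤ Λ (P.leg Λ z) + 18 := by
  by_cases hex : ∃ i, P.depth i z < Λ i - 4
  · obtain ⟨i, hi⟩ := hex
    rw [h.leg_eq hz hi]
    linarith
  · push Not at hex
    exact h.depth_le_of_core hz hex _

lemma le_depth_of_leg_ne {z : ℍ} (hz : z ∈ P.region) {i : Fin 3} (hi : P.leg Λ z ≠ i) :
    Λ i - 4 ≤ P.depth i z := by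
  by_contra hlt
  exact hi (h.leg_eq hz (not_le.1 hlt))

lemma pos_nonneg {z : ℍ} (hz : z ∈ P.region) (i : Fin 3) : 0 ≤ P.pos Λ i z :=
  le_min (div_nonneg (depth_nonneg hz i) (by linarith [h.long i])) zero_le_one

omit h in
lemma pos_le_one (i : Fin 3) (z : ℍ) : P.pos Λ i z ≤ 1 := min_le_right _ _

lemma pos_eq_one {z : ℍ} {i : Fin 3} (hi : Λ i - 4 ≤ P.depth i z) : P.pos Λ i z = 1 := by
  apply min_eq_right
  rw [le_div_iff₀ (by linarith [h.long i])]
  linarith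

lemma mul_pos_of_le {z : ℍ} {i : Fin 3} (hi : P.depth i z ≤ Λ i - 4) :
    (Λ i - 4) * P.pos Λ i z = P.depth i z := by
  have hr : 0 < Λ i - 4 := by linarith [h.long i]
  rw [pos, min_eq_left ((div_le_one hr).2 hi)]
  field_simp

lemma abs_depth_sub_le {z : ℍ} (hz : z ∈ P.region) {i : Fin 3} (hi : P.depth i z ≤ Λ i + 18) :
    |P.depth i z - Λ i * P.pos Λ i z| ≤ 18 := by
  have h0 := h.pos_nonneg hz i
  have h1 := pos_le_one (P := P) (Λ := Λ) i z
  rcases le_total (P.depth i z) (Λ i - 4) with h2 | h2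
  · have := h.mul_pos_of_le h2
    rw [abs_le]
    constructor <;> linarith
  · rw [h.pos_eq_one h2, abs_le]
    constructor <;> linarith

lemma dist_le_pos_sub {z w : ℍ} (hz : z ∈ P.region) (hw : w ∈ P.region) {i : Fin 3}
    (hzi : P.depth i z ≤ Λ i + 18) (hwi : P.depth i w ≤ Λ i + 18) :
    dist z w ≤ Λ i * |P.pos Λ i z - P.pos Λ i w| + 80 := by
  have h1 := h.dist_le_depth_sub hz hw hzi hwi
  have h2 := h.abs_depth_sub_le hz hzi
  have h3 := h.abs_depth_sub_le hw hwi
  have h4 : Λ i * |P.pos Λ i z - P.pos Λ i w| = |Λ i * P.pos Λ i z - Λ i * P.pos Λ i w| := by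
    rw [← mul_sub, abs_mul, abs_of_nonneg (show 0 ≤ Λ i by linarith [h.long i])]
  have h5 : |P.depth i z - P.depth i w| ≤ |Λ i * P.pos Λ i z - Λ i * P.pos Λ i w| + 36 := by
    have := abs_add_three (P.depth i z - Λ i * P.pos Λ i z)
      (Λ i * P.pos Λ i z - Λ i * P.pos Λ i w) (-(P.depth i w - Λ i * P.pos Λ i w))
    rw [abs_neg] at this
    have e : P.depth i z - Λ i * P.pos Λ i z + (Λ i * P.pos Λ i z - Λ i * P.pos Λ i w) +
      -(P.depth i w - Λ i * P.pos Λ i w) = P.depth i z - P.depth i w := by ring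
    rw [e] at this
    linarith
  linarith

lemma mul_one_sub_pos (z : ℍ) (i : Fin 3) :
    (Λ i - 4) * (1 - P.pos Λ i z) = max (Λ i - 4 - P.depth i z) 0 := by
  rcases le_total (P.depth i z) (Λ i - 4) with h2 | h2
  · rw [mul_sub, h.mul_pos_of_le h2, max_eq_left (by linarith), mul_one]
  · rw [h.pos_eq_one h2, max_eq_right (by linarith), sub_self, mul_zero]

lemma abs_pos_sub_le {K : ℝ} {i : Fin 3} (hK : Λ i ≤ K * (Λ i - 4)) (z w : ℍ) :
    Λ i * |P.pos Λ i z - P.pos Λ i w| ≤ K * dist z w := by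
  have hr : 0 < Λ i - 4 := by linarith [h.long i]
  have h1 : (Λ i - 4) * |P.pos Λ i z - P.pos Λ i w| ≤ dist z w := by
    calc (Λ i - 4) * |P.pos Λ i z - P.pos Λ i w| =
        |(Λ i - 4) * (1 - P.pos Λ i w) - (Λ i - 4) * (1 - P.pos Λ i z)| := by
          rw [← mul_sub, abs_mul, abs_of_pos hr]; congr 2; ring
      _ ≤ |(Λ i - 4 - P.depth i w) - (Λ i - 4 - P.depth i z)| := by
          rw [h.mul_one_sub_pos, h.mul_one_sub_pos]
          exact abs_max_sub_max_le_abs _ _ _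
      _ = |P.depth i z - P.depth i w| := by congr 1; ring
      _ ≤ dist z w := (P.aSide i).arsinh_val_sub_le z w
  have hK0 : 0 ≤ K := by
    by_contra hneg
    nlinarith [h.long i]
  calc Λ i * |P.pos Λ i z - P.pos Λ i w| ≤
      K * (Λ i - 4) * |P.pos Λ i z - P.pos Λ i w| := by gcongr
    _ ≤ K * dist z w := by rw [mul_assoc]; gcongr

/-- To pass between different legs one must first leave the leg of `z`. Depths are 1-Lipschitz, and
`lt_depth_add` shows that the two remaining leg lengths add up rather than overlap. -/
lemma pos_add_le {K : ℝ} {z w : ℍ} (hz : z ∈ P.region) (hw : w ∈ P.region)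
    (hne : P.leg Λ z ≠ P.leg Λ w) (hK : ∀ i, Λ i ≤ K * (Λ i - 4)) :
    Λ (P.leg Λ z) * (1 - P.pos Λ (P.leg Λ z) z) + Λ (P.leg Λ w) * (1 - P.pos Λ (P.leg Λ w) w) ≤
      K * dist z w := by
  set i := P.leg Λ z with hi
  set j := P.leg Λ w with hj
  have h1 := h.mul_one_sub_pos z i
  have h2 := h.mul_one_sub_pos w j
  have h3 := P.depth_sub_le i w z
  have h4 := P.depth_sub_le j z w
  rw [dist_comm] at h3
  have h5 := h.le_depth_of_leg_ne hz (i := j) hne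
  have h6 := h.le_depth_of_leg_ne hw (i := i) hne.symm
  have h7 := h.lt_depth_add hw hne
  have h8 : max (Λ i - 4 - P.depth i z) 0 + max (Λ j - 4 - P.depth j w) 0 ≤ dist z w := by
    have := dist_nonneg (x := z) (y := w)
    rcases max_cases (Λ i - 4 - P.depth i z) 0 with ⟨e1, e2⟩ | ⟨e1, e2⟩ <;>
    rcases max_cases (Λ j - 4 - P.depth j w) 0 with ⟨e3, e4⟩ | ⟨e3, e4⟩ <;>
    · rw [e1, e3]; linarith
  have hK0 : 0 ≤ K := by
    by_contra hneg
    nlinarith [h.long i, hK i]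
  have p1 := pos_le_one (P := P) (Λ := Λ) i z
  have p2 := pos_le_one (P := P) (Λ := Λ) j w
  have h9 : Λ i * (1 - P.pos Λ i z) ≤ K * (Λ i - 4) * (1 - P.pos Λ i z) :=
    mul_le_mul_of_nonneg_right (hK i) (by linarith)
  have h10 : Λ j * (1 - P.pos Λ j w) ≤ K * (Λ j - 4) * (1 - P.pos Λ j w) :=
    mul_le_mul_of_nonneg_right (hK j) (by linarith)
  rw [mul_assoc, h1] at h9
  rw [mul_assoc, h2] at h10
  nlinarith

end IsLong

/-- By the law of cosines `cosh aᵢ - 1` is `cosh bᵢ + cosh (bᵢ₊₁ - bᵢ₊₂)` divided by `sinh bᵢ₊₁ sinh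
bᵢ₊₂`. This is comparable to `exp (bᵢ - bᵢ₊₁ - bᵢ₊₂) = exp (-2 Λᵢ)`. -/
lemma isLong_of_bLength {P : RightAngledHexagon} {Λ : Fin 3 → ℝ} (hP : P.region.Nonempty)
    (hΛ : ∀ i, 100 ≤ Λ i) (hb : ∀ i, P.bLength i = Λ (i + 1) + Λ (i + 2)) :
    P.IsLong Λ ∧ ∀ i, 2 * Real.exp (-(2 * Λ i)) ≤ Real.cosh (P.aLength i) - 1 := by
  have key : ∀ i, 2 * Real.exp (-(2 * Λ i)) ≤ Real.cosh (P.aLength i) - 1 ∧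
      Real.cosh (P.aLength i) - 1 ≤ 32 * Real.exp (-(2 * Λ i)) := by
    intro i
    obtain ⟨e1, e2, e3, e4⟩ := Fin3.add i
    have b0 := hb i
    have b1 := hb (i + 1)
    have b2 := hb (i + 2)
    rw [e1, e2] at b1
    rw [e4, e3] at b2
    have l0 := hΛ i
    have l1 := hΛ (i + 1)
    have l2 := hΛ (i + 2)
    have h := P.cosh_aLength i
    have s1 := P.bLength_pos (i + 1)
    have s2 := P.bLength_pos (i + 2)
    set x := P.bLength i with hx
    set y := P.bLength (i + 1) with hy
    set z := P.bLength (i + 2) with hz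
    have hsy := exp_div_four_le_sinh (x := y) (by linarith)
    have hsz := exp_div_four_le_sinh (x := z) (by linarith)
    have hsy' : Real.sinh y ≤ Real.exp y / 2 := by
      rw [Real.sinh_eq]; linarith [Real.exp_pos (-y)]
    have hsz' : Real.sinh z ≤ Real.exp z / 2 := by
      rw [Real.sinh_eq]; linarith [Real.exp_pos (-z)]
    have hyp := Real.sinh_pos_iff.2 s1
    have hzp := Real.sinh_pos_iff.2 s2
    have hnum : Real.cosh (P.aLength i) - 1 =
        (Real.cosh x + Real.cosh (y - z)) / (Real.sinh y * Real.sinh z) := by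
      rw [h, cof, Real.cosh_sub]
      field_simp
      ring
    have hc : Real.cosh (y - z) ≤ Real.cosh x := by
      rw [Real.cosh_le_cosh, abs_of_pos (by linarith : 0 < x), abs_le]
      constructor <;> linarith
    have hexp : Real.exp (-(2 * Λ i)) * (Real.exp y * Real.exp z) = Real.exp x := by
      rw [← Real.exp_add, ← Real.exp_add]
      congr 1
      linarith
    have hx2 := cosh_le_exp (x := x) (by linarith)
    have hx3 := exp_div_two_le_cosh x
    have hprod1 : Real.exp y / 4 * (Real.exp z / 4) ≤ Real.sinh y * Real.sinh z :=
      mul_le_mul hsy hsz (by positivity) hyp.le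
    have hprod2 : Real.sinh y * Real.sinh z ≤ Real.exp y / 2 * (Real.exp z / 2) :=
      mul_le_mul hsy' hsz' hzp.le (by positivity)
    have hE := Real.exp_pos (-(2 * Λ i))
    rw [hnum]
    constructor
    · rw [le_div_iff₀ (by positivity)]
      nlinarith [Real.cosh_pos (y - z)]
    · rw [div_le_iff₀ (by positivity)]
      nlinarith
  exact ⟨⟨hP, hΛ, fun i => by linarith [hb i], fun i => by linarith [hb i], fun i => (key i).2⟩,
    fun i => (key i).1⟩

/-- The converse passage, needed for black hexagons, of which only the arcs are known. Here `sinh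
aᵢ` is comparable to `exp (-Λᵢ)`, and the dual law of cosines makes `cosh bᵢ` comparable to `exp
(Λᵢ₊₁ + Λᵢ₊₂)`. The ratios lie between `1/50` and `3/2`, which an error of 4 in the exponent covers
since `exp 4 ≥ 50`. -/
lemma isLong_of_aLength {P : RightAngledHexagon} {Λ : Fin 3 → ℝ} (hP : P.region.Nonempty)
    (hΛ : ∀ i, 100 ≤ Λ i) (h1 : ∀ i, 2 * Real.exp (-(2 * Λ i)) ≤ Real.cosh (P.aLength i) - 1)
    (h2 : ∀ i, Real.cosh (P.aLength i) - 1 ≤ 32 * Real.exp (-(2 * Λ i))) : P.IsLong Λ := by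
  have hsmall : ∀ i, Real.cosh (P.aLength i) ≤ 2 := by
    intro i
    have e1 : Real.exp (-(2 * Λ i)) * Real.exp (2 * Λ i) = 1 := by
      rw [← Real.exp_add, neg_add_cancel, Real.exp_zero]
    have e2 := Real.add_one_le_exp (2 * Λ i)
    have := Real.exp_pos (-(2 * Λ i))
    nlinarith [h2 i, hΛ i]
  have hsinh : ∀ i, 2 * Real.exp (-Λ i) ≤ Real.sinh (P.aLength i) ∧
      Real.sinh (P.aLength i) ≤ 10 * Real.exp (-Λ i) := by
    intro i
    have e0 := Real.sinh_pos_iff.2 (P.aLength_pos i)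
    have e1 := Real.cosh_sq (P.aLength i)
    have e2 : Real.exp (-(2 * Λ i)) = Real.exp (-Λ i) ^ 2 := by
      rw [← Real.exp_nat_mul]; congr 1; push_cast; ring
    have e3 := Real.exp_pos (-Λ i)
    have e4 := h1 i
    have e5 := h2 i
    have e6 := hsmall i
    rw [e2] at e4 e5
    have e7 := Real.one_le_cosh (P.aLength i)
    constructor
    · refine (sq_le_sq₀ (by positivity) e0.le).1 ?_
      nlinarith
    · refine (sq_le_sq₀ e0.le (by positivity)).1 ?_
      nlinarith
  have key : ∀ i, P.bLength i ≤ Λ (i + 1) + Λ (i + 2) + 4 ∧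
      Λ (i + 1) + Λ (i + 2) - 4 ≤ P.bLength i := by
    intro i
    have h := P.cosh_bLength i
    have p1 := Real.sinh_pos_iff.2 (P.aLength_pos (i + 1))
    have p2 := Real.sinh_pos_iff.2 (P.aLength_pos (i + 2))
    rw [eq_div_iff (by positivity)] at h
    obtain ⟨s1, s1'⟩ := hsinh (i + 1)
    obtain ⟨s2, s2'⟩ := hsinh (i + 2)
    have c0 := Real.one_le_cosh (P.aLength i)
    have c1 := Real.one_le_cosh (P.aLength (i + 1))
    have c2 := Real.one_le_cosh (P.aLength (i + 2))
    have d0 := hsmall i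
    have d1 := hsmall (i + 1)
    have d2 := hsmall (i + 2)
    have hE : Real.exp (-Λ (i + 1)) * Real.exp (-Λ (i + 2)) * Real.exp (Λ (i + 1) + Λ (i + 2)) =
        1 := by
      rw [← Real.exp_add, ← Real.exp_add, ← Real.exp_zero]
      congr 1; ring
    have q1 : 2 * Real.exp (-Λ (i + 1)) * (2 * Real.exp (-Λ (i + 2))) ≤
        Real.sinh (P.aLength (i + 1)) * Real.sinh (P.aLength (i + 2)) :=
      mul_le_mul s1 s2 (by positivity) p1.le
    have q2 : Real.sinh (P.aLength (i + 1)) * Real.sinh (P.aLength (i + 2)) ≤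
        10 * Real.exp (-Λ (i + 1)) * (10 * Real.exp (-Λ (i + 2))) :=
      mul_le_mul s1' s2' p2.le (by positivity)
    set C := Real.cosh (P.bLength i) with hC
    set S := Real.sinh (P.aLength (i + 1)) * Real.sinh (P.aLength (i + 2))
    set F := Real.exp (Λ (i + 1) + Λ (i + 2)) with hF
    set ε := Real.exp (-Λ (i + 1)) * Real.exp (-Λ (i + 2)) with hε
    have hC0 : 0 < C := Real.cosh_pos _
    have hF0 : 0 < F := Real.exp_pos _
    have hε0 : 0 < ε := by positivity
    have hup : C * S ≤ 6 := by rw [h]; nlinarith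
    have hlow : 2 ≤ C * S := by rw [h]; nlinarith
    have hCF : C * ε ≤ 3 / 2 := by nlinarith
    have hCF' : 1 / 50 ≤ C * ε := by nlinarith
    have hC1 : C ≤ 3 / 2 * F := by
      calc C = C * ε * F := by rw [mul_assoc, hE, mul_one]
        _ ≤ _ := by gcongr
    have hC2 : 1 / 50 * F ≤ C := by
      calc 1 / 50 * F ≤ C * ε * F := by gcongr
        _ = C := by rw [mul_assoc, hE, mul_one]
    have hC3 := exp_div_two_le_cosh (P.bLength i)
    have hC4 := cosh_le_exp (P.bLength_pos i).le
    rw [← hC] at hC3 hC4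
    have he4 : (50 : ℝ) ≤ Real.exp 4 := by
      have : (2.7 : ℝ) ≤ Real.exp 1 := by linarith [Real.exp_one_gt_d9]
      calc (50 : ℝ) ≤ 2.7 ^ 4 := by norm_num
        _ ≤ Real.exp 1 ^ 4 := by gcongr
        _ = Real.exp 4 := by rw [← Real.exp_nat_mul]; norm_num
    constructor
    · rw [← Real.exp_le_exp, Real.exp_add, ← hF]
      nlinarith
    · rw [← Real.exp_le_exp]
      have : Real.exp (Λ (i + 1) + Λ (i + 2) - 4) * Real.exp 4 = F := by
        rw [← Real.exp_add, hF]; congr 1; ring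
      have := Real.exp_pos (Λ (i + 1) + Λ (i + 2) - 4)
      nlinarith
  exact ⟨hP, hΛ, fun i => (key i).1, fun i => (key i).2, h2⟩

end RightAngledHexagon


/-! ### The projection of a surface to its dual graph -/

lemma Path.exists_arclength {X : Type*} [PseudoMetricSpace X] {x y : X} (γ : Path x y) {L : ℝ}
    (hL : 0 ≤ L) (hγ : eVariationOn γ Set.univ ≤ ENNReal.ofReal L) : ∃ V : ℝ → ℝ, V 1 - V 0 ≤ L ∧
      ∀ a b, a ≤ b → dist (γ.extend a) (γ.extend b) ≤ V b - V a := by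
  have htot : eVariationOn γ.extend Set.univ ≤ ENNReal.ofReal L := by
    refine le_trans ?_ hγ
    exact eVariationOn.comp_le_of_monotoneOn γ (s := Set.univ) (Set.projIcc 0 1 zero_le_one)
      ((Set.monotone_projIcc _).monotoneOn _) (Set.mapsTo_univ _ _)
  have hle : ∀ t, eVariationOn γ.extend (Set.Iic t) ≤ ENNReal.ofReal L := fun t =>
    (eVariationOn.mono _ (Set.subset_univ _)).trans htot
  have hfin : ∀ t, eVariationOn γ.extend (Set.Iic t) ≠ ⊤ := fun t =>
    ((hle t).trans_lt ENNReal.ofReal_lt_top).ne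
  refine ⟨fun t => (eVariationOn γ.extend (Set.Iic t)).toReal, ?_, ?_⟩
  · have h1 := ENNReal.toReal_mono ENNReal.ofReal_ne_top (hle 1)
    rw [ENNReal.toReal_ofReal hL] at h1
    have h2 : 0 ≤ (eVariationOn γ.extend (Set.Iic (0 : ℝ))).toReal := ENNReal.toReal_nonneg
    linarith
  · intro a b hab
    have h1 : eVariationOn γ.extend (Set.Iic a) + edist (γ.extend a) (γ.extend b) ≤
        eVariationOn γ.extend (Set.Iic b) := by
      calc _ ≤ eVariationOn γ.extend (Set.Iic a) + eVariationOn γ.extend (Set.Icc a b) := by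
            gcongr
            exact eVariationOn.edist_le _ (Set.left_mem_Icc.2 hab) (Set.right_mem_Icc.2 hab)
        _ ≤ eVariationOn γ.extend (Set.Iic a ∪ Set.Icc a b) :=
            eVariationOn.add_le_union _ fun s hs t ht => hs.trans ht.1
        _ = _ := by rw [Set.Iic_union_Icc_eq_Iic hab]
    have h2 := ENNReal.toReal_mono (hfin b) h1
    rw [ENNReal.toReal_add (hfin a) (edist_ne_top _ _), ← dist_edist] at h2
    linarith

namespace FatGraph

variable {G : FatGraph}

open RightAngledHexagon

/-- The edge which contains a half-edge. -/
def edgeOf : G.Vertex × Fin 3 → G.Edge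
  | (Sum.inl n, i) => (n, i)
  | (Sum.inr b, i) => G.glue.symm (b, i)

lemma edgeOf_inl (n : G.W) (i : Fin 3) : edgeOf (G := G) (Sum.inl n, i) = (n, i) := rfl

lemma edgeOf_inr (b : G.B) (i : Fin 3) : edgeOf (G := G) (Sum.inr b, i) = G.glue.symm (b, i) := rfl

lemma edgeOf_opp (h : G.Vertex × Fin 3) : edgeOf (G.opp h) = edgeOf h := by
  obtain ⟨n | b, i⟩ := h <;> simp [opp_inl, opp_inr, edgeOf_inl, edgeOf_inr]

lemma eq_or_eq_opp {h h' : G.Vertex × Fin 3} (he : edgeOf h = edgeOf h') :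
    h = h' ∨ h' = G.opp h := by
  obtain ⟨n | b, i⟩ := h <;> obtain ⟨n' | b', i'⟩ := h'
  · left
    rw [edgeOf_inl, edgeOf_inl, Prod.mk.injEq] at he
    rw [he.1, he.2]
  · right
    rw [edgeOf_inl, edgeOf_inr] at he
    rw [opp_inl, he, Equiv.apply_symm_apply]
  · right
    rw [edgeOf_inl, edgeOf_inr] at he
    rw [opp_inr, he]
  · left
    rw [edgeOf_inr, edgeOf_inr, EmbeddingLike.apply_eq_iff_eq, Prod.mk.injEq] at he
    rw [he.1, he.2]

/-- The point at position `σ` of a half-edge at the vertex `v`, from `0` at the midpoint of the edge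
to `1` at the vertex. -/
def halfPoint (v : G.Vertex) (σ : ℝ) : Set.Icc (0 : ℝ) 1 :=
  Set.projIcc 0 1 zero_le_one (Sum.elim (fun _ => (1 - σ) / 2) (fun _ => (1 + σ) / 2) v)

lemma halfPoint_inl (n : G.W) {σ : ℝ} (h0 : 0 ≤ σ) (h1 : σ ≤ 1) :
    (halfPoint (G := G) (Sum.inl n) σ : ℝ) = (1 - σ) / 2 := by
  rw [halfPoint, Sum.elim_inl, Set.projIcc_of_mem zero_le_one ⟨by linarith, by linarith⟩]

lemma halfPoint_inr (b : G.B) {σ : ℝ} (h0 : 0 ≤ σ) (h1 : σ ≤ 1) :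
    (halfPoint (G := G) (Sum.inr b) σ : ℝ) = (1 + σ) / 2 := by
  rw [halfPoint, Sum.elim_inr, Set.projIcc_of_mem zero_le_one ⟨by linarith, by linarith⟩]

lemma halfPoint_zero (v v' : G.Vertex) : halfPoint v 0 = halfPoint v' 0 := by
  unfold halfPoint
  obtain n | b := v <;> obtain n' | b' := v' <;> simp

lemma abs_halfPoint_sub (v : G.Vertex) {σ τ : ℝ} (h0 : 0 ≤ σ) (h1 : σ ≤ 1) (h0' : 0 ≤ τ)
    (h1' : τ ≤ 1) : |(halfPoint v σ : ℝ) - halfPoint v τ| = |σ - τ| / 2 := by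
  have h2 : |(2 : ℝ)| = 2 := abs_two
  obtain n | b := v
  · rw [halfPoint_inl n h0 h1, halfPoint_inl n h0' h1', abs_sub_comm σ, ← h2, ← abs_div, h2]
    congr 1; ring
  · rw [halfPoint_inr b h0 h1, halfPoint_inr b h0' h1', ← h2, ← abs_div, h2]
    congr 1; ring

lemma abs_halfPoint_opp_sub (h : G.Vertex × Fin 3) {σ τ : ℝ} (h0 : 0 ≤ σ) (h1 : σ ≤ 1) (h0' : 0 ≤ τ)
    (h1' : τ ≤ 1) : |(halfPoint h.1 σ : ℝ) - halfPoint (G.opp h).1 τ| = (σ + τ) / 2 := by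
  obtain ⟨n | b, i⟩ := h
  · rw [opp_inl, halfPoint_inl n h0 h1, halfPoint_inr _ h0' h1', abs_of_nonpos (by linarith)]
    ring
  · rw [opp_inr, halfPoint_inr b h0 h1, halfPoint_inl _ h0' h1', abs_of_nonneg (by linarith)]
    ring

lemma pathOfLength_vertex (l : G.Edge → ℝ) (v : G.Vertex) (i j : Fin 3) :
    PathOfLength l (edgeOf (v, i), halfPoint v 1) (edgeOf (v, j), halfPoint v 1) 0 := by
  obtain n | b := v
  · have : halfPoint (G := G) (Sum.inl n) 1 = 0 :=
      Subtype.ext ((halfPoint_inl n zero_le_one le_rfl).trans (by norm_num))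
    rw [this]
    exact .white (edgeOf (Sum.inl n, i)) _ _ rfl .refl
  · have : halfPoint (G := G) (Sum.inr b) 1 = 1 :=
      Subtype.ext ((halfPoint_inr b zero_le_one le_rfl).trans (by norm_num))
    rw [this]
    exact .black (edgeOf (Sum.inr b, i)) _ _ (by simp [edgeOf_inr]) .refl

/-- The lengths of the legs of the hexagon at a vertex. -/
def legs (Λ : G.Edge → ℝ) (v : G.Vertex) (i : Fin 3) : ℝ := Λ (edgeOf (v, i))

namespace Teich

variable (m : G.Teich) (Λ : G.Edge → ℝ)

/-- The projection of the hexagon at the vertex `v` to the graph. -/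
def proj (v : G.Vertex) (z : ℍ) : G.Point :=
  (edgeOf (v, (m.hex v).leg (legs Λ v) z),
    halfPoint v ((m.hex v).pos (legs Λ v) ((m.hex v).leg (legs Λ v) z) z))

/-- The point `x` of the surface lies over the point `p` of the graph. -/
def Over (x : m.Carrier) (p : G.Point) : Prop :=
  ∃ v, ∃ z ∈ (m.hex v).region, ∃ i, m.tile v z = x ∧ (m.hex v).depth i z ≤ legs Λ v i + 18 ∧
    p = (edgeOf (v, i), halfPoint v ((m.hex v).pos (legs Λ v) i z))

/-- Each arc is a side of two hexagons. -/
lemma exists_common (h : G.Vertex × Fin 3) : ∃ z ∈ (m.hex h.1).arc h.2,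
    ∃ w ∈ (m.hex (G.opp h).1).arc (G.opp h).2, m.tile h.1 z = m.tile (G.opp h).1 w := by
  have key : ∀ n i, ∃ z ∈ (m.hex (Sum.inl n)).arc i,
      ∃ w ∈ (m.hex (Sum.inr (G.glue (n, i)).1)).arc (G.glue (n, i)).2,
        m.tile (Sum.inl n) z = m.tile (Sum.inr (G.glue (n, i)).1) w := by
    intro n i
    have h1 := (m.hex (Sum.inl n)).corner_mem_arc (m.region_nonempty _)
      (show i + 1 ≠ i by simp)
    have h2 := (m.hex (Sum.inr (G.glue (n, i)).1)).corner_mem_arc (m.region_nonempty _)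
      (show (G.glue (n, i)).2 + 2 ≠ (G.glue (n, i)).2 by simp)
    exact ⟨_, h1, _, h2, (m.tile_glue n _ _ h1.1 _ h2.1).2
      ⟨i, _, rfl, h1, h2, (dist_self _).trans (dist_self _).symm⟩⟩
  obtain ⟨n | b, i⟩ := h
  · exact key n i
  · obtain ⟨z, hz, w, hw, hzw⟩ := key (G.glue.symm (b, i)).1 (G.glue.symm (b, i)).2
    simp only [Prod.mk.eta, Equiv.apply_symm_apply] at hw hzw
    exact ⟨w, hw, z, hz, hzw.symm⟩

section Long

variable {m Λ} (hL : ∀ v, (m.hex v).IsLong (legs Λ v))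
include hL

lemma leg_of_arc {v : G.Vertex} {i : Fin 3} {z : ℍ} (hz : z ∈ (m.hex v).arc i) :
    (m.hex v).leg (legs Λ v) z = i := by
  apply (hL v).leg_eq hz.1
  rw [depth_eq_zero hz]
  linarith [(hL v).long i]

omit hL in
lemma pos_of_arc {v : G.Vertex} {i : Fin 3} {z : ℍ} (hz : z ∈ (m.hex v).arc i) :
    (m.hex v).pos (legs Λ v) i z = 0 := by
  rw [pos, depth_eq_zero hz, zero_div, min_eq_left zero_le_one]

lemma proj_of_arc {v : G.Vertex} {i : Fin 3} {z : ℍ} (hz : z ∈ (m.hex v).arc i) :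
    m.proj Λ v z = (edgeOf (v, i), halfPoint v 0) := by
  rw [proj, leg_of_arc hL hz, pos_of_arc hz]

/-- Distinct hexagons meet only in arcs, and both projections send the arc to the midpoint of its
dual edge; so the projection descends to the surface. -/
lemma proj_eq_of_tile_eq {v v' : G.Vertex} {z z' : ℍ} (hz : z ∈ (m.hex v).region)
    (hz' : z' ∈ (m.hex v').region) (h : m.tile v z = m.tile v' z') :
    m.proj Λ v z = m.proj Λ v' z' := by
  rcases m.tile_eq hz hz' h with ⟨rfl, rfl⟩ | ⟨i, j, h1, h2, h3⟩
  · rfl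
  · rw [proj_of_arc hL h2, proj_of_arc hL h3, halfPoint_zero v v', ← h1, edgeOf_opp]

lemma over_proj {v : G.Vertex} {z : ℍ} (hz : z ∈ (m.hex v).region) :
    m.Over Λ (m.tile v z) (m.proj Λ v z) :=
  ⟨v, z, hz, _, rfl, (hL v).depth_leg_le hz, rfl⟩

/-- A half-edge has length `Λ e` but parameter length `1/2`, whence the factor 2. Points over
different halves are joined through a common point of the arc, at the cost of two errors of 80. -/
lemma dist_le_of_over {x y : m.Carrier} {e : G.Edge} {t t' : Set.Icc (0 : ℝ) 1}
    (hx : m.Over Λ x (e, t)) (hy : m.Over Λ y (e, t')) :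
    dist x y ≤ 2 * Λ e * |(t : ℝ) - t'| + 160 := by
  obtain ⟨v, z, hz, i, rfl, hzi, hp⟩ := hx
  obtain ⟨v', z', hz', i', rfl, hzi', hp'⟩ := hy
  obtain ⟨rfl, rfl⟩ := Prod.mk.inj hp
  obtain ⟨he, rfl⟩ := Prod.mk.inj hp'
  have p0 := (hL v).pos_nonneg hz i
  have p1 := IsLong.pos_le_one (P := m.hex v) (Λ := legs Λ v) i z
  have p0' := (hL v').pos_nonneg hz' i'
  have p1' := IsLong.pos_le_one (P := m.hex v') (Λ := legs Λ v') i' z'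
  rcases eq_or_eq_opp he with h | h
  · obtain ⟨rfl, rfl⟩ := Prod.mk.inj h
    have h1 := (m.dist_tile_le v hz hz').trans ((hL v).dist_le_pos_sub hz hz' hzi hzi')
    rw [abs_halfPoint_sub v p0 p1 p0' p1']
    change _ ≤ Λ (edgeOf (v, i)) * _ + 80 at h1
    linarith
  · obtain ⟨z0, hz0, w0, hw0, hzw⟩ := m.exists_common (v, i)
    rw [← h] at hw0 hzw
    simp only at hz0 hw0 hzw
    have l1 := (hL v).long i
    have l2 := (hL v').long i'
    have h1 := (m.dist_tile_le v hz hz0.1).trans ((hL v).dist_le_pos_sub hz hz0.1 hzi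
      (by rw [depth_eq_zero hz0]; linarith))
    have h2 := (m.dist_tile_le v' hw0.1 hz').trans ((hL v').dist_le_pos_sub hw0.1 hz'
      (by rw [depth_eq_zero hw0]; linarith) hzi')
    rw [pos_of_arc hz0, sub_zero, abs_of_nonneg p0] at h1
    rw [pos_of_arc hw0, zero_sub, abs_neg, abs_of_nonneg p0'] at h2
    have h3 := abs_halfPoint_opp_sub (v, i) p0 p1 p0' p1'
    rw [← h] at h3
    simp only at h3
    rw [h3]
    have h4 := dist_triangle (m.tile v z) (m.tile v z0) (m.tile v' z')
    rw [hzw] at h4 h1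
    have e1 : legs Λ v i = Λ (edgeOf (v, i)) := rfl
    have e2 : legs Λ v' i' = Λ (edgeOf (v, i)) := by rw [legs, he]
    rw [e1] at h1
    rw [e2] at h2
    linarith

lemma graphDist_proj_le {l : G.Edge → ℝ} {s K : ℝ} (hs : 0 < s) (hl : ∀ e, l e = 2 * s * Λ e)
    (hK : ∀ e, Λ e ≤ K * (Λ e - 4)) {v : G.Vertex} {z w : ℍ} (hz : z ∈ (m.hex v).region)
    (hw : w ∈ (m.hex v).region) :
    graphDist l (m.proj Λ v z) (m.proj Λ v w) ≤ K * (s * dist z w) := by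
  have hlm : l ∈ G.metrics := fun e => by
    have := (hL (Sum.inl e.1)).long e.2
    change 100 ≤ Λ e at this
    rw [hl]
    have : 0 < Λ e := by linarith
    positivity
  have hseg : ∀ (v : G.Vertex) (i : Fin 3) {σ τ : ℝ}, 0 ≤ σ → σ ≤ 1 → 0 ≤ τ → τ ≤ 1 →
      PathOfLength l (edgeOf (v, i), halfPoint v σ) (edgeOf (v, i), halfPoint v τ)
        (s * (legs Λ v i * |σ - τ|)) := by
    intro v i σ τ h0 h1 h2 h3
    have := pathOfLength_segment (l := l) (edgeOf (v, i)) (halfPoint v σ) (halfPoint v τ)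
    rw [abs_halfPoint_sub v h0 h1 h2 h3, hl] at this
    convert this using 1
    rw [legs]; ring
  have p0 := (hL v).pos_nonneg hz ((m.hex v).leg (legs Λ v) z)
  have p1 := IsLong.pos_le_one (P := m.hex v) (Λ := legs Λ v) ((m.hex v).leg (legs Λ v) z) z
  have q0 := (hL v).pos_nonneg hw ((m.hex v).leg (legs Λ v) w)
  have q1 := IsLong.pos_le_one (P := m.hex v) (Λ := legs Λ v) ((m.hex v).leg (legs Λ v) w) w
  by_cases h : (m.hex v).leg (legs Λ v) z = (m.hex v).leg (legs Λ v) w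
  · rw [← h] at q0 q1
    have h1 := graphDist_le hlm (hseg v ((m.hex v).leg (legs Λ v) z) p0 p1 q0 q1)
    have h2 := (hL v).abs_pos_sub_le (i := (m.hex v).leg (legs Λ v) z) (hK _) z w
    rw [proj, proj, ← h]
    refine h1.trans ?_
    rw [mul_left_comm K]
    exact mul_le_mul_of_nonneg_left h2 hs.le
  · have h1 := ((hseg v ((m.hex v).leg (legs Λ v) z) p0 p1 zero_le_one le_rfl).trans
      (pathOfLength_vertex l v _ _)).trans
      (hseg v ((m.hex v).leg (legs Λ v) w) zero_le_one le_rfl q0 q1)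
    have h2 := (hL v).pos_add_le hz hw h fun i => hK _
    refine (graphDist_le hlm h1).trans ?_
    rw [abs_of_nonpos (by linarith), abs_of_nonneg (by linarith), mul_left_comm K]
    calc _ = s * (legs Λ v ((m.hex v).leg (legs Λ v) z) *
          (1 - (m.hex v).pos (legs Λ v) ((m.hex v).leg (legs Λ v) z) z) +
          legs Λ v ((m.hex v).leg (legs Λ v) w) *
          (1 - (m.hex v).pos (legs Λ v) ((m.hex v).leg (legs Λ v) w) w)) := by ring
      _ ≤ _ := mul_le_mul_of_nonneg_left h2 hs.le

/-- The projection is Lipschitz near each point, because a nearby point shares a hexagon with it in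
which distances agree. This is integrated along a path of almost minimal length by
`le_of_locally_le`. -/
lemma graphDist_le_dist {l : G.Edge → ℝ} {s K : ℝ} (hs : 0 < s) (hl : ∀ e, l e = 2 * s * Λ e)
    (hK0 : 0 ≤ K) (hK : ∀ e, Λ e ≤ K * (Λ e - 4)) {f : m.Carrier → G.Point}
    (hf : ∀ v, ∀ z ∈ (m.hex v).region, f (m.tile v z) = m.proj Λ v z) (x y : m.Carrier) :
    graphDist l (f x) (f y) ≤ K * (s * dist x y) := by
  have hlm : l ∈ G.metrics := fun e => by
    have := (hL (Sum.inl e.1)).long e.2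
    change 100 ≤ Λ e at this
    rw [hl]
    have : 0 < Λ e := by linarith
    positivity
  have key : ∀ ε > 0, graphDist l (f x) (f y) ≤ K * s * (dist x y + ε) := by
    intro ε hε
    obtain ⟨γ, hγ⟩ := m.hyperbolic.length_metric x y ε hε
    obtain ⟨V, hV, hVd⟩ := γ.exists_arclength (by positivity) hγ
    have hloc : ∀ t : ℝ, ∃ δ > 0, ∀ t', |t' - t| < δ →
        graphDist l (f (γ.extend t)) (f (γ.extend t')) ≤
          K * s * dist (γ.extend t) (γ.extend t') := by
      intro t
      obtain ⟨r, hr, h⟩ := m.exists_local (γ.extend t)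
      obtain ⟨δ, hδ, hc⟩ := Metric.continuous_iff.1 γ.continuous_extend t r hr
      refine ⟨δ, hδ, fun t' ht' => ?_⟩
      have h1 := hc t' ht'
      obtain ⟨v, w, hw, hwt⟩ := m.cover (γ.extend t')
      rw [← hwt] at h1 ⊢
      obtain ⟨z, hz, hzt, hd, -⟩ := h v w hw h1
      rw [dist_comm _ (m.tile v w), ← hd, ← hzt, hf v z hz, hf v w hw, dist_comm w]
      have := graphDist_proj_le hL hs hl hK hz hw
      linarith
    have := le_of_locally_le (D := fun a b => graphDist l (f (γ.extend a)) (f (γ.extend b)))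
      (V := fun t => K * s * V t) (fun a b c => graphDist_triangle hlm _ _ _)
      (graphDist_self hlm _).le (by
        intro t _
        obtain ⟨δ, hδ, h⟩ := hloc t
        refine ⟨δ, hδ, fun t' _ ht' => ⟨fun htt => ?_, fun htt => ?_⟩⟩
        · rw [← mul_sub]
          exact (h t' ht').trans (mul_le_mul_of_nonneg_left (hVd _ _ htt) (by positivity))
        · rw [← mul_sub, graphDist_comm hlm]
          refine (h t' ht').trans (mul_le_mul_of_nonneg_left ?_ (by positivity))
          rw [dist_comm]
          exact hVd _ _ htt)
    simp only [Path.extend_zero, Path.extend_one, ← mul_sub] at this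
    exact this.trans (mul_le_mul_of_nonneg_left hV (by positivity))
  apply le_of_forall_pos_le_add
  intro ε hε
  have h1 := key (ε / (K * s + 1)) (by positivity)
  have h2 : K * s * (ε / (K * s + 1)) ≤ ε := by
    rw [mul_div_assoc', div_le_iff₀ (by positivity)]
    nlinarith
  linarith

lemma exists_over_vertex : ∃ c : G.Vertex → m.Carrier, ∀ v i,
    m.Over Λ (c v) (edgeOf (v, i), halfPoint v 1) := by
  choose z hz hc using fun v => (hL v).exists_core
  refine ⟨fun v => m.tile v (z v), fun v i => ⟨v, z v, hz v, i, rfl,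
    (hL v).depth_le_of_core (hz v) (hc v) i, ?_⟩⟩
  rw [(hL v).pos_eq_one (hc v i)]

/-- Only distance zero can be expected: at a vertex the chosen leg may differ from the given edge,
and the ends of different edges are different points of `G.Point`. -/
lemma exists_proj (l : G.Edge → ℝ) (p : G.Point) : ∃ v, ∃ z ∈ (m.hex v).region,
    PathOfLength l p (m.proj Λ v z) 0 := by
  have key : ∀ v i σ, 0 ≤ σ → σ ≤ 1 → ∃ z ∈ (m.hex v).region,
      PathOfLength l (edgeOf (v, i), halfPoint v σ) (m.proj Λ v z) 0 := by
    intro v i σ h0 h1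
    have hr : 0 < legs Λ v i - 4 := by linarith [(hL v).long i]
    obtain ⟨z, hz, hzd⟩ := (hL v).exists_depth_eq i (ρ := (legs Λ v i - 4) * σ) (by positivity)
      (by nlinarith)
    have hpos : (m.hex v).pos (legs Λ v) i z = σ := by
      rw [pos, hzd, mul_div_cancel_left₀ _ hr.ne', min_eq_left h1]
    refine ⟨z, hz, ?_⟩
    rw [proj]
    by_cases hi : (m.hex v).leg (legs Λ v) z = i
    · rw [hi, hpos]; exact .refl
    · have h2 := (hL v).le_depth_of_leg_ne hz hi
      have h3 := (hL v).pos_eq_one h2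
      have h4 := (hL v).lt_depth_add hz hi
      rw [hpos] at h3
      subst h3
      rw [(hL v).pos_eq_one (by linarith)]
      exact pathOfLength_vertex l v i _
  obtain ⟨e, t⟩ := p
  rcases le_total (t : ℝ) (1 / 2) with ht | ht
  · obtain ⟨z, hz, h⟩ := key (Sum.inl e.1) e.2 (1 - 2 * t) (by linarith) (by linarith [t.2.1])
    refine ⟨_, z, hz, ?_⟩
    have e1 : halfPoint (G := G) (Sum.inl e.1) (1 - 2 * t) = t :=
      Subtype.ext ((halfPoint_inl _ (by linarith) (by linarith [t.2.1])).trans (by ring))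
    rwa [e1] at h
  · obtain ⟨z, hz, h⟩ := key (Sum.inr (G.glue e).1) (G.glue e).2 (2 * t - 1) (by linarith)
      (by linarith [t.2.2])
    refine ⟨_, z, hz, ?_⟩
    have e1 : halfPoint (G := G) (Sum.inr (G.glue e).1) (2 * t - 1) = t :=
      Subtype.ext ((halfPoint_inr _ (by linarith) (by linarith [t.2.2])).trans (by ring))
    rwa [e1, edgeOf_inr, Prod.mk.eta, Equiv.symm_apply_apply] at h

/-- A surface which is made of long hexagons is close to a metric graph. -/
lemma exists_markedApprox {l : G.Edge → ℝ} {s K D a ε : ℝ} (hs : 0 < s)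
    (hl : ∀ e, l e = 2 * s * Λ e) (hK1 : 1 ≤ K) (hK : ∀ e, Λ e ≤ K * (Λ e - 4))
    (hD : ∀ p q, graphDist l p q ≤ D) (ha : 0 < a) (hla : ∀ e, a ≤ l e)
    (h1 : 160 * s / a * D + 2 * (160 * s) < ε)
    (h2 : (K - 1) * ((1 + 160 * s / a) * D + 2 * (160 * s)) < ε) :
    ∃ f, IsMarkedApprox m s l ε f := by
  have hlm : l ∈ G.metrics := fun e => ha.trans_le (hla e)
  choose v z hz hvz using m.cover
  let f : m.Carrier → G.Point := fun x => m.proj Λ (v x) (z x)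
  have hf : ∀ v, ∀ z ∈ (m.hex v).region, f (m.tile v z) = m.proj Λ v z := fun v' z' hz' =>
    proj_eq_of_tile_eq hL (hz _) hz' (hvz _)
  have hover : ∀ x, m.Over Λ x (f x) := fun x => by
    have := over_proj hL (hz x)
    rwa [hvz] at this
  obtain ⟨c, hc⟩ := exists_over_vertex hL
  have hupper : ∀ x y, s * dist x y ≤ (1 + 160 * s / a) * graphDist l (f x) (f y) +
      2 * (160 * s) := by
    intro x y
    refine dist_le_graphDist hlm (δ := fun x y => s * dist x y) (κ := 160 * s)
      (fun x y z => by nlinarith [dist_triangle x y z]) (fun x y => by rw [dist_comm]) ha hla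
      (by positivity) (Over := m.Over Λ) ?_ c ?_ ?_ (hover x) (hover y)
    · intro x y e t t' hx hy
      have := mul_le_mul_of_nonneg_left (dist_le_of_over hL hx hy) hs.le
      rw [hl]
      linarith
    · intro e
      have := hc (Sum.inl e.1) e.2
      have e1 : halfPoint (G := G) (Sum.inl e.1) 1 = 0 :=
        Subtype.ext ((halfPoint_inl _ zero_le_one le_rfl).trans (by norm_num))
      rwa [e1] at this
    · intro e
      have := hc (Sum.inr (G.glue e).1) (G.glue e).2
      have e1 : halfPoint (G := G) (Sum.inr (G.glue e).1) 1 = 1 :=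
        Subtype.ext ((halfPoint_inr _ zero_le_one le_rfl).trans (by norm_num))
      rwa [e1, edgeOf_inr, Prod.mk.eta, Equiv.symm_apply_apply] at this
  refine ⟨f, ⟨fun x y => ?_, fun p => ?_, fun e z hz => ?_, fun n z hz => ?_, fun n z hz => ?_⟩⟩
  · have e1 := hupper x y
    have e2 := graphDist_le_dist hL hs hl (by linarith) hK hf x y
    have e3 := hD (f x) (f y)
    have e4 : 0 ≤ 160 * s / a := by positivity
    rw [abs_lt]
    constructor
    · have e5 : (1 + 160 * s / a) * graphDist l (f x) (f y) ≤ (1 + 160 * s / a) * D :=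
        mul_le_mul_of_nonneg_left e3 (by linarith)
      -- The upper bound also bounds the rescaled diameter, which turns the Lipschitz constant `K`
      -- into a small additive error.
      have e6 : (K - 1) * (s * dist x y) ≤ (K - 1) * ((1 + 160 * s / a) * D + 2 * (160 * s)) :=
        mul_le_mul_of_nonneg_left (by linarith) (by linarith)
      linarith
    · have := mul_le_mul_of_nonneg_left e3 e4
      linarith
  · obtain ⟨v', z', hz', hp⟩ := exists_proj hL l p
    refine ⟨m.tile v' z', ?_⟩
    rw [hf v' z' hz']
    refine (graphDist_le hlm hp).trans_lt ?_
    have : 0 ≤ D := (graphDist_nonneg hlm p p).trans (hD p p)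
    have : 0 ≤ 160 * s / a * D := by positivity
    linarith
  · rw [hf _ z hz.1, proj_of_arc hL hz]
    refine ⟨rfl, ?_⟩
    rw [halfPoint_inl _ le_rfl zero_le_one]
    norm_num
  · have p0 := (hL (Sum.inl n)).pos_nonneg hz ((m.hex (Sum.inl n)).leg (legs Λ (Sum.inl n)) z)
    rw [hf _ z hz, proj]
    refine ⟨rfl, ?_⟩
    rw [halfPoint_inl _ p0 (IsLong.pos_le_one _ _)]
    linarith
  · have p0 := (hL (Sum.inr n)).pos_nonneg hz ((m.hex (Sum.inr n)).leg (legs Λ (Sum.inr n)) z)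
    rw [hf _ z hz, proj]
    refine ⟨by simp [edgeOf_inr], ?_⟩
    rw [halfPoint_inr _ p0 (IsLong.pos_le_one _ _)]
    linarith

end Long

end Teich

end FatGraph


namespace FatGraph

variable {G : FatGraph}

/-! ### Degeneration of rays -/

/-- The limit of the rescaled ray of `b`. -/
def limitMetric (b : G.W × Fin 3 → ℝ) : G.Edge → ℝ :=
  fun e => b (e.1, e.2 + 1) + b (e.1, e.2 + 2) - b e

/-- Positivity of the edge lengths and the strict triangle inequalities are the same conditions. -/
lemma limitMetric_mem {b : G.W × Fin 3 → ℝ} (hb : b ∈ G.cone) : limitMetric b ∈ G.metrics :=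
  fun e => sub_pos.2 (hb e.1 e.2)

lemma limitMetric_add (b : G.W × Fin 3 → ℝ) (n : G.W) (i : Fin 3) :
    limitMetric b (n, i + 1) + limitMetric b (n, i + 2) = 2 * b (n, i) := by
  obtain ⟨e1, e2, e3, e4⟩ := Fin3.add i
  simp only [limitMetric, e1, e2, e3, e4]
  ring

lemma limitMetric_injective : Function.Injective (limitMetric (G := G)) := by
  intro b b' h
  funext k
  have h1 := limitMetric_add b k.1 k.2
  have h2 := limitMetric_add b' k.1 k.2
  rw [h, h2] at h1
  change 2 * b' k = 2 * b k at h1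
  linarith

lemma limitMetric_smul (c : ℝ) (b : G.W × Fin 3 → ℝ) :
    limitMetric (c • b) = c • limitMetric b := by
  funext e
  simp only [limitMetric, Pi.smul_apply, smul_eq_mul]
  ring

lemma exists_limitMetric_eq {l : G.Edge → ℝ} (hl : l ∈ G.metrics) :
    ∃ b ∈ G.cone, limitMetric b = l := by
  refine ⟨fun k => (l (k.1, k.2 + 1) + l (k.1, k.2 + 2)) / 2, ?_, ?_⟩
  · intro n i
    obtain ⟨e1, e2, e3, e4⟩ := Fin3.add i
    simp only [e1, e2, e3, e4]
    linarith [hl (n, i)]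
  · funext ⟨n, i⟩
    obtain ⟨e1, e2, e3, e4⟩ := Fin3.add i
    simp only [limitMetric, e1, e2, e3, e4]
    ring

lemma smul_mem_cone {b : G.W × Fin 3 → ℝ} (hb : b ∈ G.cone) {c : ℝ} (hc : 0 < c) :
    c • b ∈ G.cone := by
  intro n i
  simp only [Pi.smul_apply, smul_eq_mul]
  nlinarith [hb n i]

/-- White hexagons are controlled by the coordinates; black ones through the arcs they share with
white hexagons. -/
lemma Teich.isLong {m : G.Teich} {Λ : G.Edge → ℝ} (hΛ : ∀ e, 100 ≤ Λ e)
    (hm : ∀ n i, m.coord (n, i) = Λ (n, i + 1) + Λ (n, i + 2)) (v : G.Vertex) :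
    (m.hex v).IsLong (legs Λ v) := by
  have hw : ∀ n, (m.hex (Sum.inl n)).IsLong (legs Λ (Sum.inl n)) ∧
      ∀ i, 2 * Real.exp (-(2 * legs Λ (Sum.inl n) i)) ≤
        Real.cosh ((m.hex (Sum.inl n)).aLength i) - 1 := fun n =>
    RightAngledHexagon.isLong_of_bLength (m.region_nonempty _) (fun i => hΛ _) fun i => hm n i
  obtain n | b := v
  · exact (hw n).1
  · have harc : ∀ j, (m.hex (Sum.inr b)).aLength j =
        (m.hex (Sum.inl (G.glue.symm (b, j)).1)).aLength (G.glue.symm (b, j)).2 := by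
      intro j
      have := m.arc_length (G.glue.symm (b, j))
      rw [Equiv.apply_symm_apply] at this
      exact this.symm
    refine RightAngledHexagon.isLong_of_aLength (m.region_nonempty _) (fun i => hΛ _)
      (fun j => ?_) fun j => ?_
    · rw [harc]
      exact (hw _).2 _
    · rw [harc]
      exact (hw _).1.cosh_aLength_le _

/-- The rescaled surfaces of a ray converge to a metric graph. -/
lemma degeneratesTo_limitMetric {b : G.W × Fin 3 → ℝ} (hb : b ∈ G.cone) {m : ℝ → G.Teich}
    (hm : IsRay b m) : DegeneratesTo m (fun t => t⁻¹) (limitMetric b) := by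
  intro ε hε
  have hl := limitMetric_mem hb
  obtain ⟨a, _, ha, hab⟩ := exists_bounds hl
  obtain ⟨D, hD⟩ := exists_graphDist_le hl
  have hinv : Tendsto (fun t : ℝ => t⁻¹) atTop (𝓝 0) := tendsto_inv_atTop_zero
  have h1 : Tendsto (fun t : ℝ => 160 * t⁻¹ / a * D + 2 * (160 * t⁻¹)) atTop (𝓝 0) := by
    have := (((hinv.const_mul 160).div_const a).mul_const D).add
      ((hinv.const_mul 160).const_mul 2)
    simpa using this
  have h2 : Tendsto (fun t : ℝ => (1 + 16 / a * t⁻¹ - 1) *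
      ((1 + 160 * t⁻¹ / a) * D + 2 * (160 * t⁻¹))) atTop (𝓝 0) := by
    have := (((hinv.const_mul (16 / a)).const_add 1).sub_const 1).mul
      (((((hinv.const_mul 160).div_const a).const_add 1).mul_const D).add
        ((hinv.const_mul 160).const_mul 2))
    simpa using this
  filter_upwards [h1.eventually_lt_const hε, h2.eventually_lt_const hε,
    eventually_ge_atTop (200 / a), eventually_gt_atTop 0] with t ht1 ht2 ht3 ht4
  have hta : 200 ≤ t * a := by rwa [div_le_iff₀ ha] at ht3
  let Λ : G.Edge → ℝ := fun e => t * limitMetric b e / 2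
  have hΛa : ∀ e, t * a / 2 ≤ Λ e := fun e => by
    have := mul_le_mul_of_nonneg_left (hab e).1 ht4.le
    simp only [Λ]
    linarith
  -- Since `t a ≥ 200`, every leg is at least 100 and `Λ e - 4 ≥ t a / 4`; the excess of `K` over 1
  -- is chosen so that its product with `t a / 4` is exactly 4.
  refine Teich.exists_markedApprox (Λ := Λ) (K := 1 + 16 / a * t⁻¹) ?_ (inv_pos.2 ht4) ?_ ?_ ?_ hD
    ha (fun e => (hab e).1) ht1 ht2
  · refine Teich.isLong (fun e => by linarith [hΛa e]) fun n i => ?_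
    rw [hm t ht4]
    have := limitMetric_add b n i
    simp only [Λ, Pi.smul_apply, smul_eq_mul]
    linear_combination (-t / 2) * this
  · intro e
    simp only [Λ]
    field_simp
  · have : 0 < 16 / a * t⁻¹ := by positivity
    linarith
  · intro e
    have e1 : 16 / a * t⁻¹ * (t * a / 4) = 4 := by
      field_simp
      norm_num
    have e2 : t * a / 4 ≤ Λ e - 4 := by linarith [hΛa e]
    have e3 : 16 / a * t⁻¹ * (t * a / 4) ≤ 16 / a * t⁻¹ * (Λ e - 4) :=
      mul_le_mul_of_nonneg_left e2 (by positivity)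
    linarith

/-! ### Uniqueness of limits -/

lemma PathOfLength.smul {l : G.Edge → ℝ} {x y : G.Point} {r : ℝ} (h : PathOfLength l x y r)
    (c : ℝ) : PathOfLength (c • l) x y (c * r) := by
  induction h with
  | refl => rw [mul_zero]; exact .refl
  | segment e t t' r _ ih =>
    have := PathOfLength.segment e t t' _ ih
    rwa [Pi.smul_apply, smul_eq_mul, mul_assoc, ← mul_add] at this
  | white e e' r he _ ih => exact .white e e' _ he ih
  | black e e' r he _ ih => exact .black e e' _ he ih

lemma smul_mem_metrics {l : G.Edge → ℝ} (hl : l ∈ G.metrics) {c : ℝ} (hc : 0 < c) :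
    c • l ∈ G.metrics := fun e => mul_pos hc (hl e)

lemma graphDist_smul {l : G.Edge → ℝ} (hl : l ∈ G.metrics) {c : ℝ} (hc : 0 < c) (x y : G.Point) :
    graphDist (c • l) x y = c * graphDist l x y := by
  apply le_antisymm
  · rw [← div_le_iff₀' hc]
    refine (isLengthRel_pathOfLength hl).le_sInf fun r hr => ?_
    rw [div_le_iff₀' hc]
    exact graphDist_le (smul_mem_metrics hl hc) (hr.smul c)
  · refine (isLengthRel_pathOfLength (smul_mem_metrics hl hc)).le_sInf fun r hr => ?_
    have h1 := hr.smul c⁻¹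
    rw [inv_smul_smul₀ hc.ne'] at h1
    have h2 := graphDist_le hl h1
    rwa [← div_eq_inv_mul, le_div_iff₀' hc] at h2

lemma DegeneratesTo.smul {m : ℝ → G.Teich} {s : ℝ → ℝ} {l : G.Edge → ℝ} (hl : l ∈ G.metrics)
    (h : DegeneratesTo m s l) {c : ℝ} (hc : 0 < c) :
    DegeneratesTo m (fun t => c * s t) (c • l) := by
  intro ε hε
  filter_upwards [h (ε / c) (by positivity)] with t ⟨f, hf⟩
  refine ⟨f, ⟨fun x y => ?_, fun p => ?_, hf.arc, hf.white, hf.black⟩⟩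
  · rw [graphDist_smul hl hc, mul_assoc, ← mul_sub, abs_mul, abs_of_pos hc, ← lt_div_iff₀' hc]
    exact hf.distortion x y
  · obtain ⟨x, hx⟩ := hf.dense p
    exact ⟨x, by rwa [graphDist_smul hl hc, ← lt_div_iff₀' hc]⟩

/-- The midpoint of an edge. -/
def midpoint (e : G.Edge) : G.Point := (e, ⟨1 / 2, by norm_num, by norm_num⟩)

/-- The test function is a tent on `e'` minus a tent on `e`: it is 1-Lipschitz and vanishes at all
vertices. -/
lemma le_graphDist_midpoint {l : G.Edge → ℝ} (hl : l ∈ G.metrics) {e e' : G.Edge} (h : e ≠ e') :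
    (l e + l e') / 2 ≤ graphDist l (midpoint e) (midpoint e') := by
  classical
  let Φ : G.Point → ℝ := fun q => (if q.1 = e then -1 else if q.1 = e' then 1 else 0) *
    (l q.1 * (1 / 2 - |(q.2 : ℝ) - 1 / 2|))
  have h0 : ∀ e, Φ (e, 0) = 0 := fun e => by
    simp only [Φ, Set.Icc.coe_zero, zero_sub, abs_neg]
    rw [abs_of_pos (by norm_num)]
    simp
  have h1 : ∀ e, Φ (e, 1) = 0 := fun e => by
    simp only [Φ, Set.Icc.coe_one]
    rw [abs_of_pos (by norm_num)]
    norm_num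
  have h2 : ∀ e t t', Φ (e, t') ≤ Φ (e, t) + 1 * (l e * |(t : ℝ) - t'|) := by
    intro d t t'
    have e1 := abs_sub_abs_le_abs_sub ((t : ℝ) - 1 / 2) (t' - 1 / 2)
    have e2 := abs_sub_abs_le_abs_sub ((t' : ℝ) - 1 / 2) (t - 1 / 2)
    rw [sub_sub_sub_cancel_right] at e1 e2
    rw [abs_sub_comm (t' : ℝ) t] at e2
    have e3 := mul_le_mul_of_nonneg_left e1 (hl d).le
    have e4 := mul_le_mul_of_nonneg_left e2 (hl d).le
    have e5 := mul_nonneg (hl d).le (abs_nonneg ((t : ℝ) - t'))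
    simp only [Φ]
    split_ifs <;> linarith
  have h3 := le_add_graphDist hl zero_le_one h2 (fun e e' _ => by rw [h0, h0])
    (fun e e' _ => by rw [h1, h1]) (midpoint e) (midpoint e')
  simp only [Φ, midpoint, if_true, if_neg h.symm, sub_self, abs_zero] at h3 ⊢
  linarith

lemma graphDist_midpoint {l : G.Edge → ℝ} (hl : l ∈ G.metrics) {e e' : G.Edge} (h : e ≠ e')
    (hv : e.1 = e'.1) : graphDist l (midpoint e) (midpoint e') = (l e + l e') / 2 := by
  refine le_antisymm ?_ (le_graphDist_midpoint hl h)
  have h1 := (PathOfLength.white e e' _ hv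
    (pathOfLength_segment (l := l) e ⟨1 / 2, by norm_num, by norm_num⟩ 0)).trans
    (pathOfLength_segment e' 0 ⟨1 / 2, by norm_num, by norm_num⟩)
  refine (graphDist_le hl h1).trans (le_of_eq ?_)
  simp only [Set.Icc.coe_zero, sub_zero, zero_sub, abs_neg]
  rw [abs_of_pos (by norm_num)]
  ring

/-- The marking prescribes the images of points on arcs, so their rescaled distances converge to
known distances of the limit. -/
lemma DegeneratesTo.tendsto {m : ℝ → G.Teich} {s : ℝ → ℝ} {l : G.Edge → ℝ}
    (h : DegeneratesTo m s l) {x : ∀ t, (m t).Carrier} {y : ∀ t, (m t).Carrier} {e e' : G.Edge}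
    (hx : ∀ t, ∃ z ∈ ((m t).hex (Sum.inl e.1)).arc e.2, (m t).tile (Sum.inl e.1) z = x t)
    (hy : ∀ t, ∃ z ∈ ((m t).hex (Sum.inl e'.1)).arc e'.2, (m t).tile (Sum.inl e'.1) z = y t) :
    Tendsto (fun t => s t * dist (x t) (y t)) atTop
      (𝓝 (graphDist l (midpoint e) (midpoint e'))) := by
  rw [Metric.tendsto_atTop']
  intro ε hε
  obtain ⟨T, hT⟩ := eventually_atTop.1 (h ε hε)
  refine ⟨T, fun t ht => ?_⟩
  obtain ⟨f, hf⟩ := hT t ht.le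
  have key : ∀ (e : G.Edge) (x : (m t).Carrier),
      (∃ z ∈ ((m t).hex (Sum.inl e.1)).arc e.2, (m t).tile (Sum.inl e.1) z = x) →
      f x = midpoint e := by
    rintro e x ⟨z, hz, rfl⟩
    obtain ⟨h1, h2⟩ := hf.arc e z hz
    exact Prod.ext h1 (Subtype.ext h2)
  have := hf.distortion (x t) (y t)
  rwa [key e _ (hx t), key e' _ (hy t)] at this

/-- Two limits of rescaled surfaces are proportional. -/
lemma DegeneratesTo.eq_smul {m : ℝ → G.Teich} {s s' : ℝ → ℝ} {l l' : G.Edge → ℝ}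
    (hl : l ∈ G.metrics) (hl' : l' ∈ G.metrics) (h : DegeneratesTo m s l)
    (h' : DegeneratesTo m s' l') :
    ∃ c > 0, l' = c • l ∧ Tendsto (fun t => s' t / s t) atTop (𝓝 c) := by
  have hpt : ∀ (e : G.Edge) t, ∃ x : (m t).Carrier,
      ∃ z ∈ ((m t).hex (Sum.inl e.1)).arc e.2, (m t).tile (Sum.inl e.1) z = x := fun e t =>
    ⟨_, _, ((m t).hex _).corner_mem_arc ((m t).region_nonempty _)
      (show e.2 + 1 ≠ e.2 by simp), rfl⟩
  choose x hx using hpt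
  have hlim : ∀ (n : G.W) (i j : Fin 3), i ≠ j → Tendsto (fun t => s' t / s t) atTop
      (𝓝 ((l' (n, i) + l' (n, j)) / (l (n, i) + l (n, j)))) := by
    intro n i j hij
    have hne : ((n, i) : G.Edge) ≠ (n, j) := fun h => hij (Prod.mk.inj h).2
    have h1 := h.tendsto (hx (n, i)) (hx (n, j))
    have h2 := h'.tendsto (hx (n, i)) (hx (n, j))
    rw [graphDist_midpoint hl hne rfl] at h1
    rw [graphDist_midpoint hl' hne rfl] at h2
    have hpos : 0 < (l (n, i) + l (n, j)) / 2 := by linarith [hl (n, i), hl (n, j)]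
    have h3 := h2.div h1 hpos.ne'
    rw [div_div_div_cancel_right₀ two_ne_zero] at h3
    refine h3.congr' ?_
    filter_upwards [h1.eventually_const_lt hpos] with t ht
    exact mul_div_mul_right _ _ (right_ne_zero_of_mul ht.ne')
  obtain ⟨⟨n0, i0⟩⟩ := G.nonempty_edge
  have h01 := hlim n0 0 1 (by decide)
  refine ⟨_, div_pos (add_pos (hl' _) (hl' _)) (add_pos (hl _) (hl _)), ?_, h01⟩
  set c := (l' (n0, 0) + l' (n0, 1)) / (l (n0, 0) + l (n0, 1)) with hc
  -- The limit of `s' t / s t` is the same for every pair of edges, so one constant serves at all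
  -- white vertices. At each of them the three pairwise sums determine the three lengths, and every
  -- edge has a white end.
  have hsum : ∀ n i j, i ≠ j → l' (n, i) + l' (n, j) = c * (l (n, i) + l (n, j)) := by
    intro n i j hij
    have := tendsto_nhds_unique (hlim n i j hij) h01
    rwa [div_eq_iff (add_pos (hl _) (hl _)).ne'] at this
  funext ⟨n, i⟩
  have b1 := hsum n i (i + 1) (by simp)
  have b2 := hsum n i (i + 2) (by simp)
  have b3 := hsum n (i + 1) (i + 2) (by simp)
  rw [Pi.smul_apply, smul_eq_mul]
  linarith

end FatGraph


/-! ### The limits of rays and the four assertions -/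

namespace FatGraph

variable {G : FatGraph}

lemma sum_pos_of_mem_cone {b : G.W × Fin 3 → ℝ} (hb : b ∈ G.cone) : 0 < ∑ k, b k := by
  obtain ⟨e⟩ := G.nonempty_edge
  exact Finset.sum_pos (fun k _ => cone_pos hb k) ⟨e, Finset.mem_univ _⟩

lemma isProjectiveLimit_smul_limitMetric {b : G.W × Fin 3 → ℝ} (hb : b ∈ G.cone) {c : ℝ}
    (hc : 0 < c) {m : ℝ → G.Teich} (hm : IsRay b m) : IsProjectiveLimit m (c • limitMetric b) :=
  ⟨fun t => c * t⁻¹, fun _ ht => mul_pos hc (inv_pos.2 ht),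
    (degeneratesTo_limitMetric hb hm).smul (limitMetric_mem hb) hc⟩

/-- The projective limits of a ray are the multiples of one metric. -/
lemma eq_smul_limitMetric {b : G.W × Fin 3 → ℝ} (hb : b ∈ G.cone) {l : G.Edge → ℝ}
    (hl : l ∈ G.metrics) (h : ∀ m : ℝ → G.Teich, IsRay b m → IsProjectiveLimit m l) :
    ∃ c > (0 : ℝ), l = c • limitMetric b := by
  -- The condition on all rays has content only because a ray exists.
  obtain ⟨m, hm⟩ := exists_ray hb
  obtain ⟨s, -, hs⟩ := h m hm
  obtain ⟨c, hc, h1, -⟩ :=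
    (degeneratesTo_limitMetric hb hm).eq_smul (limitMetric_mem hb) hl hs
  exact ⟨c, hc, h1⟩

/-- Two limits under the same factors are proportional with ratio the limit of `t⁻¹ / t⁻¹`, which is
1. -/
lemma existsUnique_limit {b : G.W × Fin 3 → ℝ} (hb : b ∈ G.cone) :
    ∃! l : G.Edge → ℝ, l ∈ G.metrics ∧
      ∀ m : ℝ → G.Teich, IsRay b m → DegeneratesTo m (fun t => t⁻¹) l := by
  refine ⟨limitMetric b, ⟨limitMetric_mem hb, fun m hm => degeneratesTo_limitMetric hb hm⟩, ?_⟩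
  rintro l ⟨hl, h⟩
  obtain ⟨m, hm⟩ := exists_ray hb
  obtain ⟨c, -, h1, h2⟩ :=
    (degeneratesTo_limitMetric hb hm).eq_smul (limitMetric_mem hb) hl (h m hm)
  have h3 : Tendsto (fun t : ℝ => t⁻¹ / t⁻¹) atTop (𝓝 1) := by
    refine tendsto_const_nhds.congr' ?_
    filter_upwards [eventually_gt_atTop 0] with t ht
    rw [div_self (inv_pos.2 ht).ne']
  rw [h1, tendsto_nhds_unique h2 h3, one_smul]

/-- The projective limits common to all rays of `b` are the positive multiples of one metric. If
that metric has entropy `h`, its multiple by `c` has entropy `h / c`, so exactly `c = h` is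
normalised. -/
lemma existsUnique_projectiveLimit {b : G.W × Fin 3 → ℝ} (hb : b ∈ G.cone) :
    ∃! l : G.Edge → ℝ, l ∈ G.moduliOne ∧
      ∀ m : ℝ → G.Teich, IsRay b m → IsProjectiveLimit m l := by
  obtain ⟨h, h0, hh⟩ := exists_entropy (limitMetric_mem hb)
  refine ⟨h • limitMetric b, ⟨⟨smul_mem_metrics (limitMetric_mem hb) h0, ?_⟩,
    fun m hm => isProjectiveLimit_smul_limitMetric hb h0 hm⟩, ?_⟩
  · have := hh.smul h0
    rwa [div_self h0.ne'] at this
  · rintro l ⟨⟨hl, hl1⟩, hlim⟩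
    obtain ⟨c, hc, rfl⟩ := eq_smul_limitMetric hb hl hlim
    have := hl1.unique (hh.smul hc)
    rw [eq_div_iff hc.ne', one_mul] at this
    rw [this]

/-- The linear bijection between the cone and the metrics reduces the claim to scaling: on each
half-line of the cone exactly one point has coordinate sum 1. -/
lemma existsUnique_coordinates {l : G.Edge → ℝ} (hl : l ∈ G.metrics) :
    ∃! b : G.W × Fin 3 → ℝ, b ∈ G.unitCone ∧
      ∀ m : ℝ → G.Teich, IsRay b m → IsProjectiveLimit m l := by
  obtain ⟨b, hb, rfl⟩ := exists_limitMetric_eq hl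
  have hS := sum_pos_of_mem_cone hb
  have hb' : (∑ k, b k)⁻¹ • b ∈ G.cone := smul_mem_cone hb (inv_pos.2 hS)
  refine ⟨(∑ k, b k)⁻¹ • b, ⟨⟨hb', ?_⟩, fun m hm => ?_⟩, ?_⟩
  · simp only [Pi.smul_apply, smul_eq_mul]
    rw [← Finset.mul_sum, inv_mul_cancel₀ hS.ne']
  · have := isProjectiveLimit_smul_limitMetric hb' hS hm
    rwa [limitMetric_smul, smul_inv_smul₀ hS.ne'] at this
  · rintro b' ⟨⟨hc', hsum⟩, hlim⟩
    obtain ⟨c, hc, h⟩ := eq_smul_limitMetric hc' hl hlim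
    rw [← limitMetric_smul] at h
    have h1 := limitMetric_injective h
    subst h1
    simp only [Pi.smul_apply, smul_eq_mul]
    rw [← Finset.mul_sum, hsum, mul_one, inv_smul_smul₀ hc.ne']

end FatGraph

theorem mainTheorem3 (G : FatGraph) :
    (∀ b ∈ G.cone, ∃ m : ℝ → G.Teich, FatGraph.IsRay b m) ∧
    (∀ b ∈ G.unitCone, ∃! l : G.Edge → ℝ, l ∈ G.metrics ∧
      ∀ m : ℝ → G.Teich, FatGraph.IsRay b m → FatGraph.DegeneratesTo m (fun t => t⁻¹) l) ∧
    (∀ b ∈ G.unitCone, ∃! l : G.Edge → ℝ, l ∈ G.moduliOne ∧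
      ∀ m : ℝ → G.Teich, FatGraph.IsRay b m → FatGraph.IsProjectiveLimit m l) ∧
    (∀ l ∈ G.moduliOne, ∃! b : G.W × Fin 3 → ℝ, b ∈ G.unitCone ∧
      ∀ m : ℝ → G.Teich, FatGraph.IsRay b m → FatGraph.IsProjectiveLimit m l) := by
  exact ⟨fun b hb => FatGraph.exists_ray hb, fun b hb => FatGraph.existsUnique_limit hb.1,
    fun b hb => FatGraph.existsUnique_projectiveLimit hb.1,
    fun l hl => FatGraph.existsUnique_coordinates hl.1⟩

end
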